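/- Let $m,\kappa\in\mathbb C$ with $0<|\mathrm{Re}\,m|<1$ and set $\varsigma:=\kappa\,\Gamma(-m)/\Gamma(m)$. Assume that $(m,\kappa)$ is not an exceptional pair, i.e. it is not the case that $\kappa\neq0$ and that $\mathrm{Im}(w/m)\in\{\pi,-\pi\}$ for some $w\in\mathbb C$ with $e^w=\varsigma$. With $\mathcal J_m(z):=\sqrt{\pi z/2}\,J_m(z)$, $J_m$ the Bessel function, let $\mathcal F^{\mp}_{m,\kappa}$ be the bounded operators on $L^2(\mathbb R_+)$ that extend the integral operators on $C_c^\infty(\mathbb R_+)$ with kernels $$\mathcal F^{\mp}_{m,\kappa}(x,y)=e^{\mp i\frac{\pi}{2}m}\sqrt{\tfrac2\pi}\;\frac{\mathcal J_m(xy)-\varsigma\,\mathcal J_{-m}(xy)\,(y^2/4)^m}{1-\varsigma\,e^{\mp i\pi m}(y^2/4)^m},$$ and let $W^-_{m,\kappa;\frac12,0}:=\mathcal F^-_{m,\kappa}\,(\mathcal F^{+}_{\frac12,0})^{t}$, where $\mathcal F^{+}_{\frac12,0}$ is given by the same formula for the pair $(\frac12,0)$ (so with $\varsigma=0$), and where $B^t$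 is the transpose, $\int (B^tf)\,g=\int f\,(Bg)$. Let $A$ be the self-adjoint generator of the dilation group $[U_tf](x)=e^{t/2}f(e^tx)$, $U_t=e^{itA}$, let $H_D=-\partial_x^2$ be the Dirichlet Laplacian on $L^2(\mathbb R_+)$, and for $t\in\mathbb R$ let $$\Xi_m(t):=e^{i\ln(2)t}\,\frac{\Gamma\big(\frac{m+1+it}{2}\big)}{\Gamma\big(\frac{m+1-it}{2}\big)}.$$ Then the bounded extensions $\mathcal F^-_{m,\kappa}$ and $\mathcal F^+_{\frac12,0}$ exist, and, as operators defined on all of $L^2(\mathbb R_+)$, $$W^-_{m,\kappa;\frac12,0}=e^{i\frac\pi4}\,\Xi_{\frac12}(A)\Big(\Xi_m(-A)-\varsigma\,\Xi_{-m}(-A)\big(\tfrac{H_D}{4}\big)^m\Big)\frac{e^{-i\frac\pi2m}}{1-\varsigma\,e^{-i\pi m}\big(\tfrac{H_D}{4}\big)^m},$$ where functions of $A$ and of $H_D$ are those of the functional calculus of self-adjoint operators, and where the term with the factor $\varsigma$ is $0$ if $\varsigma=0$. -/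

import Mathlib

open MeasureTheory Set Filter Topology
open scoped ContDiff

noncomputable section

/-! ### The Hilbert space `L²(ℝ₊)` -/

/-- Lebesgue measure on `ℝ₊ = (0,∞)`. -/
abbrev volPos : Measure ℝ := volume.restrict (Ioi (0 : ℝ))

/-- The Hilbert space `L²(ℝ₊)`. -/
abbrev L2Pos : Type := Lp ℂ 2 volPos

/-! ### Composition of unbounded operators -/

/-- The product `S T` of two unbounded operators on its natural domain
`{x ∈ Dom T | T x ∈ Dom S}`. -/
def compUnbounded {H : Type*} [AddCommGroup H] [Module ℂ H] (S T : H →ₗ.[ℂ] H) : H →ₗ.[ℂ] H :=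
  S.comp (T.domRestrict ((S.domain.comap T.toFun).map T.domain.subtype)) (by
    rintro ⟨x, hx, hx'⟩
    obtain ⟨y, hy, rfl⟩ := hx
    exact hy)

theorem mem_graph_compUnbounded {H : Type*} [AddCommGroup H] [Module ℂ H] (S T : H →ₗ.[ℂ] H)
    (x z : H) : (x, z) ∈ (compUnbounded S T).graph ↔
      ∃ y, (x, y) ∈ T.graph ∧ (y, z) ∈ S.graph := by
  simp only [LinearPMap.mem_graph_iff]
  constructor
  · rintro ⟨⟨w, ⟨y, hy, rfl⟩, hw'⟩, rfl, rfl⟩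
    exact ⟨T y, ⟨y, rfl, rfl⟩, ⟨⟨T y, hy⟩, rfl, rfl⟩⟩
  · rintro ⟨_, ⟨y, rfl, rfl⟩, ⟨u, hu, rfl⟩⟩
    refine ⟨⟨y, ⟨y, ?_, rfl⟩, y.2⟩, rfl, ?_⟩
    · change T y ∈ S.domain
      rw [← hu]; exact u.2
    · change S ⟨T y, _⟩ = S u
      congr 1
      exact Subtype.ext hu.symm

/-! ### Functional calculus of self-adjoint operators -/

/-- A spectral representation of an operator `T`: a unitary map onto some `L²(X, μ)` that carries
`T`, with its domain, to the maximal operator of multiplication by a real measurable function. -/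
structure SpectralRep {H : Type*} [NormedAddCommGroup H] [InnerProductSpace ℂ H]
    (T : H →ₗ.[ℂ] H) where
  /-- the space on which the operator is diagonal -/
  X : Type
  [mX : MeasurableSpace X]
  /-- its measure -/
  μ : Measure X
  /-- the diagonalizing unitary map -/
  V : H ≃ₗᵢ[ℂ] Lp ℂ 2 μ
  /-- the multiplier -/
  a : X → ℝ
  measurable_a : Measurable a
  mem_graph_iff : ∀ f g : H, (f, g) ∈ T.graph ↔ (V g : X → ℂ) =ᵐ[μ] fun x => (a x : ℂ) * V f x

attribute [instance] SpectralRep.mX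

/-- The graph of `φ(T) = V⁻¹ (φ ∘ a) V`, on its maximal domain. -/
def SpectralRep.fcGraph {H : Type*} [NormedAddCommGroup H] [InnerProductSpace ℂ H]
    {T : H →ₗ.[ℂ] H} (R : SpectralRep T) (φ : ℝ → ℂ) : Submodule ℂ (H × H) where
  carrier := {p | (R.V p.2 : R.X → ℂ) =ᵐ[R.μ] fun x => φ (R.a x) * R.V p.1 x}
  zero_mem' := by
    simp only [mem_ofPred_eq, Prod.fst_zero, Prod.snd_zero, map_zero]
    filter_upwards [Lp.coeFn_zero ℂ 2 R.μ] with x hx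
    rw [hx]; simp
  add_mem' := by
    intro p q hp hq
    simp only [mem_ofPred_eq, Prod.fst_add, Prod.snd_add, map_add] at hp hq ⊢
    filter_upwards [Lp.coeFn_add (R.V p.1) (R.V q.1), Lp.coeFn_add (R.V p.2) (R.V q.2), hp, hq]
      with x h1 h2 h3 h4
    rw [h1, h2, Pi.add_apply, Pi.add_apply, h3, h4, mul_add]
  smul_mem' := by
    intro c p hp
    simp only [mem_ofPred_eq, Prod.smul_fst, Prod.smul_snd, map_smul] at hp ⊢
    filter_upwards [Lp.coeFn_smul c (R.V p.1), Lp.coeFn_smul c (R.V p.2), hp] with x h1 h2 h3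
    rw [h1, h2, Pi.smul_apply, Pi.smul_apply, h3, smul_eq_mul, smul_eq_mul]
    ring

/-- The operator `φ(T) = V⁻¹ (φ ∘ a) V` of the Borel functional calculus, on its maximal
domain; `φ` need not be bounded. -/
def SpectralRep.fc {H : Type*} [NormedAddCommGroup H] [InnerProductSpace ℂ H]
    {T : H →ₗ.[ℂ] H} (R : SpectralRep T) (φ : ℝ → ℂ) : H →ₗ.[ℂ] H :=
  (R.fcGraph φ).toLinearPMap

theorem SpectralRep.mem_graph_fc {H : Type*} [NormedAddCommGroup H] [InnerProductSpace ℂ H]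
    {T : H →ₗ.[ℂ] H} (R : SpectralRep T) (φ : ℝ → ℂ) (f g : H) :
    (f, g) ∈ (R.fc φ).graph ↔ (R.V g : R.X → ℂ) =ᵐ[R.μ] fun x => φ (R.a x) * R.V f x := by
  rw [SpectralRep.fc, Submodule.toLinearPMap_graph_eq]
  · rfl
  · rintro ⟨x, y⟩ h (rfl : x = 0)
    change (R.V y : R.X → ℂ) =ᵐ[R.μ] fun x => φ (R.a x) * R.V 0 x at h
    change y = 0
    rw [map_zero] at h
    rw [← LinearIsometryEquiv.map_eq_zero_iff R.V]
    refine Lp.ext (h.trans ?_)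
    filter_upwards [Lp.coeFn_zero ℂ 2 R.μ] with x hx
    rw [hx]; simp

/-! ### The generator of dilations -/

theorem map_volPos_exp_mul (t : ℝ) :
    Measure.map (fun x => Real.exp t * x) volPos = ENNReal.ofReal (Real.exp (-t)) • volPos := by
  have hpre : (fun x : ℝ => Real.exp t * x) ⁻¹' (Ioi 0) = Ioi 0 := by
    ext x; simp [Real.exp_pos]
  have h := Measure.restrict_map (μ := (volume : Measure ℝ)) (measurable_const_mul (Real.exp t))
    (measurableSet_Ioi (a := (0 : ℝ)))
  rw [hpre] at h
  rw [volPos, ← h, Real.map_volume_mul_left (Real.exp_pos t).ne', Measure.restrict_smul,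
    abs_of_pos (inv_pos.2 (Real.exp_pos t)), Real.exp_neg]

theorem quasiMeasurePreserving_exp_mul (t : ℝ) :
    Measure.QuasiMeasurePreserving (fun x : ℝ => Real.exp t * x) volPos volPos :=
  ⟨measurable_const_mul _, by
    rw [map_volPos_exp_mul]; exact Measure.smul_absolutelyContinuous⟩

theorem memLp_dilation (t : ℝ) (f : L2Pos) :
    MemLp (fun x : ℝ => (Real.exp (t / 2) : ℂ) * f (Real.exp t * x)) 2 volPos := by
  have h1 : MemLp (f : ℝ → ℂ) 2 (Measure.map (fun x => Real.exp t * x) volPos) := by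
    rw [map_volPos_exp_mul]
    exact (Lp.memLp f).smul_measure ENNReal.ofReal_ne_top
  have h2 := (memLp_map_measure_iff h1.1 (measurable_const_mul (Real.exp t)).aemeasurable).1 h1
  exact h2.const_mul _

/-- The dilation group `[U_t f](x) = e^{t/2} f(e^t x)`. -/
def dilation (t : ℝ) : L2Pos →ₗ[ℂ] L2Pos where
  toFun f := (memLp_dilation t f).toLp _
  map_add' f g := by
    rw [← MemLp.toLp_add]
    refine MemLp.toLp_congr _ _ ?_
    filter_upwards [(quasiMeasurePreserving_exp_mul t).ae (Lp.coeFn_add f g)] with x hx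
    simp only [hx, Pi.add_apply, mul_add]
  map_smul' c f := by
    rw [RingHom.id_apply, ← MemLp.toLp_const_smul]
    refine MemLp.toLp_congr _ _ ?_
    filter_upwards [(quasiMeasurePreserving_exp_mul t).ae (Lp.coeFn_smul c f)] with x hx
    simp only [hx, Pi.smul_apply, smul_eq_mul]
    ring

/-- The graph of the generator `A` of the dilation group, normalized by `U_t = e^{i t A}`:
`A f = lim_{t → 0} (i t)⁻¹ (U_t f - f)`, the domain consisting of all `f` for which the limit
exists in norm. -/
def dilationGeneratorGraph : Submodule ℂ (L2Pos × L2Pos) where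
  carrier := {p | Tendsto (fun t : ℝ => (Complex.I * (t : ℂ))⁻¹ • (dilation t p.1 - p.1))
    (𝓝[≠] 0) (𝓝 p.2)}
  zero_mem' := by simp
  add_mem' := by
    intro p q hp hq
    refine (Tendsto.add hp hq).congr fun t => ?_
    rw [← smul_add, Prod.fst_add, map_add]
    congr 1; abel
  smul_mem' := by
    intro c p hp
    refine (Tendsto.const_smul hp c).congr fun t => ?_
    rw [smul_comm, Prod.smul_fst, map_smul, smul_sub]

/-- The generator `A` of dilations. -/
def dilationGenerator : L2Pos →ₗ.[ℂ] L2Pos := dilationGeneratorGraph.toLinearPMap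

theorem mem_graph_dilationGenerator (f g : L2Pos) :
    (f, g) ∈ dilationGenerator.graph ↔
      Tendsto (fun t : ℝ => (Complex.I * (t : ℂ))⁻¹ • (dilation t f - f)) (𝓝[≠] 0) (𝓝 g) := by
  rw [dilationGenerator, Submodule.toLinearPMap_graph_eq]
  · rfl
  · rintro ⟨x, y⟩ h (rfl : x = 0)
    change Tendsto _ _ (𝓝 y) at h
    refine tendsto_nhds_unique h ?_
    simp

/-! ### The Dirichlet Laplacian on the half-line -/

theorem intervalIntegrable_of_L2Pos (v : L2Pos) {x y : ℝ} (hx : 0 ≤ x) (hy : 0 ≤ y) :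
    IntervalIntegrable v volume x y := by
  have h : ∀ z : ℝ, IntegrableOn v (Ioc 0 z) volume := by
    intro z
    have h1 : MemLp (v : ℝ → ℂ) 2 (volume.restrict (Ioc 0 z)) :=
      (Lp.memLp v).mono_measure (Measure.restrict_mono Ioc_subset_Ioi_self le_rfl)
    exact h1.integrable (by norm_num)
  have h0 : ∀ z : ℝ, 0 ≤ z → IntervalIntegrable v volume 0 z := fun z hz =>
    (intervalIntegrable_iff_integrableOn_Ioc_of_le hz).2 (h z)
  exact (h0 x hx).symm.trans (h0 y hy)

theorem intervalIntegrable_sub_primitive (c : ℂ) (v : L2Pos) {x : ℝ} (hx : 0 ≤ x) :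
    IntervalIntegrable (fun s => c - ∫ t in (0 : ℝ)..s, v t) volume 0 x := by
  refine ContinuousOn.intervalIntegrable (continuousOn_const.sub ?_)
  have h := intervalIntegral.continuousOn_primitive_interval'
    (intervalIntegrable_of_L2Pos v le_rfl hx) (left_mem_uIcc)
  exact h

/-- The graph of the Dirichlet Laplacian `H_D = -∂ₓ²`: `u` has an absolutely continuous
representative with absolutely continuous derivative, `u(0) = 0`, and `-u'' = v ∈ L²(ℝ₊)`.
Both integrations are written out; `c` is the value `u'(0)`. -/
def dirichletLaplacianGraph : Submodule ℂ (L2Pos × L2Pos) where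
  carrier := {p | ∃ c : ℂ,
    (p.1 : ℝ → ℂ) =ᵐ[volPos] fun x => ∫ s in (0 : ℝ)..x, (c - ∫ t in (0 : ℝ)..s, p.2 t)}
  zero_mem' := by
    refine ⟨0, ?_⟩
    have hz : ((0 : L2Pos) : ℝ → ℂ) =ᵐ[volPos] 0 := Lp.coeFn_zero ℂ 2 volPos
    filter_upwards [hz, ae_restrict_mem measurableSet_Ioi] with x hx hx0
    rw [Prod.fst_zero, hx, Pi.zero_apply, Prod.snd_zero]
    symm
    rw [intervalIntegral.integral_of_le (le_of_lt hx0)]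
    refine setIntegral_eq_zero_of_forall_eq_zero fun s hs => ?_
    rw [zero_sub, neg_eq_zero, intervalIntegral.integral_of_le hs.1.le]
    refine integral_eq_zero_of_ae ?_
    exact ae_mono (Measure.restrict_mono Ioc_subset_Ioi_self le_rfl) hz
  add_mem' := by
    rintro ⟨u, v⟩ ⟨u', v'⟩ ⟨c, hc⟩ ⟨c', hc'⟩
    refine ⟨c + c', ?_⟩
    simp only [Prod.mk_add_mk] at hc hc' ⊢
    filter_upwards [hc, hc', Lp.coeFn_add u u', ae_restrict_mem measurableSet_Ioi]
      with x h1 h2 h3 hx0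
    have hx0' : (0 : ℝ) ≤ x := le_of_lt hx0
    rw [h3, Pi.add_apply, h1, h2,
      ← intervalIntegral.integral_add (intervalIntegrable_sub_primitive c v hx0')
        (intervalIntegrable_sub_primitive c' v' hx0')]
    refine intervalIntegral.integral_congr fun s hs => ?_
    rw [uIcc_of_le hx0'] at hs
    have : ∫ t in (0 : ℝ)..s, (v + v' : L2Pos) t
        = (∫ t in (0 : ℝ)..s, v t) + ∫ t in (0 : ℝ)..s, v' t := by
      rw [← intervalIntegral.integral_add (intervalIntegrable_of_L2Pos v le_rfl hs.1)
        (intervalIntegrable_of_L2Pos v' le_rfl hs.1), intervalIntegral.integral_of_le hs.1,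
        intervalIntegral.integral_of_le hs.1]
      exact integral_congr_ae
        (ae_mono (Measure.restrict_mono Ioc_subset_Ioi_self le_rfl) (Lp.coeFn_add v v'))
    simp only [this]
    ring
  smul_mem' := by
    rintro a ⟨u, v⟩ ⟨c, hc⟩
    refine ⟨a * c, ?_⟩
    simp only [Prod.smul_mk] at hc ⊢
    filter_upwards [hc, Lp.coeFn_smul a u, ae_restrict_mem measurableSet_Ioi] with x h1 h3 hx0
    have hx0' : (0 : ℝ) ≤ x := le_of_lt hx0
    rw [h3, Pi.smul_apply, h1, smul_eq_mul, ← intervalIntegral.integral_const_mul]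
    refine intervalIntegral.integral_congr fun s hs => ?_
    rw [uIcc_of_le hx0'] at hs
    have : ∫ t in (0 : ℝ)..s, (a • v : L2Pos) t = a * ∫ t in (0 : ℝ)..s, v t := by
      rw [← intervalIntegral.integral_const_mul, intervalIntegral.integral_of_le hs.1,
        intervalIntegral.integral_of_le hs.1]
      exact integral_congr_ae
        (ae_mono (Measure.restrict_mono Ioc_subset_Ioi_self le_rfl) (Lp.coeFn_smul a v))
    simp only [this]
    ring

theorem dirichletLaplacianGraph_snd_eq_zero (v : L2Pos)
    (h : ((0 : L2Pos), v) ∈ dirichletLaplacianGraph) : v = 0 := by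
  obtain ⟨c, hc⟩ := h
  simp only at hc
  have hz : ((0 : L2Pos) : ℝ → ℂ) =ᵐ[volPos] 0 := Lp.coeFn_zero ℂ 2 volPos
  set w : ℝ → ℂ := (Ioi (0 : ℝ)).indicator v with hw
  have hwi : ∀ x y : ℝ, IntervalIntegrable w volume x y := by
    have h1 : MemLp w 2 volume := (memLp_indicator_iff_restrict measurableSet_Ioi).2 (Lp.memLp v)
    intro x y
    exact ((h1.locallyIntegrable (by norm_num)).integrableOn_isCompact
      isCompact_uIcc).intervalIntegrable
  have hwv : ∀ s : ℝ, 0 ≤ s → ∫ t in (0 : ℝ)..s, v t = ∫ t in (0 : ℝ)..s, w t := by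
    intro s hs
    rw [intervalIntegral.integral_of_le hs, intervalIntegral.integral_of_le hs]
    refine setIntegral_congr_fun measurableSet_Ioc fun t ht => ?_
    rw [hw, indicator_of_mem (show t ∈ Ioi (0 : ℝ) from ht.1)]
  have hPc : Continuous fun s : ℝ => c - ∫ t in (0 : ℝ)..s, w t :=
    continuous_const.sub (intervalIntegral.continuous_primitive hwi 0)
  have hFd : ∀ x : ℝ, HasDerivAt (fun x => ∫ s in (0 : ℝ)..x, (c - ∫ t in (0 : ℝ)..s, w t))
      (c - ∫ t in (0 : ℝ)..x, w t) x := fun x => hPc.integral_hasStrictDerivAt 0 x |>.hasDerivAt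
  have hae : (fun _ : ℝ => (0 : ℂ)) =ᵐ[volume.restrict (Ioi (0 : ℝ))]
      fun x => ∫ s in (0 : ℝ)..x, (c - ∫ t in (0 : ℝ)..s, w t) := by
    filter_upwards [hc, hz, ae_restrict_mem measurableSet_Ioi] with x h1 h2 hx0
    rw [h2, Pi.zero_apply] at h1
    rw [h1]
    refine intervalIntegral.integral_congr fun s hs => ?_
    rw [uIcc_of_le (le_of_lt hx0)] at hs
    simp only [hwv s hs.1]
  have hEq := Measure.eqOn_open_of_ae_eq hae isOpen_Ioi continuousOn_const
    (fun x _ => (hFd x).continuousAt.continuousWithinAt)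
  have hP : ∀ x : ℝ, 0 < x → c - ∫ t in (0 : ℝ)..x, w t = 0 := by
    intro x hx
    have h0 : HasDerivAt (fun _ : ℝ => (0 : ℂ)) (c - ∫ t in (0 : ℝ)..x, w t) x :=
      (hFd x).congr_of_eventuallyEq (by
        filter_upwards [Ioi_mem_nhds hx] with y hy using hEq hy)
    exact h0.unique (hasDerivAt_const x 0)
  have hloc : LocallyIntegrable w volume :=
    (memLp_indicator_iff_restrict measurableSet_Ioi |>.2 (Lp.memLp v)).locallyIntegrable
      (by norm_num)
  refine Lp.ext ?_
  filter_upwards [hz, ae_restrict_mem measurableSet_Ioi,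
    ae_restrict_of_ae (LocallyIntegrable.ae_hasDerivAt_integral hloc)] with x hx hx0 hd
  rw [hx, Pi.zero_apply]
  have hd0 := hd 0
  have h0 : HasDerivAt (fun _ : ℝ => c) (w x) x :=
    hd0.congr_of_eventuallyEq (by
      filter_upwards [Ioi_mem_nhds hx0] with y hy using sub_eq_zero.1 (hP y hy))
  have := h0.unique (hasDerivAt_const x c)
  rwa [hw, indicator_of_mem hx0] at this

/-- The Dirichlet Laplacian `H_D` on the half-line. -/
def dirichletLaplacian : L2Pos →ₗ.[ℂ] L2Pos := dirichletLaplacianGraph.toLinearPMap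

theorem mem_graph_dirichletLaplacian (u v : L2Pos) :
    (u, v) ∈ dirichletLaplacian.graph ↔ ∃ c : ℂ,
      (u : ℝ → ℂ) =ᵐ[volPos] fun x => ∫ s in (0 : ℝ)..x, (c - ∫ t in (0 : ℝ)..s, v t) := by
  rw [dirichletLaplacian, Submodule.toLinearPMap_graph_eq]
  · rfl
  · rintro ⟨x, y⟩ h (rfl : x = 0)
    exact dirichletLaplacianGraph_snd_eq_zero y h

/-! ### Hankel transformations and wave operators -/

/-- The Bessel function of the first kind `J_m(z)`, for real `z > 0` and complex order `m`
(the reciprocal of `Γ` is `0` at the poles of `Γ`). -/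
def besselJ (m : ℂ) (z : ℝ) : ℂ :=
  ∑' k : ℕ, (-1) ^ k / ((k.factorial : ℂ) * Complex.Gamma (m + k + 1)) *
    ((z / 2 : ℝ) : ℂ) ^ (m + 2 * k)

/-- `𝒥_m(z) = √(π z / 2) J_m(z)`. -/
def besselJHalf (m : ℂ) (z : ℝ) : ℂ := (Real.sqrt (Real.pi * z / 2) : ℂ) * besselJ m z

/-- `ς = κ Γ(-m) / Γ(m)`. -/
def varsigma (m κ : ℂ) : ℂ := κ * Complex.Gamma (-m) / Complex.Gamma m

/-- `(m, κ)` is exceptional: `κ ≠ 0`, and `π` or `-π` is the imaginary part of `w / m` for some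
value `w` of the multivalued logarithm of `ς`. -/
def IsExceptionalPair (m κ : ℂ) : Prop :=
  κ ≠ 0 ∧ ∃ w : ℂ, Complex.exp w = varsigma m κ ∧
    ((w / m).im = Real.pi ∨ (w / m).im = -Real.pi)

/-- The kernel of the Hankel transformation `ℱ^±_{m,κ}`; `ε = 1` for the sign `+`, `ε = -1` for
the sign `-`. -/
def hankelKernel (ε : ℤ) (m κ : ℂ) (x y : ℝ) : ℂ :=
  Complex.exp (ε * Complex.I * (Real.pi / 2) * m) * (Real.sqrt (2 / Real.pi) : ℂ) *
    ((besselJHalf m (x * y) -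
        varsigma m κ * besselJHalf (-m) (x * y) * ((y ^ 2 / 4 : ℝ) : ℂ) ^ m) /
      (1 - varsigma m κ * Complex.exp (ε * Complex.I * Real.pi * m) *
        ((y ^ 2 / 4 : ℝ) : ℂ) ^ m))

/-- `F` is a bounded extension to `L²(ℝ₊)` of the integral operator with kernel
`ℱ^±_{m,κ}(x, y)` on `C_c^∞(ℝ₊)`. -/
def IsHankelExtension (ε : ℤ) (m κ : ℂ) (F : L2Pos →L[ℂ] L2Pos) : Prop :=
  ∀ (h : ℝ → ℂ) (f : L2Pos), ContDiff ℝ ∞ h → HasCompactSupport h → tsupport h ⊆ Ioi 0 →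
    (f : ℝ → ℂ) =ᵐ[volPos] h →
      (F f : ℝ → ℂ) =ᵐ[volPos] fun x => ∫ y in Ioi (0 : ℝ), hankelKernel ε m κ x y * h y

open Classical in
/-- The Hankel transformation `ℱ^±_{m,κ}` as a bounded operator on `L²(ℝ₊)` (it is `0` if there
is no bounded extension). -/
def hankelTransform (ε : ℤ) (m κ : ℂ) : L2Pos →L[ℂ] L2Pos :=
  if h : ∃ F, IsHankelExtension ε m κ F then h.choose else 0

theorem L2Pos.norm_star (f : L2Pos) : ‖star f‖ = ‖f‖ := by
  rw [Lp.norm_def, Lp.norm_def, eLpNorm_congr_ae (Lp.coeFn_star f), eLpNorm_star]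

theorem L2Pos.star_add (f g : L2Pos) : star (f + g) = star f + star g := by
  refine Lp.ext ?_
  filter_upwards [Lp.coeFn_star (f + g), Lp.coeFn_add f g, Lp.coeFn_add (star f) (star g),
    Lp.coeFn_star f, Lp.coeFn_star g] with x h1 h2 h3 h4 h5
  rw [h1, h3, Pi.star_apply, h2, Pi.add_apply, Pi.add_apply, h4, h5, Pi.star_apply,
    Pi.star_apply, StarAddMonoid.star_add]

theorem L2Pos.star_smul (c : ℂ) (f : L2Pos) : star (c • f) = star c • star f := by
  refine Lp.ext ?_
  filter_upwards [Lp.coeFn_star (c • f), Lp.coeFn_smul c f, Lp.coeFn_smul (star c) (star f),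
    Lp.coeFn_star f] with x h1 h2 h3 h4
  rw [h1, h3, Pi.star_apply, h2, Pi.smul_apply, Pi.smul_apply, h4, Pi.star_apply,
    smul_eq_mul, smul_eq_mul, star_mul']

/-- The transpose `B^t` of a bounded operator on `L²(ℝ₊)`, with kernel `B^t(x, y) = B(y, x)`:
the adjoint conjugated by the complex conjugation. -/
def transposeOp (B : L2Pos →L[ℂ] L2Pos) : L2Pos →L[ℂ] L2Pos :=
  LinearMap.mkContinuous
    { toFun := fun f => star (ContinuousLinearMap.adjoint B (star f))
      map_add' := by intro f g; rw [L2Pos.star_add, map_add, L2Pos.star_add]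
      map_smul' := by
        intro c f
        rw [L2Pos.star_smul, map_smul, L2Pos.star_smul, star_star, RingHom.id_apply] }
    ‖ContinuousLinearMap.adjoint B‖ (by
      intro f
      change ‖star (ContinuousLinearMap.adjoint B (star f))‖ ≤ _
      rw [L2Pos.norm_star, ← L2Pos.norm_star f]
      exact ContinuousLinearMap.le_opNorm _ _)

/-- The defining bilinear property of the transpose. -/
theorem integral_transposeOp_mul (B : L2Pos →L[ℂ] L2Pos) (f g : L2Pos) :
    ∫ x, transposeOp B f x * g x ∂volPos = ∫ x, f x * B g x ∂volPos := by
  have h := ContinuousLinearMap.adjoint_inner_left B g (star f)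
  rw [L2.inner_def, L2.inner_def] at h
  have e1 : ∀ᵐ x ∂volPos, inner ℂ (ContinuousLinearMap.adjoint B (star f) x) (g x)
      = transposeOp B f x * g x := by
    filter_upwards [Lp.coeFn_star (ContinuousLinearMap.adjoint B (star f))] with x hx
    change _ = (star (ContinuousLinearMap.adjoint B (star f)) : L2Pos) x * g x
    rw [hx, Pi.star_apply, RCLike.inner_apply']
    rfl
  have e2 : ∀ᵐ x ∂volPos, inner ℂ ((star f : L2Pos) x) (B g x) = f x * B g x := by
    filter_upwards [Lp.coeFn_star f] with x hx
    rw [hx, Pi.star_apply, RCLike.inner_apply', starRingEnd_apply, star_star]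
  rw [← integral_congr_ae e1, ← integral_congr_ae e2]
  exact h

/-- The wave operator `W^-_{m,κ;m',κ'} = ℱ^-_{m,κ} (ℱ^+_{m',κ'})^t`. -/
def waveMinus (m κ m' κ' : ℂ) : L2Pos →L[ℂ] L2Pos :=
  (hankelTransform (-1) m κ).comp (transposeOp (hankelTransform 1 m' κ'))

/-! ### The functions in the formula -/

/-- `Ξ_m(t) = e^{i ln(2) t} Γ((m + 1 + i t) / 2) / Γ((m + 1 - i t) / 2)`. -/
def Xi (m : ℂ) (t : ℝ) : ℂ :=
  Complex.exp (Complex.I * Real.log 2 * t) *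
    (Complex.Gamma ((m + 1 + Complex.I * t) / 2) / Complex.Gamma ((m + 1 - Complex.I * t) / 2))

/-- `ς (l / 4)^m`. -/
def sigmaPow (m κ : ℂ) (l : ℝ) : ℂ := varsigma m κ * ((l / 4 : ℝ) : ℂ) ^ m

/-- `e^{-iπm/2} / (1 - ς e^{-iπm} (l / 4)^m)`. -/
def lastFactor (m κ : ℂ) (l : ℝ) : ℂ :=
  Complex.exp (-Complex.I * (Real.pi / 2) * m) /
    (1 - varsigma m κ * Complex.exp (-Complex.I * Real.pi * m) * ((l / 4 : ℝ) : ℂ) ^ m)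

end

/-!
The proof writes every operator in the formula in terms of two unitary maps.

The Mellin transform on the line `Re s = 1/2` (`mellinL2`) turns dilations into phases, and hence
the generator `A` into the multiplication by `-2πξ` (`dilationRep`). For `Re m > -1` the operator
`hankel m`, defined on Mellin transforms by `f̂(ξ) ↦ Ξ_m(2πξ) f̂(-ξ)`, is bounded, because `Γ`
changes at most by a bounded factor under a fixed imaginary shift along a vertical line
(`isSymbol_Xi`). Its integral kernel is `√(xy) J_m(xy)`. Both the operator and the integral send
the Gaussian `x^{m+1/2} e^{-λx²/2}` to `λ^{-m-1} x^{m+1/2} e^{-x²/(2λ)}`, the operator by the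
Mellin transform of the Gaussian (`hankel_gaussFun`), the integral by integrating the Bessel
series term by term (`integral_hankelFun_gaussFun`). Pairing with Gaussians then shows that, for a
suitable `f`, both give functions with the same Gaussian integrals, and these determine an
integrable function by the Weierstrass approximation theorem (`ae_eq_zero_of_gauss_moments`). This
is `hankel_ae`; it needs no asymptotics of Bessel functions.

For `m = 1/2` the kernel is `√(2/π) sin(xy)`. The sine transformation `S = hankel (1/2)` is
unitary, self-adjoint, real and involutive, and turns the Dirichlet Laplacian `H_D` into the
multiplication by `x²` (`dirichletRep`). From the action on Mellin transforms and `Ξ_{1/2}(-t)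
Ξ_{1/2}(t) = 1` one reads off `hankel m = Ξ_{1/2}(A) Ξ_m(-A) S` (`bfc_Xi_bfc_Xi_sineTransform`).

The kernel `ℱ^-_{m,κ}(x, y)` is `√(xy) J_m(xy) g(y²) - √(xy) J_{-m}(xy) ς (y²/4)^m g(y²)`, where
`g` is the last factor of the formula. Since `(m, κ)` is not exceptional, the denominator of `g`
has no zero; if `ς ≠ 0` it tends to `1` at one end of `(0, ∞)` and to infinity at the other, so it
is bounded away from zero (`exists_le_norm_denominator`), and both `g` and `ς (y²/4)^m g` are
bounded. So `ℱ^-_{m,κ}` is `hankel m ∘ g - hankel (-m) ∘ ς (y²/4)^m g`, with multiplication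
operators on the right. The transpose of `ℱ^+_{1/2,0} = e^{iπ/4} S` is `e^{iπ/4} S`, and since a
function of `y²`, multiplied by `S` from both sides, is that function of `H_D`, the formula
follows.

The statement admits arbitrary spectral representations of `A` and `H_D`. Functions of an operator
do not depend on the representation (`SpectralRep.fc_congr`): the resolvent `(T + i)⁻¹` is
determined by the graph of `T`, hence so are the spectral measures, by the Stone–Weierstrass
theorem, hence all bounded functions of `T`; the unbounded ones are reduced to these.
-/

noncomputable section

/-! ### Bounded multiplication operators -/

/-- A bounded measurable function, the symbol of a bounded multiplication operator. -/
structure IsSymbol {X : Type*} [MeasurableSpace X] (φ : X → ℂ) : Prop where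
  measurable : Measurable φ
  bounded : ∃ C, ∀ x, ‖φ x‖ ≤ C

namespace IsSymbol

variable {X Y : Type*} [MeasurableSpace X] [MeasurableSpace Y] {φ ψ : X → ℂ}

theorem comp (h : IsSymbol φ) {g : Y → X} (hg : Measurable g) : IsSymbol fun y => φ (g y) :=
  ⟨h.1.comp hg, h.2.imp fun _ hC y => hC (g y)⟩

theorem const (c : ℂ) : IsSymbol fun _ : X => c := ⟨measurable_const, ‖c‖, fun _ => le_rfl⟩

theorem add (h : IsSymbol φ) (h' : IsSymbol ψ) : IsSymbol fun x => φ x + ψ x := by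
  obtain ⟨C, hC⟩ := h.2
  obtain ⟨D, hD⟩ := h'.2
  exact ⟨h.1.add h'.1, C + D, fun x => (norm_add_le _ _).trans (add_le_add (hC x) (hD x))⟩

theorem mul (h : IsSymbol φ) (h' : IsSymbol ψ) : IsSymbol fun x => φ x * ψ x := by
  obtain ⟨C, hC⟩ := h.2
  obtain ⟨D, hD⟩ := h'.2
  refine ⟨h.1.mul h'.1, C * D, fun x => ?_⟩
  rw [norm_mul]
  exact mul_le_mul (hC x) (hD x) (norm_nonneg _) ((norm_nonneg _).trans (hC x))

theorem star (h : IsSymbol φ) : IsSymbol fun x => starRingEnd ℂ (φ x) := by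
  obtain ⟨C, hC⟩ := h.2
  exact ⟨Complex.continuous_conj.measurable.comp h.1, C, fun x => by simpa using hC x⟩

theorem memLp_mul (h : IsSymbol φ) {μ : Measure X} (f : Lp ℂ 2 μ) :
    MemLp (fun x => φ x * f x) 2 μ := by
  obtain ⟨C, hC⟩ := h.2
  exact (Lp.memLp f).mul (memLp_top_of_bound h.1.aestronglyMeasurable C (ae_of_all _ hC))

end IsSymbol

/-- The operator of multiplication by the bounded measurable function `φ` on `L²(X, μ)`. -/
def mulL2 {X : Type*} [MeasurableSpace X] (μ : Measure X) (φ : X → ℂ) (h : IsSymbol φ) :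
    Lp ℂ 2 μ →L[ℂ] Lp ℂ 2 μ :=
  LinearMap.mkContinuous
    { toFun := fun f => (h.memLp_mul f).toLp _
      map_add' := by
        intro f g
        rw [← MemLp.toLp_add]
        refine MemLp.toLp_congr _ _ ?_
        filter_upwards [Lp.coeFn_add f g] with x hx
        rw [hx, Pi.add_apply, Pi.add_apply, mul_add]
      map_smul' := by
        intro c f
        rw [RingHom.id_apply, ← MemLp.toLp_const_smul]
        refine MemLp.toLp_congr _ _ ?_
        filter_upwards [Lp.coeFn_smul c f] with x hx
        rw [hx, Pi.smul_apply, Pi.smul_apply, smul_eq_mul, smul_eq_mul]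
        ring }
    h.bounded.choose (by
      intro f
      refine Lp.norm_le_mul_norm_of_ae_le_mul ?_
      filter_upwards [(h.memLp_mul f).coeFn_toLp] with x hx
      change ‖((h.memLp_mul f).toLp _ : X → ℂ) x‖ ≤ _
      rw [hx, norm_mul]
      exact mul_le_mul_of_nonneg_right (h.bounded.choose_spec x) (norm_nonneg _))

theorem mulL2_ae {X : Type*} [MeasurableSpace X] {μ : Measure X} {φ : X → ℂ} (h : IsSymbol φ)
    (f : Lp ℂ 2 μ) : (mulL2 μ φ h f : X → ℂ) =ᵐ[μ] fun x => φ x * f x :=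
  (h.memLp_mul f).coeFn_toLp

theorem mulL2_eq_iff {X : Type*} [MeasurableSpace X] {μ : Measure X} {φ : X → ℂ} (h : IsSymbol φ)
    (f g : Lp ℂ 2 μ) : mulL2 μ φ h f = g ↔ (g : X → ℂ) =ᵐ[μ] fun x => φ x * f x := by
  constructor
  · rintro rfl; exact mulL2_ae h f
  · intro hg; exact Lp.ext ((mulL2_ae h f).trans hg.symm)

theorem mulL2_mulL2 {X : Type*} [MeasurableSpace X] {μ : Measure X} {φ ψ : X → ℂ}
    (h : IsSymbol φ) (h' : IsSymbol ψ) (f : Lp ℂ 2 μ) :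
    mulL2 μ φ h (mulL2 μ ψ h' f) = mulL2 μ (fun x => φ x * ψ x) (h.mul h') f := by
  rw [mulL2_eq_iff]
  filter_upwards [mulL2_ae (h.mul h') f, mulL2_ae h' f] with x h1 h2
  rw [h1, h2, mul_assoc]

theorem inner_mulL2_left {X : Type*} [MeasurableSpace X] {μ : Measure X} {φ : X → ℂ}
    (h : IsSymbol φ) (f g : Lp ℂ 2 μ) :
    inner ℂ (mulL2 μ φ h f) g = inner ℂ f (mulL2 μ _ h.star g) := by
  rw [L2.inner_def, L2.inner_def]
  refine integral_congr_ae ?_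
  filter_upwards [mulL2_ae h f, mulL2_ae h.star g] with x h1 h2
  rw [h1, h2, RCLike.inner_apply', RCLike.inner_apply', map_mul]
  ring

/-! ### Independence of the functional calculus of the spectral representation -/

namespace SpectralRep

variable {H : Type*} [NormedAddCommGroup H] [InnerProductSpace ℂ H] {T : H →ₗ.[ℂ] H}

/-- The bounded operator `φ(T)` for a bounded measurable function `φ`. -/
def bfc (R : SpectralRep T) (φ : ℝ → ℂ) (h : IsSymbol φ) : H →L[ℂ] H :=
  (R.V.symm.toContinuousLinearEquiv : Lp ℂ 2 R.μ →L[ℂ] H) ∘L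
    mulL2 R.μ (fun x => φ (R.a x)) (h.comp R.measurable_a) ∘L
      (R.V.toContinuousLinearEquiv : H →L[ℂ] Lp ℂ 2 R.μ)

theorem V_bfc (R : SpectralRep T) {φ : ℝ → ℂ} (h : IsSymbol φ) (f : H) :
    R.V (R.bfc φ h f) = mulL2 R.μ _ (h.comp R.measurable_a) (R.V f) :=
  R.V.apply_symm_apply _

theorem bfc_eq_iff (R : SpectralRep T) {φ : ℝ → ℂ} (h : IsSymbol φ) (f g : H) :
    R.bfc φ h f = g ↔ (R.V g : R.X → ℂ) =ᵐ[R.μ] fun x => φ (R.a x) * R.V f x := by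
  rw [← R.V.injective.eq_iff, V_bfc, mulL2_eq_iff]

theorem bfc_mul (R : SpectralRep T) {φ ψ : ℝ → ℂ} (h : IsSymbol φ) (h' : IsSymbol ψ) :
    R.bfc _ (h.mul h') = R.bfc φ h ∘L R.bfc ψ h' := by
  ext f
  refine R.V.injective ?_
  rw [ContinuousLinearMap.comp_apply, V_bfc, V_bfc, V_bfc, mulL2_mulL2]

theorem bfc_add (R : SpectralRep T) {φ ψ : ℝ → ℂ} (h : IsSymbol φ) (h' : IsSymbol ψ) :
    R.bfc _ (h.add h') = R.bfc φ h + R.bfc ψ h' := by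
  ext f
  rw [bfc_eq_iff, add_apply, map_add, V_bfc, V_bfc]
  filter_upwards [mulL2_ae (h.comp R.measurable_a) (R.V f),
    mulL2_ae (h'.comp R.measurable_a) (R.V f), Lp.coeFn_add (mulL2 R.μ _ (h.comp R.measurable_a)
    (R.V f)) (mulL2 R.μ _ (h'.comp R.measurable_a) (R.V f))] with x h1 h2 h3
  rw [h3, Pi.add_apply, h1, h2, add_mul]

theorem bfc_const (R : SpectralRep T) (c : ℂ) :
    R.bfc _ (IsSymbol.const c) = c • ContinuousLinearMap.id ℂ H := by
  ext f
  rw [bfc_eq_iff, smul_apply, map_smul]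
  filter_upwards [Lp.coeFn_smul c (R.V f)] with x h1
  rw [ContinuousLinearMap.id_apply, h1]
  rfl

theorem inner_bfc_left (R : SpectralRep T) {φ : ℝ → ℂ} (h : IsSymbol φ) (f g : H) :
    inner ℂ (R.bfc φ h f) g = inner ℂ f (R.bfc _ h.star g) := by
  rw [← R.V.inner_map_map, V_bfc, inner_mulL2_left, ← R.V.inner_map_map f, V_bfc]

theorem bfc_star_congr {R R' : SpectralRep T} {φ : ℝ → ℂ} (h : IsSymbol φ)
    (e : R.bfc φ h = R'.bfc φ h) : R.bfc _ h.star = R'.bfc _ h.star := by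
  ext f
  refine ext_inner_left ℂ fun g => ?_
  rw [← inner_bfc_left R h, ← inner_bfc_left R' h, e]

theorem isSymbol_resolvent : IsSymbol fun x : ℝ => ((x : ℂ) + Complex.I)⁻¹ := by
  refine ⟨by fun_prop, 1, fun x => ?_⟩
  rw [norm_inv]
  refine inv_le_one_of_one_le₀ ?_
  have := Complex.abs_im_le_norm ((x : ℂ) + Complex.I)
  simpa using this

theorem ofReal_add_I_ne_zero (x : ℝ) : (x : ℂ) + Complex.I ≠ 0 := fun h => by
  have := congrArg Complex.im h
  simp at this

/-- `g = (T + i)⁻¹ f` says that `(g, f - i g)` is in the graph of `T`, which does not mention the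
representation. -/
theorem bfc_resolvent_eq_iff (R : SpectralRep T) (f g : H) :
    R.bfc _ isSymbol_resolvent f = g ↔ (g, f - Complex.I • g) ∈ T.graph := by
  rw [bfc_eq_iff, R.mem_graph_iff, map_sub, map_smul]
  have e : ((R.V f - Complex.I • R.V g : Lp ℂ 2 R.μ) : R.X → ℂ) =ᵐ[R.μ]
      fun x => R.V f x - Complex.I * R.V g x := by
    filter_upwards [Lp.coeFn_sub (R.V f) (Complex.I • R.V g), Lp.coeFn_smul Complex.I (R.V g)]
      with x h1 h2
    rw [h1, Pi.sub_apply, h2, Pi.smul_apply, smul_eq_mul]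
  constructor
  · intro h
    filter_upwards [h, e] with x h1 h2
    rw [h2, h1]
    have := ofReal_add_I_ne_zero (R.a x)
    field_simp
    ring
  · intro h
    filter_upwards [h, e] with x h1 h2
    rw [h2] at h1
    rw [eq_inv_mul_iff_mul_eq₀ (ofReal_add_I_ne_zero (R.a x)), add_mul, ← h1]
    ring

/-- The spectral measure of the vector `f`. -/
def spectralMeasure (R : SpectralRep T) (f : H) : Measure ℝ :=
  (R.μ.withDensity fun x => (‖R.V f x‖₊ ^ 2 : NNReal)).map R.a

instance (R : SpectralRep T) (f : H) : IsFiniteMeasure (R.spectralMeasure f) := by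
  have h : IsFiniteMeasure (R.μ.withDensity fun x => ((‖R.V f x‖₊ ^ 2 : NNReal) : ENNReal)) := by
    refine isFiniteMeasure_withDensity ?_
    have := (Lp.memLp (R.V f)).eLpNorm_lt_top
    rw [eLpNorm_lt_top_iff_lintegral_rpow_enorm_lt_top (by norm_num) (by norm_num)] at this
    refine ne_of_lt (lt_of_le_of_lt (lintegral_mono fun x => ?_) this)
    simp [enorm_eq_nnnorm]
  exact Measure.isFiniteMeasure_map _ _

theorem integral_spectralMeasure (R : SpectralRep T) {φ : ℝ → ℂ} (h : IsSymbol φ) (f : H) :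
    ∫ t, φ t ∂(R.spectralMeasure f) = inner ℂ f (R.bfc φ h f) := by
  rw [spectralMeasure, integral_map R.measurable_a.aemeasurable h.1.aestronglyMeasurable,
    integral_withDensity_eq_integral_smul₀, ← R.V.inner_map_map, L2.inner_def]
  · refine integral_congr_ae ?_
    rw [V_bfc]
    filter_upwards [mulL2_ae (h.comp R.measurable_a) (R.V f)] with x hx
    rw [hx, RCLike.inner_apply']
    have : (starRingEnd ℂ) (R.V f x) * R.V f x = ((‖R.V f x‖₊ ^ 2 : NNReal) : ℂ) := by
      rw [mul_comm, Complex.mul_conj, Complex.normSq_eq_norm_sq]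
      simp
    rw [mul_left_comm, this, mul_comm, NNReal.smul_def, Complex.real_smul]
  · exact ((Lp.aestronglyMeasurable (R.V f)).nnnorm.aemeasurable.pow_const 2)

/-- The bounded continuous functions on which the calculi of two representations agree. -/
def agreeSubalgebra (R R' : SpectralRep T) : StarSubalgebra ℂ (BoundedContinuousFunction ℝ ℂ) where
  carrier := {φ | ∀ h : IsSymbol φ, R.bfc φ h = R'.bfc φ h}
  mul_mem' := by
    intro φ ψ hφ hψ h
    have s := fun θ : BoundedContinuousFunction ℝ ℂ =>
      (⟨θ.continuous.measurable, ‖θ‖, θ.norm_coe_le_norm⟩ : IsSymbol θ)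
    have := R.bfc_mul (s φ) (s ψ)
    rw [hφ (s φ), hψ (s ψ), ← bfc_mul] at this
    exact this
  add_mem' := by
    intro φ ψ hφ hψ h
    have s := fun θ : BoundedContinuousFunction ℝ ℂ =>
      (⟨θ.continuous.measurable, ‖θ‖, θ.norm_coe_le_norm⟩ : IsSymbol θ)
    have := R.bfc_add (s φ) (s ψ)
    rw [hφ (s φ), hψ (s ψ), ← bfc_add] at this
    exact this
  algebraMap_mem' := by
    intro c h
    exact (R.bfc_const c).trans (R'.bfc_const c).symm
  star_mem' := by
    intro φ hφ h
    have s : IsSymbol φ := ⟨φ.continuous.measurable, ‖φ‖, φ.norm_coe_le_norm⟩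
    exact bfc_star_congr s (hφ s)

/-- The spectral measure does not depend on the representation: the subalgebra on which the calculi
agree contains the resolvent function `(x + i)⁻¹`, hence separates points, and such a subalgebra
determines finite measures. -/
theorem spectralMeasure_eq (R R' : SpectralRep T) (f : H) :
    R.spectralMeasure f = R'.spectralMeasure f := by
  refine ext_of_forall_mem_subalgebra_integral_eq_of_polish (𝕜 := ℂ) (A := agreeSubalgebra R R')
    ?_ ?_
  · intro x y hxy
    have hc : Continuous fun x : ℝ => ((x : ℂ) + Complex.I)⁻¹ :=
      Continuous.inv₀ (by fun_prop) ofReal_add_I_ne_zero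
    let φ : BoundedContinuousFunction ℝ ℂ := BoundedContinuousFunction.ofNormedAddCommGroup
      (fun x : ℝ => ((x : ℂ) + Complex.I)⁻¹) hc isSymbol_resolvent.2.choose
      isSymbol_resolvent.2.choose_spec
    refine ⟨φ, ⟨φ, ⟨φ, ?_, rfl⟩, rfl⟩, ?_⟩
    · intro h
      change R.bfc _ isSymbol_resolvent = R'.bfc _ isSymbol_resolvent
      ext f
      rw [bfc_resolvent_eq_iff, ← bfc_resolvent_eq_iff R']
    · intro h
      have h' : ((x : ℂ) + Complex.I)⁻¹ = ((y : ℂ) + Complex.I)⁻¹ := h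
      rw [inv_inj, add_left_inj, Complex.ofReal_inj] at h'
      exact hxy h'
  · intro g hg
    have s : IsSymbol g := ⟨g.continuous.measurable, ‖g‖, g.norm_coe_le_norm⟩
    rw [integral_spectralMeasure R s, integral_spectralMeasure R' s, hg s]

/-- The bounded calculus does not depend on the representation: its quadratic form is given by the
spectral measures, and a quadratic form determines its operator by polarization. -/
theorem bfc_congr (R R' : SpectralRep T) {φ : ℝ → ℂ} (h : IsSymbol φ) :
    R.bfc φ h = R'.bfc φ h := by
  have : (R.bfc φ h : H →ₗ[ℂ] H) = R'.bfc φ h := by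
    rw [← ext_inner_map]
    intro f
    have := R.integral_spectralMeasure h f
    rw [R.spectralMeasure_eq R', R'.integral_spectralMeasure h] at this
    rw [← inner_conj_symm, ← inner_conj_symm _ f]
    exact congrArg _ this.symm
  exact ContinuousLinearMap.coe_injective this

/-- `g = φ(T) f` is equivalent to `φ (1 + |φ|)⁻¹ (T) f = (1 + |φ|)⁻¹ (T) g`, where only bounded
functions occur. -/
theorem fcGraph_congr (R R' : SpectralRep T) {φ : ℝ → ℂ} (h : Measurable φ) :
    R.fcGraph φ = R'.fcGraph φ := by
  have hd : ∀ x, (1 : ℝ) ≤ 1 + ‖φ x‖ := fun x => by linarith [norm_nonneg (φ x)]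
  have hn : ∀ x, ‖((1 + ‖φ x‖ : ℝ) : ℂ)‖ = 1 + ‖φ x‖ := fun x => by
    rw [Complex.norm_real, Real.norm_of_nonneg (by linarith [hd x])]
  have h0 : ∀ x, ((1 + ‖φ x‖ : ℝ) : ℂ) ≠ 0 := fun x => by
    rw [← norm_pos_iff, hn]; linarith [hd x]
  have hm : Measurable fun x => ((1 + ‖φ x‖ : ℝ) : ℂ)⁻¹ :=
    (Complex.measurable_ofReal.comp (measurable_const.add h.norm)).inv
  have s1 : IsSymbol fun x => ((1 + ‖φ x‖ : ℝ) : ℂ)⁻¹ :=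
    ⟨hm, 1, fun x => by rw [norm_inv, hn]; exact inv_le_one_of_one_le₀ (hd x)⟩
  have s2 : IsSymbol fun x => ((1 + ‖φ x‖ : ℝ) : ℂ)⁻¹ * φ x := by
    refine ⟨hm.mul h, 1, fun x => ?_⟩
    rw [norm_mul, norm_inv, hn, inv_mul_le_iff₀ (by linarith [hd x])]
    linarith
  have key : ∀ (R : SpectralRep T) (f g : H), (f, g) ∈ R.fcGraph φ ↔
      R.bfc _ s2 f = R.bfc _ s1 g := by
    intro R f g
    rw [bfc_eq_iff, V_bfc]
    change (R.V g : R.X → ℂ) =ᵐ[R.μ] (fun x => φ (R.a x) * R.V f x) ↔ _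
    constructor
    · intro hg
      filter_upwards [hg, mulL2_ae (s1.comp R.measurable_a) (R.V g)] with x h1 h2
      rw [h2, h1, mul_assoc]
    · intro hg
      filter_upwards [hg, mulL2_ae (s1.comp R.measurable_a) (R.V g)] with x h1 h2
      rw [h2, mul_assoc] at h1
      exact mul_left_cancel₀ (inv_ne_zero (h0 _)) h1
  ext ⟨f, g⟩
  rw [key, key, bfc_congr R R' s1, bfc_congr R R' s2]

theorem fc_congr (R R' : SpectralRep T) {φ : ℝ → ℂ} (h : Measurable φ) : R.fc φ = R'.fc φ := by
  rw [fc, fc, fcGraph_congr R R' h]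

theorem fc_eq_toPMap (R : SpectralRep T) {φ : ℝ → ℂ} (B : H →ₗ[ℂ] H)
    (h : ∀ f, (R.V (B f) : R.X → ℂ) =ᵐ[R.μ] fun x => φ (R.a x) * R.V f x) :
    R.fc φ = B.toPMap ⊤ := by
  refine LinearPMap.eq_of_eq_graph ?_
  ext ⟨f, g⟩
  rw [mem_graph_fc, LinearPMap.mem_graph_iff]
  constructor
  · intro hg
    refine ⟨⟨f, trivial⟩, rfl, ?_⟩
    change B f = g
    exact R.V.injective (Lp.ext ((h f).trans hg.symm))
  · rintro ⟨⟨f', _⟩, rfl, rfl⟩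
    exact h f'

end SpectralRep

/-! ### Products of operators with bounded factors -/

theorem mem_graph_toPMap_top {H : Type*} [AddCommGroup H] [Module ℂ H] (B : H →ₗ[ℂ] H) (x y : H) :
    (x, y) ∈ (B.toPMap ⊤).graph ↔ y = B x := by
  rw [LinearPMap.mem_graph_iff]
  constructor
  · rintro ⟨⟨f', _⟩, rfl, rfl⟩; rfl
  · rintro rfl; exact ⟨⟨x, trivial⟩, rfl, rfl⟩

theorem mem_graph_sub {H : Type*} [AddCommGroup H] [Module ℂ H] (S T : H →ₗ.[ℂ] H) (x z : H) :
    (x, z) ∈ (S - T).graph ↔ ∃ u v, (x, u) ∈ S.graph ∧ (x, v) ∈ T.graph ∧ z = u - v := by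
  simp only [LinearPMap.mem_graph_iff]
  constructor
  · rintro ⟨⟨w, hw⟩, rfl, rfl⟩
    exact ⟨S ⟨w, hw.1⟩, T ⟨w, hw.2⟩, ⟨_, rfl, rfl⟩, ⟨_, rfl, rfl⟩, rfl⟩
  · rintro ⟨u, v, ⟨⟨w, hw⟩, rfl, rfl⟩, ⟨⟨w', hw'⟩, e, rfl⟩, rfl⟩
    obtain rfl : w' = w := e
    exact ⟨⟨w', hw, hw'⟩, rfl, rfl⟩

/-- If `q` maps into the domain of `P` and `P q = p`, then `b₁ (b₂ - b₃ P) q` is everywhere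
defined. -/
theorem compUnbounded_eq_toPMap {H : Type*} [AddCommGroup H] [Module ℂ H]
    (b₁ b₂ b₃ q p : H →ₗ[ℂ] H) (P : H →ₗ.[ℂ] H) (h : ∀ f, (q f, p f) ∈ P.graph) :
    compUnbounded (b₁.toPMap ⊤) (compUnbounded (b₂.toPMap ⊤ - compUnbounded (b₃.toPMap ⊤) P)
      (q.toPMap ⊤)) = (b₁ ∘ₗ (b₂ ∘ₗ q - b₃ ∘ₗ p)).toPMap ⊤ := by
  refine LinearPMap.eq_of_eq_graph ?_
  ext ⟨x, z⟩
  simp only [mem_graph_compUnbounded, mem_graph_sub, mem_graph_toPMap_top]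
  constructor
  · rintro ⟨y, ⟨_, rfl, ⟨u, v, rfl, ⟨w, hw, rfl⟩, rfl⟩⟩, rfl⟩
    have : w = p x := LinearPMap.mem_graph_snd_inj P hw (h x) rfl
    rw [this]; rfl
  · rintro rfl
    exact ⟨_, ⟨_, rfl, ⟨_, _, rfl, ⟨_, h x, rfl⟩, rfl⟩⟩, rfl⟩

/-! ### The Fourier transform on `L¹ ∩ L²` -/

open scoped FourierTransform in
/-- On `L¹ ∩ L²` the `L²` Fourier transform is given by the Fourier integral. -/
theorem fourier_ae_of_integrable (f : Lp ℂ 2 (volume : Measure ℝ)) (g : ℝ → ℂ)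
    (hfg : (f : ℝ → ℂ) =ᵐ[volume] g) (hg : Integrable g) :
    ((𝓕 f : Lp ℂ 2 (volume : Measure ℝ)) : ℝ → ℂ) =ᵐ[volume] 𝓕 g := by
  have hf : Integrable (f : ℝ → ℂ) := hg.congr hfg.symm
  have hcont : Continuous (𝓕 (f : ℝ → ℂ)) :=
    VectorFourier.fourierIntegral_continuous Real.continuous_fourierChar
      (by exact continuous_inner) hf
  have e : 𝓕 g = 𝓕 (f : ℝ → ℂ) := by
    ext x; exact (Real.fourier_congr_ae hfg x).symm
  rw [e]
  refine ae_eq_of_integral_contDiff_smul_eq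
    ((Lp.memLp _).locallyIntegrable (by norm_num)) hcont.locallyIntegrable ?_
  intro φ hφ hφc
  have hg₁ : HasCompactSupport (Complex.ofRealCLM ∘ φ) := hφc.comp_left rfl
  have hg₂ : ContDiff ℝ ∞ (Complex.ofRealCLM ∘ φ) := by fun_prop
  set ψ := hg₁.toSchwartzMap hg₂ with hψ
  have h1 := congrArg (fun D : TemperedDistribution ℝ ℂ => D ψ)
    (Lp.fourier_toTemperedDistribution_eq f)
  simp only [TemperedDistribution.fourier_apply, Lp.toTemperedDistribution_apply] at h1
  have h2 := VectorFourier.integral_fourierIntegral_smul_eq_flip (L := innerₗ ℝ)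
    Real.continuous_fourierChar (by exact continuous_inner)
    (ψ.integrable (μ := volume)) hf
  rw [flip_innerₗ] at h2
  calc ∫ x, φ x • (𝓕 f : Lp ℂ 2 (volume : Measure ℝ)) x
      = ∫ x, ψ x • (𝓕 f : Lp ℂ 2 (volume : Measure ℝ)) x := by simp [hψ]
    _ = ∫ x, (𝓕 ψ) x • f x := h1.symm
    _ = ∫ x, ψ x • (𝓕 (f : ℝ → ℂ)) x := h2
    _ = ∫ x, φ x • (𝓕 (f : ℝ → ℂ) : ℝ → ℂ) x := by simp [hψ]

/-! ### The logarithmic change of variables and the Mellin transform -/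

theorem lintegral_volPos_eq (F : ℝ → ENNReal) :
    ∫⁻ x, F x ∂volPos = ∫⁻ u : ℝ, ENNReal.ofReal (Real.exp (-u)) * F (Real.exp (-u)) := by
  have hi : (fun u : ℝ => Real.exp (-u)) '' univ = Ioi 0 := by
    ext x
    constructor
    · rintro ⟨u, -, rfl⟩; exact Real.exp_pos _
    · intro hx; exact ⟨-Real.log x, trivial, by simp [Real.exp_log hx]⟩
  have h := lintegral_image_eq_lintegral_abs_deriv_mul (s := univ) (f := fun u => Real.exp (-u))
    (f' := fun u => -Real.exp (-u)) MeasurableSet.univ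
    (fun u _ => by simpa using (hasDerivAt_neg u).exp)
    (fun u _ v _ h => by simpa using h) F
  rw [hi] at h
  simpa using h

theorem quasiMeasurePreserving_exp_neg :
    Measure.QuasiMeasurePreserving (fun u : ℝ => Real.exp (-u)) volume volPos := by
  refine ⟨by fun_prop, Measure.AbsolutelyContinuous.mk fun s hs h0 => ?_⟩
  rw [Measure.map_apply (by fun_prop) hs]
  rw [← lintegral_indicator_one hs, lintegral_volPos_eq, lintegral_eq_zero_iff
    (by have := measurable_one.indicator hs (β := ENNReal); fun_prop)] at h0
  rw [measure_eq_zero_iff_ae_notMem]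
  filter_upwards [h0] with u hu hus
  simp only [Pi.zero_apply, mul_eq_zero, ENNReal.ofReal_eq_zero, not_le.2 (Real.exp_pos _),
    false_or] at hu
  rw [indicator_of_mem (show Real.exp (-u) ∈ s from hus)] at hu
  exact one_ne_zero hu

theorem measurable_neg_log : Measurable fun x : ℝ => -Real.log x := Real.measurable_log.neg

theorem quasiMeasurePreserving_neg_log :
    Measure.QuasiMeasurePreserving (fun x : ℝ => -Real.log x) volPos volume := by
  refine ⟨measurable_neg_log, Measure.AbsolutelyContinuous.mk fun s hs h0 => ?_⟩
  rw [Measure.map_apply measurable_neg_log hs,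
    ← lintegral_indicator_one (measurable_neg_log hs), lintegral_volPos_eq]
  rw [measure_eq_zero_iff_ae_notMem] at h0
  rw [lintegral_congr_ae (g := fun _ => 0), lintegral_zero]
  filter_upwards [h0] with u hu
  rw [indicator_of_notMem, mul_zero]
  simpa using hu

theorem eLpNorm_two_eq {X : Type*} [MeasurableSpace X] (μ : Measure X) (f : X → ℂ) :
    eLpNorm f 2 μ = (∫⁻ x, ‖f x‖ₑ ^ (2 : ℝ) ∂μ) ^ (1 / 2 : ℝ) := by
  rw [eLpNorm_eq_lintegral_rpow_enorm_toReal (by norm_num) (by norm_num)]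
  norm_num

theorem eLpNorm_logChange (f : ℝ → ℂ) :
    eLpNorm (fun u : ℝ => (Real.exp (-(1 / 2) * u) : ℂ) * f (Real.exp (-u))) 2 volume =
      eLpNorm f 2 volPos := by
  rw [eLpNorm_two_eq, eLpNorm_two_eq, lintegral_volPos_eq]
  congr 1
  refine lintegral_congr fun u => ?_
  rw [enorm_mul, ENNReal.mul_rpow_of_nonneg _ _ (by norm_num)]
  congr 1
  rw [← ofReal_norm, Complex.norm_real, Real.norm_of_nonneg (Real.exp_pos _).le,
    ENNReal.ofReal_rpow_of_pos (Real.exp_pos _), ← Real.exp_mul]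
  congr 2
  ring

theorem memLp_logChange (f : L2Pos) :
    MemLp (fun u : ℝ => (Real.exp (-(1 / 2) * u) : ℂ) * f (Real.exp (-u))) 2 volume := by
  refine ⟨?_, ?_⟩
  · refine AEStronglyMeasurable.mul (by fun_prop) ?_
    exact (Lp.aestronglyMeasurable f).comp_quasiMeasurePreserving quasiMeasurePreserving_exp_neg
  · rw [eLpNorm_logChange]; exact (Lp.memLp f).2

/-- The unitary map `f ↦ (u ↦ e^{-u/2} f(e^{-u}))` from `L²(ℝ₊)` to `L²(ℝ)`, as an isometry. -/
def logChange : L2Pos →ₗᵢ[ℂ] Lp ℂ 2 (volume : Measure ℝ) where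
  toFun f := (memLp_logChange f).toLp _
  map_add' f g := by
    rw [← MemLp.toLp_add]
    refine MemLp.toLp_congr _ _ ?_
    filter_upwards [quasiMeasurePreserving_exp_neg.ae (Lp.coeFn_add f g)] with x hx
    simp only [hx, Pi.add_apply, mul_add]
  map_smul' c f := by
    rw [RingHom.id_apply, ← MemLp.toLp_const_smul]
    refine MemLp.toLp_congr _ _ ?_
    filter_upwards [quasiMeasurePreserving_exp_neg.ae (Lp.coeFn_smul c f)] with x hx
    simp only [hx, Pi.smul_apply, smul_eq_mul]
    ring
  norm_map' f := by
    change ‖(memLp_logChange f).toLp _‖ = ‖f‖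
    rw [Lp.norm_toLp, eLpNorm_logChange, Lp.norm_def]

theorem logChange_ae {f : L2Pos} {h : ℝ → ℂ} (hfh : (f : ℝ → ℂ) =ᵐ[volPos] h) :
    (logChange f : ℝ → ℂ) =ᵐ[volume]
      fun u => (Real.exp (-(1 / 2) * u) : ℂ) * h (Real.exp (-u)) := by
  filter_upwards [(memLp_logChange f).coeFn_toLp, quasiMeasurePreserving_exp_neg.ae hfh]
    with x h1 h2
  change ((memLp_logChange f).toLp _ : ℝ → ℂ) x = _
  rw [h1, h2]

theorem logChange_surjective : Function.Surjective logChange := by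
  intro g
  have key : ∀ u : ℝ, (Real.exp (-(1 / 2) * u) : ℂ) *
      ((Real.exp (-Real.log (Real.exp (-u)) / 2) : ℂ) * g (-Real.log (Real.exp (-u)))) = g u := by
    intro u
    rw [Real.log_exp, neg_neg, ← mul_assoc, ← Complex.ofReal_mul, ← Real.exp_add]
    ring_nf
    simp
  have hm : MemLp (fun x : ℝ => (Real.exp (-Real.log x / 2) : ℂ) * g (-Real.log x)) 2 volPos := by
    refine ⟨?_, ?_⟩
    · refine AEStronglyMeasurable.mul
        (Measurable.aestronglyMeasurable (by have := Real.measurable_log; fun_prop)) ?_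
      exact (Lp.aestronglyMeasurable g).comp_quasiMeasurePreserving quasiMeasurePreserving_neg_log
    · rw [← eLpNorm_logChange]
      simp only [key]
      exact (Lp.memLp g).2
  refine ⟨hm.toLp _, Lp.ext ?_⟩
  refine (logChange_ae hm.coeFn_toLp).trans (ae_of_all _ key)

/-- The Mellin transform on the line `Re s = 1/2` as a unitary map: `(M f)(ξ)` is
`∫ x^{-1/2 + 2πiξ} f(x) dx`, see `mellinL2_ae`. -/
def mellinL2 : L2Pos ≃ₗᵢ[ℂ] Lp ℂ 2 (volume : Measure ℝ) :=
  (LinearIsometryEquiv.ofSurjective logChange logChange_surjective).trans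
    (Lp.fourierTransformₗᵢ ℝ ℂ)

theorem mellinL2_ae {f : L2Pos} {h : ℝ → ℂ} (hfh : (f : ℝ → ℂ) =ᵐ[volPos] h)
    (hi : MellinConvergent h (1 / 2)) :
    (mellinL2 f : ℝ → ℂ) =ᵐ[volume]
      fun ξ => mellin h (1 / 2 + 2 * Real.pi * ξ * Complex.I) := by
  have hg : Integrable fun u : ℝ => (Real.exp (-(1 / 2) * u) : ℂ) * h (Real.exp (-u)) := by
    have h1 : IntegrableOn (fun u : ℝ => |(-Real.exp (-u))| • (((Real.exp (-u) : ℝ) : ℂ) ^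
        ((1 / 2 : ℂ) - 1) • h (Real.exp (-u)))) univ := by
      rw [← integrableOn_image_iff_integrableOn_abs_deriv_smul (f := fun u => Real.exp (-u))
        (f' := fun u => -Real.exp (-u)) MeasurableSet.univ
        (fun u _ => by simpa using (hasDerivAt_neg u).exp)
        (fun u _ v _ h => by simpa using h) (fun x : ℝ => (x : ℂ) ^ ((1 / 2 : ℂ) - 1) • h x)]
      refine hi.mono_set ?_
      rintro _ ⟨u, -, rfl⟩
      exact Real.exp_pos _
    rw [integrableOn_univ] at h1
    refine h1.congr (ae_of_all _ fun u => ?_)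
    have : (((1 / 2 : ℂ) - 1)) = ((-(1 / 2) : ℝ) : ℂ) := by push_cast; ring
    simp only [abs_neg, abs_of_pos (Real.exp_pos _)]
    rw [this, ← Complex.ofReal_cpow (Real.exp_pos _).le, ← Real.exp_mul, Complex.real_smul,
      smul_eq_mul, ← mul_assoc, ← Complex.ofReal_mul, ← Real.exp_add]
    congr 3
    ring
  refine (fourier_ae_of_integrable _ _ (logChange_ae hfh) hg).trans (ae_of_all _ fun ξ => ?_)
  beta_reduce
  rw [mellin_eq_fourier]
  have e1 : (1 / 2 + 2 * Real.pi * ξ * Complex.I : ℂ).re = 1 / 2 := by simp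
  have e2 : (1 / 2 + 2 * Real.pi * ξ * Complex.I : ℂ).im / (2 * Real.pi) = ξ := by
    simp
  rw [e1, e2]
  simp only [Complex.real_smul]

/-! ### Smooth functions with compact support in `ℝ₊` -/

/-- Smooth functions with compact support in the open half-line `(0, ∞)`. -/
structure IsTest (h : ℝ → ℂ) : Prop where
  contDiff : ContDiff ℝ ∞ h
  hasCompactSupport : HasCompactSupport h
  tsupport_subset : tsupport h ⊆ Ioi 0

theorem IsTest.memLp {h : ℝ → ℂ} (hh : IsTest h) : MemLp h 2 volPos :=
  (hh.contDiff.continuous.memLp_of_hasCompactSupport hh.hasCompactSupport).restrict _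

/-- The support lies in a compact subinterval of `(0, ∞)`. -/
theorem IsTest.exists_bounds {h : ℝ → ℂ} (hh : IsTest h) :
    ∃ a b : ℝ, 0 < a ∧ a ≤ b ∧ ∀ x, x ∉ Icc a b → h x = 0 := by
  rcases (tsupport h).eq_empty_or_nonempty with h0 | hne
  · refine ⟨1, 1, one_pos, le_rfl, fun x _ => ?_⟩
    exact image_eq_zero_of_notMem_tsupport (by rw [h0]; exact notMem_empty x)
  · have hc : IsCompact (tsupport h) := hh.hasCompactSupport
    obtain ⟨a, ha, hal⟩ := hc.exists_isLeast hne
    obtain ⟨b, hb, hbl⟩ := hc.exists_isGreatest hne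
    refine ⟨a, b, hh.tsupport_subset ha, hal hb, fun x hx => ?_⟩
    exact image_eq_zero_of_notMem_tsupport fun hx' => hx ⟨hal hx', hbl hx'⟩

theorem IsTest.mellinConvergent {h : ℝ → ℂ} (hh : IsTest h) (s : ℂ) : MellinConvergent h s := by
  obtain ⟨a, b, ha, -, hab⟩ := hh.exists_bounds
  have hc : IntegrableOn (fun t : ℝ => (t : ℂ) ^ (s - 1) • h t) (Icc a b) := by
    refine ContinuousOn.integrableOn_Icc fun t ht => ContinuousAt.continuousWithinAt ?_
    exact (Complex.continuousAt_ofReal_cpow_const t _ (Or.inr (ha.trans_le ht.1).ne')).smul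
      hh.contDiff.continuous.continuousAt
  refine ((integrableOn_iff_integrable_of_support_subset ?_).1 hc).integrableOn
  intro t ht
  by_contra h'
  exact ht (by simp [hab t h'])

/-- A bounded operator on `L²(ℝ₊)` which vanishes on the test functions is zero. -/
theorem clm_eq_zero_of_isTest {H : Type*} [NormedAddCommGroup H] [InnerProductSpace ℂ H]
    [CompleteSpace H] (D : L2Pos →L[ℂ] H)
    (hD : ∀ (h : ℝ → ℂ) (hh : IsTest h), D (hh.memLp.toLp h) = 0) : D = 0 := by
  have key : ContinuousLinearMap.adjoint D = 0 := by
    ext1 w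
    set v := ContinuousLinearMap.adjoint D w with hv
    have hl : LocallyIntegrableOn (v : ℝ → ℂ) (Ioi 0) volume :=
      locallyIntegrableOn_of_locallyIntegrable_restrict
        ((Lp.memLp v).locallyIntegrable (by norm_num))
    have h0 := IsOpen.ae_eq_zero_of_integral_contDiff_smul_eq_zero isOpen_Ioi hl (by
      intro g hg hgc hgs
      have hh : IsTest fun x => (g x : ℂ) :=
        ⟨Complex.ofRealCLM.contDiff.comp hg, hgc.comp_left (g := Complex.ofReal) rfl,
          (closure_mono (fun x (hx : (g x : ℂ) ≠ 0) =>
            (fun h => hx (by rw [h, Complex.ofReal_zero]) : g x ≠ 0))).trans hgs⟩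
      have h1 : inner ℂ v (hh.memLp.toLp _) = (0 : ℂ) := by
        rw [hv, ContinuousLinearMap.adjoint_inner_left, hD _ hh, inner_zero_right]
      rw [← inner_conj_symm, map_eq_zero, L2.inner_def] at h1
      rw [← setIntegral_eq_integral_of_forall_compl_eq_zero (s := Ioi (0 : ℝ)), ← h1]
      · refine integral_congr_ae ?_
        filter_upwards [hh.memLp.coeFn_toLp] with x hx
        rw [hx, RCLike.inner_apply', Complex.conj_ofReal, Complex.real_smul]
      · intro x hx
        rw [image_eq_zero_of_notMem_tsupport (fun h => hx (hgs h)), zero_smul])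
    refine Lp.ext ?_
    rw [Filter.EventuallyEq, ae_restrict_iff' measurableSet_Ioi]
    have hz : ((0 : L2Pos) : ℝ → ℂ) =ᵐ[volPos] 0 := Lp.coeFn_zero ℂ 2 volPos
    rw [Filter.EventuallyEq, ae_restrict_iff' measurableSet_Ioi] at hz
    filter_upwards [h0, hz] with x hx hx' hx0
    rw [hx hx0, zero_apply, hx' hx0]
    rfl
  rw [← ContinuousLinearMap.adjoint_adjoint D, key, map_zero]

theorem clm_ext_of_isTest {H : Type*} [NormedAddCommGroup H] [InnerProductSpace ℂ H]
    [CompleteSpace H] (D D' : L2Pos →L[ℂ] H)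
    (hD : ∀ (h : ℝ → ℂ) (hh : IsTest h), D (hh.memLp.toLp h) = D' (hh.memLp.toLp h)) :
    D = D' :=
  sub_eq_zero.1 (clm_eq_zero_of_isTest (D - D') fun h hh => by
    rw [sub_apply, hD h hh, sub_self])

/-! ### The Mellin transform diagonalizes the generator of dilations -/

theorem dilation_ae (t : ℝ) (f : L2Pos) :
    (dilation t f : ℝ → ℂ) =ᵐ[volPos] fun x => (Real.exp (t / 2) : ℂ) * f (Real.exp t * x) :=
  (memLp_dilation t f).coeFn_toLp

theorem norm_dilation_le (t : ℝ) (f : L2Pos) : ‖dilation t f‖ ≤ ‖f‖ := by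
  rw [Lp.norm_def, Lp.norm_def]
  refine ENNReal.toReal_mono (Lp.memLp f).2.ne (le_of_eq ?_)
  rw [eLpNorm_congr_ae (dilation_ae t f), eLpNorm_two_eq, eLpNorm_two_eq]
  congr 1
  have hm : ∫⁻ x, ‖f x‖ₑ ^ (2 : ℝ) ∂(Measure.map (fun x => Real.exp t * x) volPos)
      = ∫⁻ x, ‖f (Real.exp t * x)‖ₑ ^ (2 : ℝ) ∂volPos := by
    refine lintegral_map' ?_ (measurable_const_mul _).aemeasurable
    rw [map_volPos_exp_mul]
    exact (((Lp.aestronglyMeasurable f).enorm).pow_const _).smul_measure _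
  rw [map_volPos_exp_mul, lintegral_smul_measure] at hm
  simp only [enorm_mul, ENNReal.mul_rpow_of_nonneg _ _ (by norm_num : (0 : ℝ) ≤ 2)]
  rw [lintegral_const_mul' _ _ (by finiteness), ← hm, smul_eq_mul, ← mul_assoc,
    ← ofReal_norm, Complex.norm_real, Real.norm_of_nonneg (Real.exp_pos _).le,
    ENNReal.ofReal_rpow_of_pos (Real.exp_pos _), ← ENNReal.ofReal_mul (by positivity),
    ← Real.exp_mul, ← Real.exp_add]
  have : t / 2 * 2 + -t = 0 := by ring
  rw [this]
  simp

theorem isSymbol_exp_I (t : ℝ) :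
    IsSymbol fun ξ : ℝ => Complex.exp (-(2 * Real.pi * t * ξ : ℝ) * Complex.I) := by
  refine ⟨by fun_prop, 1, fun ξ => ?_⟩
  rw [← Complex.ofReal_neg, Complex.norm_exp_ofReal_mul_I]

/-- In the Mellin representation a dilation is the multiplication by a phase. -/
theorem mellinL2_dilation (t : ℝ) (f : L2Pos) :
    mellinL2 (dilation t f) = mulL2 volume _ (isSymbol_exp_I t) (mellinL2 f) := by
  let U : L2Pos →L[ℂ] L2Pos := LinearMap.mkContinuous (dilation t) 1 (by
    intro f; rw [one_mul]; exact norm_dilation_le t f)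
  let M : L2Pos →L[ℂ] Lp ℂ 2 (volume : Measure ℝ) := mellinL2.toContinuousLinearEquiv
  suffices h : M ∘L U = mulL2 volume _ (isSymbol_exp_I t) ∘L M from
    congrArg (fun D : L2Pos →L[ℂ] Lp ℂ 2 (volume : Measure ℝ) => D f) h
  refine clm_ext_of_isTest _ _ fun h hh => ?_
  change mellinL2 (dilation t (hh.memLp.toLp h)) =
    mulL2 volume _ (isSymbol_exp_I t) (mellinL2 (hh.memLp.toLp h))
  refine Lp.ext ?_
  have hd : (dilation t (hh.memLp.toLp h) : ℝ → ℂ) =ᵐ[volPos]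
      fun x => (Real.exp (t / 2) : ℂ) • h (Real.exp t * x) := by
    filter_upwards [dilation_ae t (hh.memLp.toLp h),
      (quasiMeasurePreserving_exp_mul t).ae hh.memLp.coeFn_toLp] with x h1 h2
    rw [h1, h2, smul_eq_mul]
  have hi : MellinConvergent (fun x => (Real.exp (t / 2) : ℂ) • h (Real.exp t * x)) (1 / 2) := by
    refine MellinConvergent.const_smul ?_ _
    rw [MellinConvergent.comp_mul_left (Real.exp_pos t)]
    exact hh.mellinConvergent _
  filter_upwards [mellinL2_ae hd hi, mulL2_ae (isSymbol_exp_I t) (mellinL2 (hh.memLp.toLp h)),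
    mellinL2_ae hh.memLp.coeFn_toLp (hh.mellinConvergent _)] with ξ h1 h2 h3
  rw [h1, h2, h3, mellin_const_smul, mellin_comp_mul_left _ _ (Real.exp_pos t), smul_eq_mul,
    smul_eq_mul, ← mul_assoc]
  congr 1
  rw [Complex.ofReal_exp, Complex.ofReal_exp, Complex.cpow_def_of_ne_zero (Complex.exp_ne_zero _),
    ← Complex.ofReal_exp t, ← Complex.ofReal_log (Real.exp_pos t).le, Real.log_exp,
    ← Complex.exp_add]
  congr 1
  push_cast
  ring

/-- The multiplier `(i t)⁻¹ (e^{-2πi t ξ} - 1)` of the difference quotient defining the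
generator. -/
def phaseQuotient (t ξ : ℝ) : ℂ :=
  (Complex.I * t)⁻¹ * (Complex.exp (-(2 * Real.pi * t * ξ : ℝ) * Complex.I) - 1)

theorem tendsto_phaseQuotient (ξ : ℝ) :
    Tendsto (fun t => phaseQuotient t ξ) (𝓝[≠] 0) (𝓝 ((-(2 * Real.pi * ξ) : ℝ) : ℂ)) := by
  have h : HasDerivAt (fun t : ℝ => Complex.exp (-(2 * Real.pi * t * ξ : ℝ) * Complex.I))
      (Complex.exp (-(2 * Real.pi * (0 : ℝ) * ξ : ℝ) * Complex.I) *
        (-(2 * Real.pi * 1 * ξ : ℝ) * Complex.I)) 0 := by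
    have h1 : HasDerivAt (fun t : ℝ => 2 * Real.pi * t * ξ) (2 * Real.pi * 1 * ξ) 0 :=
      ((hasDerivAt_id (0 : ℝ)).const_mul (2 * Real.pi)).mul_const ξ
    exact ((h1.ofReal_comp.neg).mul_const Complex.I).cexp
  rw [hasDerivAt_iff_tendsto_slope] at h
  have h2 := h.const_mul (Complex.I)⁻¹
  have e : (Complex.I)⁻¹ * (Complex.exp (-(2 * Real.pi * (0 : ℝ) * ξ : ℝ) * Complex.I) *
        (-(2 * Real.pi * 1 * ξ : ℝ) * Complex.I)) = ((-(2 * Real.pi * ξ) : ℝ) : ℂ) := by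
    simp
    ring_nf
    simp
  rw [e] at h2
  refine h2.congr fun t => ?_
  rw [slope_def_module, phaseQuotient, mul_inv, Complex.real_smul]
  simp
  ring

theorem norm_phaseQuotient_le (t ξ : ℝ) :
    ‖phaseQuotient t ξ‖ ≤ ‖((-(2 * Real.pi * ξ) : ℝ) : ℂ)‖ := by
  rw [phaseQuotient, norm_mul, norm_inv, norm_mul, Complex.norm_I, one_mul, Complex.norm_real,
    Complex.norm_real, ← Complex.ofReal_neg, mul_comm _ Complex.I]
  rcases eq_or_ne t 0 with rfl | ht
  · simp
  rw [inv_mul_le_iff₀ (norm_pos_iff.2 ht)]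
  refine (Real.norm_exp_I_mul_ofReal_sub_one_le).trans (le_of_eq ?_)
  rw [← norm_mul]
  congr 1
  ring

theorem mellinL2_difference_quotient (t : ℝ) (f : L2Pos) :
    (mellinL2 ((Complex.I * (t : ℂ))⁻¹ • (dilation t f - f)) : ℝ → ℂ) =ᵐ[volume]
      fun ξ => phaseQuotient t ξ * mellinL2 f ξ := by
  rw [map_smul, map_sub, mellinL2_dilation]
  filter_upwards [Lp.coeFn_smul (Complex.I * (t : ℂ))⁻¹
      (mulL2 volume _ (isSymbol_exp_I t) (mellinL2 f) - mellinL2 f),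
    Lp.coeFn_sub (mulL2 volume _ (isSymbol_exp_I t) (mellinL2 f)) (mellinL2 f),
    mulL2_ae (isSymbol_exp_I t) (mellinL2 f)] with ξ h1 h2 h3
  rw [h1, Pi.smul_apply, h2, Pi.sub_apply, h3, phaseQuotient, smul_eq_mul]
  ring

/-- The domain of `A` consists of all `f` for which `ξ f̂(ξ)` is square integrable: along a sequence
`t → 0` the difference quotients converge almost everywhere, and conversely they are dominated
by their limit. -/
theorem mem_graph_dilationGenerator_iff_mellinL2 (f g : L2Pos) :
    (f, g) ∈ dilationGenerator.graph ↔ (mellinL2 g : ℝ → ℂ) =ᵐ[volume]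
      fun ξ => ((-(2 * Real.pi * ξ) : ℝ) : ℂ) * mellinL2 f ξ := by
  rw [mem_graph_dilationGenerator, ← mellinL2.toHomeomorph.isInducing.tendsto_nhds_iff.symm]
  change Tendsto (fun t : ℝ => mellinL2 ((Complex.I * (t : ℂ))⁻¹ • (dilation t f - f)))
    (𝓝[≠] 0) (𝓝 (mellinL2 g)) ↔ _
  constructor
  · intro h
    have hs : Tendsto (fun n : ℕ => 1 / ((n : ℝ) + 1)) atTop (𝓝[≠] 0) :=
      tendsto_nhdsWithin_iff.2 ⟨tendsto_one_div_add_atTop_nhds_zero_nat,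
        Eventually.of_forall fun n => by
          have : (0 : ℝ) < 1 / ((n : ℝ) + 1) := by positivity
          exact this.ne'⟩
    obtain ⟨ns, hns, hae⟩ := (tendstoInMeasure_of_tendsto_Lp (h.comp hs)).exists_seq_tendsto_ae
    have hq : ∀ᵐ ξ : ℝ, ∀ n : ℕ, (mellinL2 ((Complex.I * ((1 / ((n : ℝ) + 1) : ℝ) : ℂ))⁻¹ •
        (dilation (1 / ((n : ℝ) + 1)) f - f)) : ℝ → ℂ) ξ =
          phaseQuotient (1 / ((n : ℝ) + 1)) ξ * mellinL2 f ξ :=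
      ae_all_iff.2 fun n => mellinL2_difference_quotient _ f
    filter_upwards [hae, hq] with ξ h1 h2
    refine tendsto_nhds_unique h1 ?_
    have h3 := ((tendsto_phaseQuotient ξ).comp (hs.comp hns.tendsto_atTop)).mul_const
      (mellinL2 f ξ)
    exact h3.congr fun n => (h2 (ns n)).symm
  · intro h
    rw [Lp.tendsto_Lp_iff_tendsto_eLpNorm']
    have e : ∀ t : ℝ, eLpNorm ((mellinL2 ((Complex.I * (t : ℂ))⁻¹ • (dilation t f - f)) : ℝ → ℂ)
        - (mellinL2 g : ℝ → ℂ)) 2 volume = (∫⁻ ξ,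
          ‖(phaseQuotient t ξ - ((-(2 * Real.pi * ξ) : ℝ) : ℂ)) * mellinL2 f ξ‖ₑ ^ (2 : ℝ)) ^
            (1 / 2 : ℝ) := by
      intro t
      rw [eLpNorm_two_eq]
      congr 1
      refine lintegral_congr_ae ?_
      filter_upwards [mellinL2_difference_quotient t f, h] with ξ h1 h2
      rw [Pi.sub_apply, h1, h2, sub_mul]
    simp only [e]
    have hL : Tendsto (fun t : ℝ => ∫⁻ ξ, ‖(phaseQuotient t ξ - ((-(2 * Real.pi * ξ) : ℝ) : ℂ)) *
          mellinL2 f ξ‖ₑ ^ (2 : ℝ)) (𝓝[≠] 0) (𝓝 (∫⁻ _ : ℝ, 0)) := by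
      refine tendsto_lintegral_filter_of_dominated_convergence'
        (fun ξ => ‖(2 : ℂ) * mellinL2 g ξ‖ₑ ^ (2 : ℝ)) ?_ ?_ ?_ ?_
      · refine Eventually.of_forall fun t => AEMeasurable.pow_const (AEMeasurable.enorm ?_) _
        refine AEMeasurable.mul ?_ (Lp.aestronglyMeasurable _).aemeasurable
        unfold phaseQuotient
        fun_prop
      · refine Eventually.of_forall fun t => ?_
        filter_upwards [h] with ξ hξ
        refine ENNReal.rpow_le_rpow ?_ (by norm_num)
        rw [hξ, ← ofReal_norm, ← ofReal_norm]
        refine ENNReal.ofReal_le_ofReal ?_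
        rw [← mul_assoc, norm_mul, norm_mul]
        refine mul_le_mul_of_nonneg_right ?_ (norm_nonneg _)
        rw [norm_mul, Complex.norm_ofNat]
        linarith [norm_sub_le (phaseQuotient t ξ) ((-(2 * Real.pi * ξ) : ℝ) : ℂ),
          norm_phaseQuotient_le t ξ]
      · have := ((Lp.memLp (mellinL2 g)).const_mul (2 : ℂ)).eLpNorm_lt_top
        rw [eLpNorm_lt_top_iff_lintegral_rpow_enorm_lt_top (by norm_num) (by norm_num)] at this
        simpa using this.ne
      · refine ae_of_all _ fun ξ => ?_
        have h1 := ((tendsto_phaseQuotient ξ).sub_const ((-(2 * Real.pi * ξ) : ℝ) : ℂ)).mul_const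
          (mellinL2 f ξ)
        rw [sub_self, zero_mul] at h1
        have h2 := (ENNReal.continuous_rpow_const (y := 2)).continuousAt.tendsto.comp
          ((continuous_enorm.tendsto (0 : ℂ)).comp h1)
        simpa [Function.comp_def] using h2
    rw [lintegral_zero] at hL
    have := (ENNReal.continuous_rpow_const (y := 1 / 2)).continuousAt.tendsto.comp hL
    simpa [Function.comp_def] using this

/-- The Mellin transform as a spectral representation of the generator of dilations. -/
def dilationRep : SpectralRep dilationGenerator where
  X := ℝ
  μ := volume
  V := mellinL2
  a ξ := -(2 * Real.pi * ξ)
  measurable_a := by fun_prop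
  mem_graph_iff := mem_graph_dilationGenerator_iff_mellinL2

/-! ### Vertical shifts of the Gamma function -/

theorem sum_inv_sq_le {u : ℝ} (hu : 0 < u) (n : ℕ) :
    ∑ j ∈ Finset.range (n + 1), 1 / (u + j) ^ 2 ≤ 1 / u ^ 2 + 1 / u - 1 / (u + n) := by
  induction n with
  | zero => simp
  | succ n ih =>
    rw [Finset.sum_range_succ]
    have h0 : (0 : ℝ) < u + n := by positivity
    have h1 : 1 / (u + ((n + 1 : ℕ) : ℝ)) ^ 2 ≤ 1 / (u + n) - 1 / (u + ((n + 1 : ℕ) : ℝ)) := by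
      push_cast
      have h2 : (0 : ℝ) < u + (n + 1) := by linarith
      rw [div_sub_div _ _ h0.ne' h2.ne', div_le_div_iff₀ (by positivity) (by positivity)]
      nlinarith
    linarith

theorem sum_inv_normSq_le {c : ℝ} (hc : 0 < c) (y : ℝ) (n : ℕ) :
    ∑ j ∈ Finset.range (n + 1), 1 / ((c + j) ^ 2 + y ^ 2) ≤
      2 * (1 / (c + |y|) ^ 2 + 1 / (c + |y|)) := by
  have hu : 0 < c + |y| := by positivity
  have h1 : ∀ j : ℕ, 1 / ((c + j) ^ 2 + y ^ 2) ≤ 2 * (1 / ((c + |y|) + j) ^ 2) := by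
    intro j
    have : (0 : ℝ) < c + j := by positivity
    rw [mul_one_div, div_le_div_iff₀ (by positivity) (by positivity)]
    nlinarith [sq_nonneg (c + j - |y|), sq_abs y]
  refine (Finset.sum_le_sum fun j _ => h1 j).trans ?_
  rw [← Finset.mul_sum]
  have h2 := sum_inv_sq_le hu n
  have h3 : 0 < 1 / (c + |y| + n) := by positivity
  linarith

/-- The products in Euler's formula for `Γ` change by a bounded factor under an imaginary shift of
the argument, uniformly along a vertical line. -/
theorem prod_normSq_shift_le {c : ℝ} (hc : 0 < c) (b y : ℝ) (n : ℕ) :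
    ∏ j ∈ Finset.range (n + 1), ((c + j) ^ 2 + (y + b) ^ 2) ≤
      Real.exp (2 * (2 * |b| * (1 / c + 1) + b ^ 2 * (1 / c ^ 2 + 1 / c))) *
        ∏ j ∈ Finset.range (n + 1), ((c + j) ^ 2 + y ^ 2) := by
  have hp : ∀ j : ℕ, (0 : ℝ) < (c + j) ^ 2 + y ^ 2 := fun j => by positivity
  have h1 : ∀ j : ℕ, (c + j) ^ 2 + (y + b) ^ 2 ≤
      Real.exp ((2 * |b| * |y| + b ^ 2) * (1 / ((c + j) ^ 2 + y ^ 2))) *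
        ((c + j) ^ 2 + y ^ 2) := by
    intro j
    have h2 := Real.add_one_le_exp ((2 * |b| * |y| + b ^ 2) * (1 / ((c + j) ^ 2 + y ^ 2)))
    have h3 := mul_le_mul_of_nonneg_right h2 (hp j).le
    refine le_trans ?_ h3
    rw [add_mul, mul_one_div, div_mul_cancel₀ _ (hp j).ne']
    have : y * b ≤ |b| * |y| := by rw [← abs_mul, mul_comm]; exact le_abs_self _
    nlinarith
  refine (Finset.prod_le_prod (fun j _ => by positivity) fun j _ => h1 j).trans ?_
  rw [Finset.prod_mul_distrib, ← Real.exp_sum, ← Finset.mul_sum]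
  refine mul_le_mul_of_nonneg_right (Real.exp_le_exp.2 ?_)
    (Finset.prod_nonneg fun j _ => (hp j).le)
  refine (mul_le_mul_of_nonneg_left (sum_inv_normSq_le hc y n) (by positivity)).trans ?_
  have hu : c ≤ c + |y| := by linarith [abs_nonneg y]
  have hu0 : 0 < c + |y| := by positivity
  have e1 : 1 / (c + |y|) ≤ 1 / c := one_div_le_one_div_of_le hc hu
  have e2 : 1 / (c + |y|) ^ 2 ≤ 1 / c ^ 2 :=
    one_div_le_one_div_of_le (by positivity) (by gcongr)
  have e3 : |y| * (1 / (c + |y|) ^ 2 + 1 / (c + |y|)) ≤ 1 / c + 1 := by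
    have : |y| * (1 / (c + |y|) ^ 2 + 1 / (c + |y|)) ≤
        (c + |y|) * (1 / (c + |y|) ^ 2 + 1 / (c + |y|)) := by gcongr; linarith
    refine this.trans ?_
    have : (c + |y|) * (1 / (c + |y|) ^ 2 + 1 / (c + |y|)) = 1 / (c + |y|) + 1 := by field_simp
    rw [this]
    linarith
  have e4 : b ^ 2 * (1 / (c + |y|) ^ 2 + 1 / (c + |y|)) ≤ b ^ 2 * (1 / c ^ 2 + 1 / c) := by
    gcongr
  have e5 := mul_le_mul_of_nonneg_left e3 (show 0 ≤ 2 * |b| by positivity)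
  nlinarith

/-- On the vertical line `Re z = c` the function `Γ` changes at most by a bounded factor under a
fixed imaginary shift. -/
theorem norm_Gamma_le_shift {c : ℝ} (hc : 0 < c) (b : ℝ) :
    ∃ C : ℝ, ∀ y : ℝ, ‖Complex.Gamma (c + y * Complex.I)‖ ≤
      C * ‖Complex.Gamma (c + (y + b : ℝ) * Complex.I)‖ := by
  set K := Real.exp (2 * (2 * |b| * (1 / c + 1) + b ^ 2 * (1 / c ^ 2 + 1 / c))) with hK
  refine ⟨Real.sqrt K, fun y => ?_⟩
  refine le_of_tendsto_of_tendsto (Complex.GammaSeq_tendsto_Gamma _).norm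
    ((Complex.GammaSeq_tendsto_Gamma _).norm.const_mul _) ?_
  filter_upwards [eventually_gt_atTop 0] with n hn
  have hn' : (0 : ℝ) < n := by exact_mod_cast hn
  have hden : ∀ y : ℝ, ‖∏ j ∈ Finset.range (n + 1), ((c : ℂ) + y * Complex.I + j)‖ =
      Real.sqrt (∏ j ∈ Finset.range (n + 1), ((c + j) ^ 2 + y ^ 2)) := by
    intro y
    rw [norm_prod, Real.sqrt_eq_rpow, ← Real.finsetProd_rpow _ _ fun j _ => by positivity]
    refine Finset.prod_congr rfl fun j _ => ?_
    rw [← Real.sqrt_eq_rpow]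
    have : (c : ℂ) + y * Complex.I + j = (c + j : ℝ) + y * Complex.I := by push_cast; ring
    rw [this, Complex.norm_add_mul_I]
  have hnum : ∀ y : ℝ, ‖((n : ℂ) ^ ((c : ℂ) + y * Complex.I) * (n.factorial : ℂ))‖ =
      (n : ℝ) ^ c * n.factorial := by
    intro y
    rw [norm_mul, ← Complex.ofReal_natCast n, Complex.norm_cpow_eq_rpow_re_of_pos hn']
    simp
  have hpos : ∀ y : ℝ, 0 < ∏ j ∈ Finset.range (n + 1), ((c + j) ^ 2 + y ^ 2) := fun y =>
    Finset.prod_pos fun j _ => by positivity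
  simp only [Complex.GammaSeq]
  rw [norm_div, norm_div, hden, hden, hnum, hnum, ← mul_div_assoc,
    div_le_div_iff₀ (Real.sqrt_pos.2 (hpos _)) (Real.sqrt_pos.2 (hpos _))]
  have h1 := Real.sqrt_le_sqrt (prod_normSq_shift_le hc b y n)
  rw [Real.sqrt_mul (Real.exp_pos _).le, ← hK] at h1
  have h2 : (0 : ℝ) ≤ (n : ℝ) ^ c * n.factorial := by positivity
  nlinarith [mul_le_mul_of_nonneg_left h1 h2]

/-! ### The functions `Ξ_m` -/

theorem Xi_arg_re_pos {m : ℂ} (hm : -1 < m.re) (t : ℝ) : 0 < ((m + 1 + Complex.I * t) / 2).re := by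
  have : ((m + 1 + Complex.I * t) / 2).re = (m.re + 1) / 2 := by
    rw [← Complex.ofReal_ofNat, Complex.div_ofReal_re]
    simp
  rw [this]
  linarith

theorem Xi_arg_re_pos' {m : ℂ} (hm : -1 < m.re) (t : ℝ) :
    0 < ((m + 1 - Complex.I * t) / 2).re := by
  have := Xi_arg_re_pos hm (-t)
  simpa [sub_eq_add_neg] using this

theorem continuous_Xi {m : ℂ} (hm : -1 < m.re) : Continuous (Xi m) := by
  have hG : ∀ {f : ℝ → ℂ}, Continuous f → (∀ t, 0 < (f t).re) →
      Continuous fun t => Complex.Gamma (f t) := by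
    intro f hf h0
    rw [continuous_iff_continuousAt]
    intro t
    refine ContinuousAt.comp (f := f) ?_ hf.continuousAt
    refine (Complex.differentiableAt_Gamma _ fun k hk => ?_).continuousAt
    have := h0 t
    rw [hk] at this
    simp at this
    linarith [(Nat.cast_nonneg k : (0 : ℝ) ≤ k)]
  unfold Xi
  refine Continuous.mul (by fun_prop) (Continuous.div (hG (by fun_prop) (Xi_arg_re_pos hm))
    (hG (by fun_prop) (Xi_arg_re_pos' hm))
    fun t => Complex.Gamma_ne_zero_of_re_pos (Xi_arg_re_pos' hm t))

/-- By `|Γ(z̄)| = |Γ(z)|`, `|Ξ_m(t)|` is a quotient of values of `|Γ|` at two points of the line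
`Re z = (Re m + 1) / 2` whose distance is `|Im m|`, for every `t`. -/
theorem isSymbol_Xi {m : ℂ} (hm : -1 < m.re) : IsSymbol (Xi m) := by
  refine ⟨(continuous_Xi hm).measurable, ?_⟩
  obtain ⟨C, hC⟩ := norm_Gamma_le_shift (c := (m.re + 1) / 2) (by linarith) (-m.im)
  refine ⟨C, fun t => ?_⟩
  have h1 := hC ((m.im + t) / 2)
  have e1 : ((((m.re + 1) / 2 : ℝ) : ℂ) + ((m.im + t) / 2 : ℝ) * Complex.I) =
      (m + 1 + Complex.I * t) / 2 := by
    apply Complex.ext <;> simp [← Complex.ofReal_ofNat, Complex.div_ofReal_re,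
      Complex.div_ofReal_im]
  have e2 : ((((m.re + 1) / 2 : ℝ) : ℂ) + ((m.im + t) / 2 + -m.im : ℝ) * Complex.I) =
      starRingEnd ℂ ((m + 1 - Complex.I * t) / 2) := by
    apply Complex.ext
    · simp [← Complex.ofReal_ofNat, Complex.div_ofReal_re]
    · simp [← Complex.ofReal_ofNat, Complex.div_ofReal_im]
      ring
  rw [e1, e2, Complex.Gamma_conj, Complex.norm_conj] at h1
  have h2 : 0 < ‖Complex.Gamma ((m + 1 - Complex.I * t) / 2)‖ :=
    norm_pos_iff.2 (Complex.Gamma_ne_zero_of_re_pos (Xi_arg_re_pos' hm t))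
  rw [Xi, norm_mul, norm_div]
  have h3 : ‖Complex.exp (Complex.I * Real.log 2 * t)‖ = 1 := by
    rw [mul_assoc, ← Complex.ofReal_mul, Complex.norm_exp_I_mul_ofReal]
  rw [h3, one_mul, div_le_iff₀ h2]
  exact h1

theorem Xi_neg_mul_Xi {m : ℂ} (hm : -1 < m.re) (t : ℝ) : Xi m (-t) * Xi m t = 1 := by
  have h1 := Complex.Gamma_ne_zero_of_re_pos (Xi_arg_re_pos hm t)
  have h2 := Complex.Gamma_ne_zero_of_re_pos (Xi_arg_re_pos' hm t)
  have e : Complex.exp (Complex.I * Real.log 2 * (-t : ℝ)) *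
      Complex.exp (Complex.I * Real.log 2 * t) = 1 := by
    rw [← Complex.exp_add, Complex.ofReal_neg, mul_neg, neg_add_cancel, Complex.exp_zero]
  have e1 : (m + 1 + Complex.I * (-t : ℝ)) / 2 = (m + 1 - Complex.I * t) / 2 := by
    push_cast; ring
  have e2 : (m + 1 - Complex.I * (-t : ℝ)) / 2 = (m + 1 + Complex.I * t) / 2 := by
    push_cast; ring
  rw [Xi, Xi, mul_mul_mul_comm, e, e1, e2]
  field_simp

theorem conj_Xi (m : ℂ) (t : ℝ) : starRingEnd ℂ (Xi m t) = Xi (starRingEnd ℂ m) (-t) := by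
  simp only [Xi, map_mul, map_div₀, ← Complex.exp_conj, ← Complex.Gamma_conj, map_add, map_sub,
    map_one, map_ofNat, Complex.conj_I, Complex.conj_ofReal, Complex.ofReal_neg]
  congr 2 <;> ring_nf

/-! ### Hankel transformations -/

/-- The reflection `g ↦ (ξ ↦ g(-ξ))` on `L²(ℝ)`. -/
def reflectL2 : Lp ℂ 2 (volume : Measure ℝ) →ₗᵢ[ℂ] Lp ℂ 2 (volume : Measure ℝ) :=
  Lp.compMeasurePreservingₗᵢ ℂ (Neg.neg : ℝ → ℝ) (Measure.measurePreserving_neg volume)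

theorem reflectL2_ae (g : Lp ℂ 2 (volume : Measure ℝ)) :
    (reflectL2 g : ℝ → ℂ) =ᵐ[volume] fun ξ => g (-ξ) :=
  Lp.coeFn_compMeasurePreserving g (Measure.measurePreserving_neg volume)

theorem isSymbol_Xi_mul {m : ℂ} (hm : -1 < m.re) (c : ℝ) : IsSymbol fun ξ : ℝ => Xi m (c * ξ) :=
  (isSymbol_Xi hm).comp (measurable_const_mul c)

theorem ae_neg {p : ℝ → Prop} (h : ∀ᵐ ξ : ℝ, p ξ) : ∀ᵐ ξ : ℝ, p (-ξ) :=
  (Measure.measurePreserving_neg (volume : Measure ℝ)).quasiMeasurePreserving.ae h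

/-- The Hankel transformation with kernel `√(xy) J_m(xy)`, defined through its action
`f̂(ξ) ↦ Ξ_m(2πξ) f̂(-ξ)` on Mellin transforms. -/
def hankel (m : ℂ) (hm : -1 < m.re) : L2Pos →L[ℂ] L2Pos :=
  (mellinL2.symm.toContinuousLinearEquiv : Lp ℂ 2 (volume : Measure ℝ) →L[ℂ] L2Pos) ∘L
    mulL2 volume _ (isSymbol_Xi_mul hm (2 * Real.pi)) ∘L reflectL2.toContinuousLinearMap ∘L
      (mellinL2.toContinuousLinearEquiv : L2Pos →L[ℂ] Lp ℂ 2 (volume : Measure ℝ))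

theorem mellinL2_hankel_ae {m : ℂ} (hm : -1 < m.re) (f : L2Pos) :
    (mellinL2 (hankel m hm f) : ℝ → ℂ) =ᵐ[volume]
      fun ξ => Xi m (2 * Real.pi * ξ) * mellinL2 f (-ξ) := by
  have e : mellinL2 (hankel m hm f) = mulL2 volume _ (isSymbol_Xi_mul hm (2 * Real.pi))
      (reflectL2 (mellinL2 f)) := mellinL2.apply_symm_apply _
  rw [e]
  filter_upwards [mulL2_ae (isSymbol_Xi_mul hm (2 * Real.pi)) (reflectL2 (mellinL2 f)),
    reflectL2_ae (mellinL2 f)] with ξ h1 h2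
  rw [h1, h2]

theorem hankel_eq_iff {m : ℂ} (hm : -1 < m.re) (f g : L2Pos) :
    hankel m hm f = g ↔ (mellinL2 g : ℝ → ℂ) =ᵐ[volume]
      fun ξ => Xi m (2 * Real.pi * ξ) * mellinL2 f (-ξ) := by
  constructor
  · rintro rfl; exact mellinL2_hankel_ae hm f
  · intro h
    exact mellinL2.injective (Lp.ext ((mellinL2_hankel_ae hm f).trans h.symm))

theorem hankel_hankel {m : ℂ} (hm : -1 < m.re) (f : L2Pos) :
    hankel m hm (hankel m hm f) = f := by
  rw [hankel_eq_iff]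
  filter_upwards [ae_neg (mellinL2_hankel_ae hm f)] with ξ h1
  rw [h1, neg_neg, ← mul_assoc, mul_comm (Xi m _), mul_neg, Xi_neg_mul_Xi hm, one_mul]

theorem inner_hankel_left {m : ℂ} (hm : -1 < m.re) (hm' : -1 < (starRingEnd ℂ m).re)
    (f g : L2Pos) : inner ℂ (hankel m hm f) g = inner ℂ f (hankel (starRingEnd ℂ m) hm' g) := by
  rw [← mellinL2.inner_map_map, ← mellinL2.inner_map_map f, L2.inner_def, L2.inner_def,
    ← integral_neg_eq_self]
  refine integral_congr_ae ?_
  filter_upwards [ae_neg (mellinL2_hankel_ae hm f), mellinL2_hankel_ae hm' g] with ξ h1 h2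
  rw [h1, h2, neg_neg, RCLike.inner_apply', RCLike.inner_apply', map_mul, conj_Xi, mul_neg, neg_neg]
  ring

/-! ### Gaussians -/

/-- The function `x^{m+1/2} e^{-λ x²/2}`, up to a factor reproduced by the Hankel transformation. -/
def gaussFun (m : ℂ) (l : ℝ) (x : ℝ) : ℂ :=
  (x : ℂ) ^ (m + 1 / 2) * Complex.exp (-((l / 2 * x ^ 2 : ℝ) : ℂ))

theorem norm_gaussFun (m : ℂ) (l : ℝ) {x : ℝ} (hx : 0 < x) :
    ‖gaussFun m l x‖ = x ^ (m.re + 1 / 2) * Real.exp (-(l / 2 * x ^ 2)) := by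
  rw [gaussFun, norm_mul, Complex.norm_cpow_eq_rpow_re_of_pos hx, ← Complex.ofReal_neg,
    Complex.norm_exp_ofReal]
  simp

theorem measurable_gaussFun (m : ℂ) (l : ℝ) : Measurable (gaussFun m l) := by
  unfold gaussFun
  fun_prop

theorem memLp_gaussFun {m : ℂ} (hm : -1 < m.re) {l : ℝ} (hl : 0 < l) :
    MemLp (gaussFun m l) 2 volPos := by
  rw [memLp_two_iff_integrable_sq_norm (measurable_gaussFun m l).aestronglyMeasurable]
  have h := integrableOn_rpow_mul_exp_neg_mul_sq hl (s := 2 * m.re + 1) (by linarith)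
  refine h.congr_fun (fun x hx => ?_) measurableSet_Ioi
  have hx0 : (0 : ℝ) < x := hx
  simp only
  rw [norm_gaussFun m l hx0, mul_pow, ← Real.rpow_mul_natCast hx0.le,
    ← Real.exp_nat_mul]
  congr 2
  · push_cast; ring
  · push_cast; ring

theorem mellinConvergent_gaussFun {m : ℂ} (hm : -1 < m.re) {l : ℝ} (hl : 0 < l) :
    MellinConvergent (gaussFun m l) (1 / 2) := by
  have h := integrableOn_rpow_mul_exp_neg_mul_sq (half_pos hl) (s := m.re) (by linarith)
  refine Integrable.mono' h ?_ ?_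
  · exact Measurable.aestronglyMeasurable (by have := measurable_gaussFun m l; fun_prop)
  · filter_upwards [ae_restrict_mem measurableSet_Ioi] with x hx
    have hx0 : (0 : ℝ) < x := hx
    rw [norm_smul, norm_gaussFun m l hx0, Complex.norm_cpow_eq_rpow_re_of_pos hx0, ← mul_assoc,
      ← Real.rpow_add hx0]
    refine le_of_eq ?_
    congr 2
    · simp; ring
    · ring

theorem mellin_gaussFun {m : ℂ} {l : ℝ} (hl : 0 < l) {s : ℂ} (hs : 0 < (s + m + 1 / 2).re) :
    mellin (gaussFun m l) s = 1 / 2 * ((2 / l : ℝ) : ℂ) ^ ((s + m + 1 / 2) / 2) *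
      Complex.Gamma ((s + m + 1 / 2) / 2) := by
  have e1 : mellin (gaussFun m l) s = mellin (fun x : ℝ =>
      (fun y : ℝ => Complex.exp (-((l / 2 : ℝ) * y : ℂ))) (x ^ (2 : ℝ))) (s + (m + 1 / 2)) := by
    rw [← mellin_cpow_smul]
    congr 1
    ext x
    rw [gaussFun, smul_eq_mul, Real.rpow_two]
    push_cast
    rfl
  rw [e1, mellin_comp_rpow (fun y : ℝ => Complex.exp (-((l / 2 : ℝ) * y : ℂ))), ← add_assoc,
    mellin, abs_of_pos two_pos]
  have hs' : 0 < ((s + m + 1 / 2) / 2).re := by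
    have : (s + m + 1 / 2) / 2 = (s + m + 1 / 2) / ((2 : ℝ) : ℂ) := by push_cast; rfl
    rw [this, Complex.div_ofReal_re]; exact half_pos hs
  have h := Complex.integral_cpow_mul_exp_neg_mul_Ioi hs' (half_pos hl)
  simp only [smul_eq_mul]
  rw [Complex.ofReal_ofNat, h, Complex.real_smul, mul_assoc]
  congr 1
  · simp
  · congr 2
    push_cast
    rw [one_div_div]

theorem mellinL2_gaussFun {m : ℂ} (hm : -1 < m.re) {l : ℝ} (hl : 0 < l) :
    (mellinL2 ((memLp_gaussFun hm hl).toLp _) : ℝ → ℂ) =ᵐ[volume] fun ξ =>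
      1 / 2 * ((2 / l : ℝ) : ℂ) ^ ((m + 1 + Complex.I * (2 * Real.pi * ξ : ℝ)) / 2) *
        Complex.Gamma ((m + 1 + Complex.I * (2 * Real.pi * ξ : ℝ)) / 2) := by
  filter_upwards [mellinL2_ae (memLp_gaussFun hm hl).coeFn_toLp (mellinConvergent_gaussFun hm hl)]
    with ξ h1
  have e : (1 / 2 + 2 * Real.pi * ξ * Complex.I + m + 1 / 2 : ℂ) =
      m + 1 + Complex.I * (2 * Real.pi * ξ : ℝ) := by push_cast; ring
  rw [h1, mellin_gaussFun hl, e]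
  rw [e]
  simp
  linarith

/-- On Mellin transforms this is the identity
`Ξ_m(t) Γ((m + 1 - i t) / 2) = 2^{i t} Γ((m + 1 + i t) / 2)`. -/
theorem hankel_gaussFun {m : ℂ} (hm : -1 < m.re) {l : ℝ} (hl : 0 < l) :
    hankel m hm ((memLp_gaussFun hm hl).toLp _) =
      ((l : ℂ) ^ (-m - 1)) • (memLp_gaussFun hm (inv_pos.2 hl)).toLp _ := by
  rw [hankel_eq_iff, map_smul]
  filter_upwards [ae_neg (mellinL2_gaussFun hm hl), mellinL2_gaussFun hm (inv_pos.2 hl),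
    Lp.coeFn_smul ((l : ℂ) ^ (-m - 1)) (mellinL2 ((memLp_gaussFun hm (inv_pos.2 hl)).toLp _))]
    with ξ h1 h2 h3
  rw [h3, Pi.smul_apply, h1, h2, smul_eq_mul]
  set t : ℝ := 2 * Real.pi * ξ with ht
  have e1 : (m + 1 + Complex.I * (2 * Real.pi * -ξ : ℝ)) / 2 = (m + 1 - Complex.I * t) / 2 := by
    rw [ht]; push_cast; ring
  rw [e1, Xi]
  have hG := Complex.Gamma_ne_zero_of_re_pos (Xi_arg_re_pos' hm t)
  set z := (m + 1 - Complex.I * t) / 2 with hz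
  set w := (m + 1 + Complex.I * t) / 2 with hw
  have key : (l : ℂ) ^ (-m - 1) * ((2 / l⁻¹ : ℝ) : ℂ) ^ w =
      Complex.exp (Complex.I * Real.log 2 * t) * ((2 / l : ℝ) : ℂ) ^ z := by
    have hl0 : (l : ℂ) ≠ 0 := Complex.ofReal_ne_zero.2 hl.ne'
    have h20 : ((2 / l⁻¹ : ℝ) : ℂ) ≠ 0 := Complex.ofReal_ne_zero.2 (by positivity)
    have h30 : ((2 / l : ℝ) : ℂ) ≠ 0 := Complex.ofReal_ne_zero.2 (by positivity)
    rw [Complex.cpow_def_of_ne_zero hl0, Complex.cpow_def_of_ne_zero h20,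
      Complex.cpow_def_of_ne_zero h30, ← Complex.ofReal_log hl.le,
      ← Complex.ofReal_log (by positivity), ← Complex.ofReal_log (by positivity),
      ← Complex.exp_add, ← Complex.exp_add, Real.log_div two_ne_zero (inv_pos.2 hl).ne',
      Real.log_div two_ne_zero hl.ne', Real.log_inv, hw, hz]
    congr 1
    push_cast
    ring
  have hq := div_mul_cancel₀ (Complex.Gamma w) hG
  linear_combination (1 / 2 * Complex.Gamma w) * key -
    (1 / 2 * Complex.exp (Complex.I * Real.log 2 * t) * ((2 / l : ℝ) : ℂ) ^ z) * hq

/-! ### The Bessel series -/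

theorem add_natCast_ne_zero {m : ℂ} (hm : -1 < m.re) (k : ℕ) : m + k + 1 ≠ 0 := fun h => by
  have := congrArg Complex.re h
  simp at this
  linarith [(Nat.cast_nonneg k : (0 : ℝ) ≤ k)]

theorem Gamma_add_natCast_ne_zero {m : ℂ} (hm : -1 < m.re) (k : ℕ) :
    Complex.Gamma (m + k + 1) ≠ 0 :=
  Complex.Gamma_ne_zero_of_re_pos (by
    simp
    linarith [(Nat.cast_nonneg k : (0 : ℝ) ≤ k)])

theorem norm_Gamma_succ {m : ℂ} (hm : -1 < m.re) (k : ℕ) :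
    ‖Complex.Gamma (m + (k + 1 : ℕ) + 1)‖ = ‖m + k + 1‖ * ‖Complex.Gamma (m + k + 1)‖ := by
  rw [← norm_mul, ← Complex.Gamma_add_one _ (add_natCast_ne_zero hm k)]
  congr 2
  push_cast
  ring

theorem re_le_norm_add {m : ℂ} (k : ℕ) : m.re + k + 1 ≤ ‖m + k + 1‖ := by
  have := Complex.re_le_norm (m + k + 1)
  simpa using this

/-- The bound carries over from `k` to `k + 1`, since `Re m + k + 1 ≤ |m + k + 1|`. -/
theorem exists_Gamma_re_le {m : ℂ} (hm : -1 < m.re) :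
    ∃ D : ℝ, 0 < D ∧ ∀ k : ℕ, Real.Gamma (m.re + k + 1) ≤ D * ‖Complex.Gamma (m + k + 1)‖ := by
  have h0 : 0 < ‖Complex.Gamma (m + (0 : ℕ) + 1)‖ := norm_pos_iff.2 (Gamma_add_natCast_ne_zero hm 0)
  have h1 : 0 < Real.Gamma (m.re + (0 : ℕ) + 1) := Real.Gamma_pos_of_pos (by simp; linarith)
  refine ⟨Real.Gamma (m.re + (0 : ℕ) + 1) / ‖Complex.Gamma (m + (0 : ℕ) + 1)‖, div_pos h1 h0,
    fun k => ?_⟩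
  induction k with
  | zero => rw [div_mul_cancel₀ _ h0.ne']
  | succ k ih =>
    have hp : 0 < m.re + k + 1 := by linarith [(Nat.cast_nonneg k : (0 : ℝ) ≤ k)]
    have e : m.re + ((k + 1 : ℕ) : ℝ) + 1 = (m.re + k + 1) + 1 := by push_cast; ring
    rw [e, Real.Gamma_add_one hp.ne', norm_Gamma_succ hm, mul_left_comm]
    exact mul_le_mul (re_le_norm_add k) ih (Real.Gamma_pos_of_pos hp).le (norm_nonneg _)

theorem exists_le_norm_Gamma {m : ℂ} (hm : -1 < m.re) :
    ∃ δ : ℝ, 0 < δ ∧ ∀ k : ℕ, δ ≤ ‖Complex.Gamma (m + k + 1)‖ := by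
  have hp : ∀ k : ℕ, 0 < ‖Complex.Gamma (m + k + 1)‖ := fun k =>
    norm_pos_iff.2 (Gamma_add_natCast_ne_zero hm k)
  have h1 : ∀ k : ℕ, ‖Complex.Gamma (m + (1 : ℕ) + 1)‖ ≤
      ‖Complex.Gamma (m + (k + 1 : ℕ) + 1)‖ := by
    intro k
    induction k with
    | zero => simp
    | succ k ih =>
      refine ih.trans ?_
      rw [norm_Gamma_succ hm (k + 1)]
      refine le_mul_of_one_le_left (norm_nonneg _) ?_
      have := re_le_norm_add (m := m) (k + 1)
      push_cast at this ⊢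
      linarith [(Nat.cast_nonneg k : (0 : ℝ) ≤ k)]
  refine ⟨min ‖Complex.Gamma (m + (0 : ℕ) + 1)‖ ‖Complex.Gamma (m + (1 : ℕ) + 1)‖,
    lt_min (hp 0) (hp 1), fun k => ?_⟩
  cases k with
  | zero => exact min_le_left _ _
  | succ k => exact (min_le_right _ _).trans (h1 k)

/-- The terms of the Bessel series. -/
def besselTerm (m : ℂ) (z : ℝ) (k : ℕ) : ℂ :=
  (-1) ^ k / ((k.factorial : ℂ) * Complex.Gamma (m + k + 1)) * ((z / 2 : ℝ) : ℂ) ^ (m + 2 * k)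

theorem rpow_add_two_mul_natCast {x : ℝ} (hx : 0 < x) (r : ℝ) (k : ℕ) :
    x ^ (r + 2 * k) = x ^ r * (x ^ 2) ^ k := by
  rw [Real.rpow_add hx, ← pow_mul, ← Real.rpow_natCast]
  push_cast
  rfl

theorem norm_besselTerm (m : ℂ) {z : ℝ} (hz : 0 < z) (k : ℕ) :
    ‖besselTerm m z k‖ = (z / 2) ^ m.re * (((z / 2) ^ 2) ^ k / k.factorial) /
      ‖Complex.Gamma (m + k + 1)‖ := by
  rw [besselTerm, norm_mul, norm_div, norm_mul, norm_pow, norm_neg, norm_one, one_pow,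
    Complex.norm_natCast, Complex.norm_cpow_eq_rpow_re_of_pos (half_pos hz)]
  have : (m + 2 * k : ℂ).re = m.re + 2 * k := by simp
  rw [this, rpow_add_two_mul_natCast (half_pos hz), div_mul_eq_mul_div, one_mul, mul_div_assoc',
    div_div]

theorem hasSum_exp_bound (C q : ℝ) :
    HasSum (fun k : ℕ => C * (q ^ k / k.factorial)) (C * Real.exp q) := by
  rw [Real.exp_eq_exp_ℝ]
  exact (NormedSpace.expSeries_div_hasSum_exp q).mul_left C

theorem exists_norm_besselTerm_le {m : ℂ} (hm : -1 < m.re) :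
    ∃ C : ℝ, 0 < C ∧ ∀ z : ℝ, 0 < z → ∀ k : ℕ,
      ‖besselTerm m z k‖ ≤ C * z ^ m.re * (((z / 2) ^ 2) ^ k / k.factorial) := by
  obtain ⟨δ, hδ, h⟩ := exists_le_norm_Gamma hm
  refine ⟨(1 / 2) ^ m.re / δ, by positivity, fun z hz k => ?_⟩
  rw [norm_besselTerm m hz]
  have e : (1 / 2) ^ m.re / δ * z ^ m.re * (((z / 2) ^ 2) ^ k / k.factorial) =
      (z / 2) ^ m.re * (((z / 2) ^ 2) ^ k / k.factorial) / δ := by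
    rw [div_eq_mul_one_div z 2, Real.mul_rpow hz.le (by norm_num)]
    ring
  rw [e]
  exact div_le_div_of_nonneg_left (by positivity) hδ (h k)

theorem hasSum_besselJ {m : ℂ} (hm : -1 < m.re) {z : ℝ} (hz : 0 < z) :
    HasSum (besselTerm m z) (besselJ m z) := by
  obtain ⟨C, -, hC⟩ := exists_norm_besselTerm_le hm
  exact (Summable.of_norm_bounded (hasSum_exp_bound _ _).summable (hC z hz)).hasSum

theorem exists_norm_besselJ_le {m : ℂ} (hm : -1 < m.re) :
    ∃ C : ℝ, 0 < C ∧ ∀ z : ℝ, 0 < z → ‖besselJ m z‖ ≤ C * z ^ m.re * Real.exp ((z / 2) ^ 2) := by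
  obtain ⟨C, hC0, hC⟩ := exists_norm_besselTerm_le hm
  exact ⟨C, hC0, fun z hz => tsum_of_norm_bounded (hasSum_exp_bound _ _) (hC z hz)⟩

/-- The function `√z J_m(z)`, the kernel of the Hankel transformation being `√(xy) J_m(xy)`. -/
def hankelFun (m : ℂ) (z : ℝ) : ℂ := (Real.sqrt (2 / Real.pi) : ℂ) * besselJHalf m z

theorem hankelFun_eq (m : ℂ) (z : ℝ) : hankelFun m z = (Real.sqrt z : ℂ) * besselJ m z := by
  rw [hankelFun, besselJHalf, ← mul_assoc, ← Complex.ofReal_mul, ← Real.sqrt_mul (by positivity)]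
  congr 3
  field_simp

theorem exists_norm_hankelFun_le {m : ℂ} (hm : -1 < m.re) :
    ∃ C : ℝ, 0 < C ∧ ∀ z : ℝ, 0 < z →
      ‖hankelFun m z‖ ≤ C * z ^ (m.re + 1 / 2) * Real.exp ((z / 2) ^ 2) := by
  obtain ⟨C, hC0, hC⟩ := exists_norm_besselJ_le hm
  refine ⟨C, hC0, fun z hz => ?_⟩
  rw [hankelFun_eq, norm_mul, Complex.norm_real, Real.norm_of_nonneg (Real.sqrt_nonneg z),
    Real.rpow_add hz, ← Real.sqrt_eq_rpow]
  refine (mul_le_mul_of_nonneg_left (hC z hz) (Real.sqrt_nonneg z)).trans (le_of_eq ?_)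
  ring

theorem aestronglyMeasurable_hankelFun_mul {m : ℂ} (hm : -1 < m.re) :
    AEStronglyMeasurable (fun p : ℝ × ℝ => hankelFun m (p.1 * p.2)) (volPos.prod volPos) := by
  simp only [hankelFun_eq]
  refine AEStronglyMeasurable.mul (by fun_prop) ?_
  refine aestronglyMeasurable_of_tendsto_ae atTop
    (f := fun (n : ℕ) (p : ℝ × ℝ) => ∑ k ∈ Finset.range n, besselTerm m (p.1 * p.2) k) ?_ ?_
  · intro n
    refine Measurable.aestronglyMeasurable (Finset.measurable_fun_sum _ fun k _ => ?_)
    unfold besselTerm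
    fun_prop
  · rw [Measure.prod_restrict]
    filter_upwards [ae_restrict_mem (measurableSet_Ioi.prod measurableSet_Ioi)] with p hp
    exact (hasSum_besselJ hm (mul_pos hp.1 hp.2)).tendsto_sum_nat

/-- A Gaussian is reproduced by the integral operator with kernel `√(xy) J_m(xy)`; the Bessel
series can be integrated term by term. -/
theorem integral_hankelFun_gaussFun {m : ℂ} (hm : -1 < m.re) {l y : ℝ} (hl : 0 < l) (hy : 0 < y) :
    ∫ x, hankelFun m (x * y) * gaussFun m l x ∂volPos =
      (l : ℂ) ^ (-m - 1) * gaussFun m l⁻¹ y := by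
  obtain ⟨D, hD0, hD⟩ := exists_Gamma_re_le hm
  set c : ℕ → ℂ := fun k => (y : ℂ) ^ (1 / 2 : ℂ) * besselTerm m y k with hc
  set F : ℕ → ℝ → ℂ := fun k x =>
    c k * ((x : ℂ) ^ ((m + 2 * k + 3 / 2 : ℂ) - 1) • gaussFun m l x) with hF
  have hFx : ∀ x : ℝ, 0 < x → ∀ k : ℕ,
      F k x = (Real.sqrt (x * y) : ℂ) * besselTerm m (x * y) k * gaussFun m l x := by
    intro x hx k
    have hx0 : (x : ℂ) ≠ 0 := Complex.ofReal_ne_zero.2 hx.ne'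
    have e1 : (Real.sqrt (x * y) : ℂ) = (x : ℂ) ^ (1 / 2 : ℂ) * (y : ℂ) ^ (1 / 2 : ℂ) := by
      rw [Real.sqrt_eq_rpow, Complex.ofReal_cpow (mul_pos hx hy).le, Complex.ofReal_mul,
        Complex.mul_cpow_ofReal_nonneg hx.le hy.le]
      push_cast
      rfl
    have e2 : ((x * y / 2 : ℝ) : ℂ) ^ (m + 2 * k) =
        (x : ℂ) ^ (m + 2 * k) * ((y / 2 : ℝ) : ℂ) ^ (m + 2 * k) := by
      rw [mul_div_assoc, Complex.ofReal_mul,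
        Complex.mul_cpow_ofReal_nonneg hx.le (half_pos hy).le]
    have e3 : (m + 2 * k + 3 / 2 : ℂ) - 1 = 1 / 2 + (m + 2 * k) := by ring
    simp only [hF, hc, besselTerm]
    rw [e1, e2, e3, Complex.cpow_add _ _ hx0, smul_eq_mul]
    ring
  have hpt : ∀ x ∈ Ioi (0 : ℝ), hankelFun m (x * y) * gaussFun m l x = ∑' k, F k x := by
    intro x hx
    rw [tsum_congr (hFx x hx), tsum_mul_right, tsum_mul_left, hankelFun_eq,
      (hasSum_besselJ hm (mul_pos hx hy)).tsum_eq]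
  have hnorm : ∀ (k : ℕ) (x : ℝ), x ∈ Ioi (0 : ℝ) →
      ‖F k x‖ = ‖c k‖ * (x ^ (2 * m.re + 2 * k + 1) * Real.exp (-(l / 2) * x ^ (2 : ℝ))) := by
    intro k x hx
    have hx0 : (0 : ℝ) < x := hx
    simp only [hF]
    rw [norm_mul, norm_smul, norm_gaussFun m l hx0, Complex.norm_cpow_eq_rpow_re_of_pos hx0,
      ← mul_assoc (x ^ _), ← Real.rpow_add hx0, Real.rpow_two, neg_mul]
    congr 3
    simp
    ring
  have hq : ∀ k : ℕ, -1 < 2 * m.re + 2 * k + 1 := fun k => by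
    linarith [(Nat.cast_nonneg k : (0 : ℝ) ≤ k)]
  have hint : ∀ k, Integrable (F k) volPos := by
    intro k
    have h1 : Integrable (fun x : ℝ => ‖c k‖ *
        (x ^ (2 * m.re + 2 * k + 1) * Real.exp (-(l / 2) * x ^ (2 : ℝ)))) volPos :=
      (integrableOn_rpow_mul_exp_neg_mul_rpow (hq k) two_pos (half_pos hl)).const_mul _
    refine h1.mono' ?_ ?_
    · refine Measurable.aestronglyMeasurable ?_
      have := measurable_gaussFun m l
      fun_prop
    · filter_upwards [ae_restrict_mem measurableSet_Ioi] with x hx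
      exact (hnorm k x hx).le
  have hsum : Summable fun k => ∫ x, ‖F k x‖ ∂volPos := by
    refine Summable.of_nonneg_of_le (fun k => integral_nonneg fun x => norm_nonneg _) ?_
      (hasSum_exp_bound (D / 2 * y ^ (1 / 2 : ℝ) * (y / 2) ^ m.re * (2 / l) ^ (m.re + 1))
        ((y / 2) ^ 2 * (2 / l))).summable
    intro k
    have hΓ : 0 < ‖Complex.Gamma (m + k + 1)‖ := norm_pos_iff.2 (Gamma_add_natCast_ne_zero hm k)
    have hck : ‖c k‖ = y ^ (1 / 2 : ℝ) * ‖besselTerm m y k‖ := by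
      rw [hc]
      simp only
      rw [norm_mul, Complex.norm_cpow_eq_rpow_re_of_pos hy]
      congr 2
      simp
    have e1 : -(2 * m.re + 2 * k + 1 + 1) / 2 = -(m.re + 1 + k) := by ring
    have e2 : (2 * m.re + 2 * k + 1 + 1) / 2 = m.re + k + 1 := by ring
    rw [setIntegral_congr_fun measurableSet_Ioi (hnorm k), integral_const_mul,
      integral_rpow_mul_exp_neg_mul_rpow two_pos (hq k) (half_pos hl), e1, e2, hck,
      norm_besselTerm m hy, Real.rpow_neg (half_pos hl).le, ← Real.inv_rpow (half_pos hl).le,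
      inv_div, Real.rpow_add (by positivity), Real.rpow_natCast]
    have h3 : Real.Gamma (m.re + k + 1) / ‖Complex.Gamma (m + k + 1)‖ ≤ D :=
      (div_le_iff₀ hΓ).2 (hD k)
    set A : ℝ := 1 / 2 * y ^ (1 / 2 : ℝ) * (y / 2) ^ m.re * (2 / l) ^ (m.re + 1) *
      (((y / 2) ^ 2 * (2 / l)) ^ k / k.factorial) with hA
    have hA0 : 0 ≤ A := by positivity
    calc _ = A * (Real.Gamma (m.re + k + 1) / ‖Complex.Gamma (m + k + 1)‖) := by
            rw [hA, mul_pow]; ring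
      _ ≤ A * D := mul_le_mul_of_nonneg_left h3 hA0
      _ = _ := by rw [hA]; ring
  have hval : ∀ k, ∫ x, F k x ∂volPos = (y : ℂ) ^ (m + 1 / 2) * (l : ℂ) ^ (-m - 1) *
      ((-((l⁻¹ / 2 * y ^ 2 : ℝ) : ℂ)) ^ k / k.factorial) := by
    intro k
    have hs : 0 < (m + 2 * k + 3 / 2 + m + 1 / 2 : ℂ).re := by
      have : (m + 2 * k + 3 / 2 + m + 1 / 2 : ℂ) = m + m + 2 * k + (2 : ℝ) := by
        push_cast; ring
      rw [this]
      simp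
      linarith [hq k]
    have h1 := mellin_gaussFun hl hs
    rw [mellin] at h1
    simp only [hF]
    rw [integral_const_mul, h1]
    have e1 : (m + 2 * k + 3 / 2 + m + 1 / 2 : ℂ) / 2 = m + k + 1 := by ring
    have hΓ := Gamma_add_natCast_ne_zero hm k
    have hk : (k.factorial : ℂ) ≠ 0 := Nat.cast_ne_zero.2 k.factorial_ne_zero
    rw [e1, hc]
    simp only [besselTerm]
    have hy0 : (y : ℂ) ≠ 0 := Complex.ofReal_ne_zero.2 hy.ne'
    have hl0 : (l : ℂ) ≠ 0 := Complex.ofReal_ne_zero.2 hl.ne'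
    have e2 : ((y / 2 : ℝ) : ℂ) ^ (m + 2 * k) = (y : ℂ) ^ m * (y : ℂ) ^ (2 * k) *
        (2 : ℂ) ^ (-(m + 2 * k)) := by
      rw [div_eq_mul_inv, Complex.ofReal_mul, Complex.mul_cpow_ofReal_nonneg hy.le (by norm_num),
        Complex.cpow_add _ _ hy0, Complex.ofReal_inv, Complex.ofReal_ofNat,
        Complex.inv_cpow _ _ (by simp [Real.pi_ne_zero.symm]), Complex.cpow_neg]
      congr 2
      exact_mod_cast Complex.cpow_natCast (y : ℂ) (2 * k)
    have e3 : ((2 / l : ℝ) : ℂ) ^ (m + k + 1) = (2 : ℂ) ^ (m + k + 1) *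
        ((l : ℂ) ^ (-m - 1) * ((l : ℂ) ^ k)⁻¹) := by
      have : -m - 1 = -(m + k + 1) + k := by ring
      rw [this, Complex.cpow_add _ _ hl0, Complex.cpow_natCast, mul_assoc,
        mul_inv_cancel₀ (pow_ne_zero _ hl0), mul_one, div_eq_mul_inv, Complex.ofReal_mul,
        Complex.mul_cpow_ofReal_nonneg two_pos.le (inv_pos.2 hl).le, Complex.ofReal_inv,
        Complex.inv_cpow _ _ (by
          rw [Complex.arg_ofReal_of_nonneg hl.le]; exact Real.pi_ne_zero.symm),
        Complex.cpow_neg, Complex.ofReal_ofNat]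
    have e4 : (2 : ℂ) ^ (m + k + 1) = (2 : ℂ) ^ (m + 2 * k) * (2 : ℂ) * ((2 : ℂ) ^ k)⁻¹ := by
      have : m + k + 1 = m + 2 * k + 1 + (-k : ℂ) := by ring
      rw [this, Complex.cpow_add _ _ two_ne_zero, Complex.cpow_add _ _ two_ne_zero,
        Complex.cpow_one, Complex.cpow_neg, Complex.cpow_natCast]
    have e5 : (2 : ℂ) ^ (m + 2 * k) ≠ 0 := by simp [Complex.cpow_eq_zero_iff]
    have e6 : (-((l⁻¹ / 2 * y ^ 2 : ℝ) : ℂ)) ^ k =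
        (-1) ^ k * (y : ℂ) ^ (2 * k) * ((l : ℂ) ^ k)⁻¹ * ((2 : ℂ) ^ k)⁻¹ := by
      rw [pow_mul, ← inv_pow, ← inv_pow, ← mul_pow, ← mul_pow, ← mul_pow]
      congr 1
      push_cast
      ring
    rw [e2, e3, e4, e6, Complex.cpow_add _ _ hy0, Complex.cpow_neg]
    field_simp
  have h := hasSum_integral_of_summable_integral_norm hint hsum
  rw [setIntegral_congr_fun measurableSet_Ioi hpt, ← h.tsum_eq, tsum_congr hval, tsum_mul_left,
    gaussFun, Complex.exp_eq_exp_ℂ, (NormedSpace.expSeries_div_hasSum_exp _).tsum_eq]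
  ring

/-! ### The integral kernel of the Hankel transformation -/

theorem measurable_exp_neg_sq : Measurable fun x : ℝ => Real.exp (-x ^ 2) := by fun_prop

theorem exp_neg_sq_mem_Icc (x : ℝ) : Real.exp (-x ^ 2) ∈ Icc (0 : ℝ) 1 :=
  ⟨(Real.exp_pos _).le, Real.exp_le_one_iff.2 (by linarith [sq_nonneg x])⟩

/-- Vanishing of the moments `∫ v (e^{-x²})ⁿ` implies that of `∫ v φ(e^{-x²})` for continuous `φ`,
by the Weierstrass approximation theorem. -/
theorem integral_comp_exp_neg_sq_eq_zero {v : ℝ → ℂ} (hv : Integrable v volPos)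
    (h : ∀ n : ℕ, ∫ x, ((Real.exp (-x ^ 2) ^ n : ℝ) : ℂ) * v x ∂volPos = 0)
    {φ : ℝ → ℝ} (hφ : ContinuousOn φ (Icc 0 1)) (hφm : Measurable φ) :
    ∫ x, (φ (Real.exp (-x ^ 2)) : ℂ) * v x ∂volPos = 0 := by
  have hb : ∀ ψ : ℝ → ℝ, ContinuousOn ψ (Icc 0 1) → Measurable ψ →
      Integrable (fun x => (ψ (Real.exp (-x ^ 2)) : ℂ) * v x) volPos := by
    intro ψ hψ hψm
    obtain ⟨C, hC⟩ := isCompact_Icc.exists_bound_of_continuousOn hψ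
    refine hv.bdd_mul (c := C) ?_ ?_
    · exact (Complex.measurable_ofReal.comp
        (hψm.comp measurable_exp_neg_sq)).aestronglyMeasurable
    · exact ae_of_all _ fun x => by
        rw [Complex.norm_real]; exact hC _ (exp_neg_sq_mem_Icc x)
  have hpoly : ∀ p : Polynomial ℝ,
      ∫ x, ((p.eval (Real.exp (-x ^ 2)) : ℝ) : ℂ) * v x ∂volPos = 0 := by
    intro p
    have e : ∀ x, ((p.eval (Real.exp (-x ^ 2)) : ℝ) : ℂ) * v x = ∑ n ∈ Finset.range
        (p.natDegree + 1), (p.coeff n : ℂ) * (((Real.exp (-x ^ 2) ^ n : ℝ) : ℂ) * v x) := by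
      intro x
      rw [Polynomial.eval_eq_sum_range, Complex.ofReal_sum, Finset.sum_mul]
      refine Finset.sum_congr rfl fun n _ => ?_
      push_cast
      ring
    simp only [e]
    rw [integral_finsetSum]
    · refine Finset.sum_eq_zero fun n _ => ?_
      rw [integral_const_mul, h n, mul_zero]
    · intro n _
      exact (hb (fun t => t ^ n) (by fun_prop) (by fun_prop)).const_mul _
  have hN : 0 ≤ ∫ x, ‖v x‖ ∂volPos := integral_nonneg fun x => norm_nonneg _
  rw [← norm_eq_zero]
  refine le_antisymm (le_of_forall_pos_le_add fun ε hε => ?_) (norm_nonneg _)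
  obtain ⟨p, hp⟩ := exists_polynomial_near_of_continuousOn 0 1 φ hφ
    (ε / ((∫ x, ‖v x‖ ∂volPos) + 1)) (by positivity)
  have h1 : ∫ x, (φ (Real.exp (-x ^ 2)) : ℂ) * v x ∂volPos =
      ∫ x, ((φ (Real.exp (-x ^ 2)) : ℂ) * v x -
        ((p.eval (Real.exp (-x ^ 2)) : ℝ) : ℂ) * v x) ∂volPos := by
    rw [integral_sub (hb φ hφ hφm) (hb (fun t => p.eval t) p.continuous.continuousOn
      p.continuous.measurable), hpoly, sub_zero]
  rw [h1, zero_add]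
  have h2 : ‖∫ x, ((φ (Real.exp (-x ^ 2)) : ℂ) * v x -
        ((p.eval (Real.exp (-x ^ 2)) : ℝ) : ℂ) * v x) ∂volPos‖ ≤
      ∫ x, ε / ((∫ x, ‖v x‖ ∂volPos) + 1) * ‖v x‖ ∂volPos := by
    refine norm_integral_le_of_norm_le (hv.norm.const_mul _) (ae_of_all _ fun x => ?_)
    rw [← sub_mul, norm_mul, ← Complex.ofReal_sub, Complex.norm_real, norm_sub_rev]
    exact mul_le_mul_of_nonneg_right (hp _ (exp_neg_sq_mem_Icc x)).le (norm_nonneg _)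
  refine h2.trans ?_
  rw [integral_const_mul, div_mul_eq_mul_div, div_le_iff₀ (by positivity)]
  nlinarith

/-- An integrable function on the half-line is determined by its moments with respect to
`e^{-x²}`. -/
theorem ae_eq_zero_of_gauss_moments {v : ℝ → ℂ} (hv : Integrable v volPos)
    (h : ∀ n : ℕ, ∫ x, ((Real.exp (-x ^ 2) ^ n : ℝ) : ℂ) * v x ∂volPos = 0) :
    v =ᵐ[volPos] 0 := by
  have h0 := IsOpen.ae_eq_zero_of_integral_contDiff_smul_eq_zero isOpen_Ioi
    (locallyIntegrableOn_of_locallyIntegrable_restrict hv.locallyIntegrable) (by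
    intro g hg hgc hgs
    obtain ⟨R, hR⟩ := hgc.isCompact.isBounded.subset_closedBall 0
    have hgR : ∀ x : ℝ, |R| < x → g x = 0 := by
      intro x hx
      refine image_eq_zero_of_notMem_tsupport fun hx' => ?_
      have h1 := hR hx'
      rw [mem_closedBall_zero_iff, Real.norm_eq_abs] at h1
      linarith [le_abs_self x, le_abs_self R]
    have hg0 : g 0 = 0 := image_eq_zero_of_notMem_tsupport fun h => lt_irrefl (0 : ℝ) (hgs h)
    -- `g(x) = φ(e^{-x²})` with `φ(t) = g(√(-log t))`; since `log 0 = 0`, the value `φ(0)` is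
    -- `g(0) = 0`, which is the limit of `φ` at `0` as `g` has compact support
    have hφm : Measurable fun t : ℝ => g (Real.sqrt (-Real.log t)) :=
      hg.continuous.measurable.comp
        (Real.continuous_sqrt.measurable.comp Real.measurable_log.neg)
    have hφ : ContinuousOn (fun t : ℝ => g (Real.sqrt (-Real.log t))) (Icc 0 1) := by
      intro t ht
      rcases ht.1.eq_or_lt with rfl | ht0
      · have hev : ∀ᶠ t in 𝓝[Icc (0 : ℝ) 1] 0, g (Real.sqrt (-Real.log t)) = 0 := by
          have hpos : 0 < Real.exp (-(|R| + 1) ^ 2) := Real.exp_pos _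
          filter_upwards [self_mem_nhdsWithin, mem_nhdsWithin_of_mem_nhds (Iio_mem_nhds hpos)]
            with t ht ht'
          rcases ht.1.eq_or_lt with rfl | ht0
          · simpa using hg0
          · refine hgR _ (Real.lt_sqrt_of_sq_lt ?_)
            have := Real.log_lt_log ht0 ht'
            rw [Real.log_exp] at this
            nlinarith [abs_nonneg R]
        refine (continuousWithinAt_const (b := (0 : ℝ))).congr_of_eventuallyEq hev ?_
        simpa using hg0
      · refine ContinuousAt.continuousWithinAt ?_
        refine hg.continuous.continuousAt.comp (Real.continuous_sqrt.continuousAt.comp ?_)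
        exact (Real.continuousAt_log ht0.ne').neg
    have h1 := integral_comp_exp_neg_sq_eq_zero hv h hφ hφm
    rw [← setIntegral_eq_integral_of_forall_compl_eq_zero (s := Ioi (0 : ℝ)), ← h1]
    · refine setIntegral_congr_fun measurableSet_Ioi fun x hx => ?_
      rw [Real.log_exp, neg_neg, Real.sqrt_sq (le_of_lt hx), Complex.real_smul]
    · intro x hx
      rw [image_eq_zero_of_notMem_tsupport (fun h => hx (hgs h)), zero_smul])
  rw [Filter.EventuallyEq, ae_restrict_iff' measurableSet_Ioi]
  exact h0

theorem conj_gaussFun (m : ℂ) (l : ℝ) {x : ℝ} (hx : 0 < x) :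
    starRingEnd ℂ (gaussFun (starRingEnd ℂ m) l x) = gaussFun m l x := by
  have ha : (x : ℂ).arg ≠ Real.pi := by
    rw [Complex.arg_ofReal_of_nonneg hx.le]; exact Real.pi_ne_zero.symm
  have e : m + 1 / 2 = starRingEnd ℂ (starRingEnd ℂ m + 1 / 2) := by
    simp [map_ofNat (starRingEnd ℂ) 2]
  rw [gaussFun, gaussFun, map_mul, ← Complex.exp_conj, map_neg, Complex.conj_ofReal, e,
    Complex.cpow_conj _ _ ha, Complex.conj_ofReal]

/-- The bilinear pairing of `L²` functions with Gaussians. -/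
theorem inner_gaussFun {m : ℂ} (hm' : -1 < (starRingEnd ℂ m).re) {l : ℝ} (hl : 0 < l)
    (f : L2Pos) : inner ℂ ((memLp_gaussFun hm' hl).toLp _) f =
      ∫ x, f x * gaussFun m l x ∂volPos := by
  rw [L2.inner_def]
  refine integral_congr_ae ?_
  filter_upwards [(memLp_gaussFun hm' hl).coeFn_toLp, ae_restrict_mem measurableSet_Ioi]
    with x h1 hx
  rw [h1, RCLike.inner_apply', conj_gaussFun m l hx, mul_comm]

/-- Multiplication formula: the Hankel transformation is moved to the Gaussian. -/
theorem integral_hankel_mul_gaussFun {m : ℂ} (hm : -1 < m.re) {l : ℝ} (hl : 0 < l) (f : L2Pos) :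
    ∫ x, hankel m hm f x * gaussFun m l x ∂volPos =
      (l : ℂ) ^ (-m - 1) * ∫ x, f x * gaussFun m l⁻¹ x ∂volPos := by
  have hm' : -1 < (starRingEnd ℂ m).re := by simpa using hm
  have ha : (l : ℂ).arg ≠ Real.pi := by
    rw [Complex.arg_ofReal_of_nonneg hl.le]; exact Real.pi_ne_zero.symm
  have e : starRingEnd ℂ ((l : ℂ) ^ (-starRingEnd ℂ m - 1)) = (l : ℂ) ^ (-m - 1) := by
    have : -m - 1 = starRingEnd ℂ (-starRingEnd ℂ m - 1) := by simp
    rw [this, Complex.cpow_conj _ _ ha, Complex.conj_ofReal]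
  rw [← inner_gaussFun hm' hl, ← inner_conj_symm, inner_hankel_left hm hm', inner_conj_symm,
    hankel_gaussFun hm' hl, inner_smul_left, e, inner_gaussFun hm' (inv_pos.2 hl)]

theorem gaussFun_add_mul (m : ℂ) (l : ℝ) (n : ℕ) (x : ℝ) :
    gaussFun m (l + 2 * n) x = ((Real.exp (-x ^ 2) ^ n : ℝ) : ℂ) * gaussFun m l x := by
  have : ((Real.exp (-x ^ 2) ^ n : ℝ) : ℂ) = Complex.exp (-(n * x ^ 2 : ℂ)) := by
    rw [← Real.exp_nat_mul]
    push_cast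
    congr 1
    ring
  rw [this, gaussFun, gaussFun, mul_left_comm, ← Complex.exp_add]
  congr 2
  push_cast
  ring

/-- The Hankel transformation is given by its integral kernel on every `f ∈ L²` for which the
kernel can be paired with a Gaussian: both sides have the same integrals against the Gaussians. -/
theorem hankel_ae {m : ℂ} (hm : -1 < m.re) (f : L2Pos) {l : ℝ} (hl : 0 < l)
    (hint : Integrable (fun p : ℝ × ℝ => hankelFun m (p.1 * p.2) * f p.2 * gaussFun m l p.1)
      (volPos.prod volPos)) :
    (hankel m hm f : ℝ → ℂ) =ᵐ[volPos] fun x => ∫ y, hankelFun m (x * y) * f y ∂volPos := by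
  set u : ℝ → ℂ := fun x => ∫ y, hankelFun m (x * y) * f y ∂volPos with hu
  have hpow : ∀ n : ℕ, ∀ x : ℝ, ‖((Real.exp (-x ^ 2) ^ n : ℝ) : ℂ)‖ ≤ 1 := by
    intro n x
    rw [Complex.norm_real, Real.norm_of_nonneg (by positivity)]
    exact pow_le_one₀ (exp_neg_sq_mem_Icc x).1 (exp_neg_sq_mem_Icc x).2
  have hI1 : Integrable (fun x => hankel m hm f x * gaussFun m l x) volPos :=
    (Lp.memLp (hankel m hm f)).integrable_mul (memLp_gaussFun hm hl)
  have hI2 : Integrable (fun x => u x * gaussFun m l x) volPos := by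
    have := hint.integral_prod_left
    refine this.congr (ae_of_all _ fun x => ?_)
    simp only [hu]
    rw [← integral_mul_const]
  have hu_int : ∀ n : ℕ, ∫ x, u x * gaussFun m (l + 2 * n) x ∂volPos =
      ((l + 2 * n : ℝ) : ℂ) ^ (-m - 1) * ∫ y, f y * gaussFun m (l + 2 * n)⁻¹ y ∂volPos := by
    intro n
    have hln : 0 < l + 2 * n := by positivity
    have hi : Integrable (Function.uncurry fun x y : ℝ =>
        hankelFun m (x * y) * f y * gaussFun m (l + 2 * n) x) (volPos.prod volPos) := by
      have := hint.bdd_mul (f := fun p : ℝ × ℝ => ((Real.exp (-p.1 ^ 2) ^ n : ℝ) : ℂ)) (c := 1)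
        (by fun_prop) (ae_of_all _ fun p => hpow n p.1)
      refine this.congr (ae_of_all _ fun p => ?_)
      simp only [Function.uncurry]
      rw [gaussFun_add_mul]
      ring
    simp only [hu, ← integral_mul_const]
    rw [integral_integral_swap hi, ← integral_const_mul]
    refine setIntegral_congr_fun measurableSet_Ioi fun y hy => ?_
    have : ∀ x : ℝ, hankelFun m (x * y) * f y * gaussFun m (l + 2 * n) x =
        f y * (hankelFun m (x * y) * gaussFun m (l + 2 * n) x) := fun x => by ring
    simp only [this]
    rw [integral_const_mul, integral_hankelFun_gaussFun hm hln hy]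
    ring
  have hv : (fun x => (hankel m hm f x - u x) * gaussFun m l x) =ᵐ[volPos] 0 := by
    refine ae_eq_zero_of_gauss_moments ?_ ?_
    · simp only [sub_mul]; exact hI1.sub hI2
    · intro n
      have hln : 0 < l + 2 * n := by positivity
      have e : ∀ x, ((Real.exp (-x ^ 2) ^ n : ℝ) : ℂ) *
          ((hankel m hm f x - u x) * gaussFun m l x) =
          hankel m hm f x * gaussFun m (l + 2 * n) x - u x * gaussFun m (l + 2 * n) x := by
        intro x
        rw [gaussFun_add_mul]
        ring
      simp only [e]
      rw [integral_sub, integral_hankel_mul_gaussFun hm hln, hu_int, sub_self]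
      · exact (Lp.memLp (hankel m hm f)).integrable_mul (memLp_gaussFun hm hln)
      · have := hI2.bdd_mul (f := fun x : ℝ => ((Real.exp (-x ^ 2) ^ n : ℝ) : ℂ)) (c := 1)
          (by fun_prop) (ae_of_all _ fun x => hpow n x)
        refine this.congr (ae_of_all _ fun x => ?_)
        simp only
        rw [gaussFun_add_mul]
        ring
  filter_upwards [hv, ae_restrict_mem measurableSet_Ioi] with x hx hx0
  have hx0' : (0 : ℝ) < x := hx0
  have hg : gaussFun m l x ≠ 0 := by
    rw [← norm_pos_iff, norm_gaussFun m l hx0']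
    positivity
  exact sub_eq_zero.1 ((mul_eq_zero.1 hx).resolve_right hg)

theorem aestronglyMeasurable_hankelFun_mul_mul {m : ℂ} (hm : -1 < m.re) (f : L2Pos) (l : ℝ) :
    AEStronglyMeasurable (fun p : ℝ × ℝ => hankelFun m (p.1 * p.2) * f p.2 * gaussFun m l p.1)
      (volPos.prod volPos) :=
  ((aestronglyMeasurable_hankelFun_mul hm).mul (Lp.aestronglyMeasurable f).comp_snd).mul
    (measurable_gaussFun m l).aestronglyMeasurable.comp_fst

/-- For functions supported in a compact subinterval of `(0, ∞)` the kernel can be paired with a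
narrow Gaussian, which compensates the growth `e^{x² y² / 4}` of the bound on the Bessel series. -/
theorem exists_integrable_hankelFun_mul {m : ℂ} (hm : -1 < m.re) (f : L2Pos) {a b : ℝ} (ha : 0 < a)
    (hf : ∀ᵐ x ∂volPos, x ∉ Icc a b → f x = 0) :
    ∃ l : ℝ, 0 < l ∧ Integrable (fun p : ℝ × ℝ =>
      hankelFun m (p.1 * p.2) * f p.2 * gaussFun m l p.1) (volPos.prod volPos) := by
  obtain ⟨C, hC0, hC⟩ := exists_norm_hankelFun_le hm
  -- with this width `e^{(xy/2)²} e^{-λ x²/2} ≤ e^{-x²}` for `y ≤ b`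
  refine ⟨b ^ 2 / 2 + 2, by positivity, ?_⟩
  have hf1 : IntegrableOn (fun y : ℝ => ‖f y‖) (Icc a b) := by
    have h1 : MemLp (f : ℝ → ℂ) 2 (volume.restrict (Icc a b)) :=
      (Lp.memLp f).mono_measure
        (Measure.restrict_mono (fun x hx => mem_Ioi.2 (ha.trans_le hx.1)) le_rfl)
    exact (h1.integrable (by norm_num)).norm
  have hf2 : Integrable (fun y : ℝ => y ^ (m.re + 1 / 2) * ‖f y‖) volPos := by
    have h1 : IntegrableOn (fun y : ℝ => y ^ (m.re + 1 / 2) * ‖f y‖) (Icc a b) := by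
      refine hf1.continuousOn_mul (fun y hy => ?_) isCompact_Icc
      exact (Real.continuousAt_rpow_const _ _ (Or.inl (ha.trans_le hy.1).ne')).continuousWithinAt
    have h2 : Integrable ((Icc a b).indicator fun y : ℝ => y ^ (m.re + 1 / 2) * ‖f y‖) volPos :=
      (h1.integrable_indicator measurableSet_Icc).restrict
    refine h2.congr ?_
    filter_upwards [hf] with y hy
    by_cases h : y ∈ Icc a b
    · rw [indicator_of_mem h]
    · rw [indicator_of_notMem h, hy h, norm_zero, mul_zero]
  have hg : Integrable (fun x : ℝ => C * (x ^ (2 * m.re + 1) * Real.exp (-1 * x ^ 2))) volPos :=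
    Integrable.const_mul (integrableOn_rpow_mul_exp_neg_mul_sq one_pos (by linarith)) C
  refine (hg.mul_prod hf2).mono' (aestronglyMeasurable_hankelFun_mul_mul hm f _) ?_
  have hf' : ∀ᵐ p ∂(volPos.prod volPos), p.2 ∉ Icc a b → f p.2 = 0 :=
    Measure.quasiMeasurePreserving_snd.ae hf
  have hpos : ∀ᵐ p ∂(volPos.prod volPos), p ∈ Ioi (0 : ℝ) ×ˢ Ioi (0 : ℝ) := by
    rw [Measure.prod_restrict]
    exact ae_restrict_mem (measurableSet_Ioi.prod measurableSet_Ioi)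
  filter_upwards [hf', hpos] with p hp hp0
  obtain ⟨x, y⟩ := p
  have hx : (0 : ℝ) < x := hp0.1
  have hy : (0 : ℝ) < y := hp0.2
  simp only at hp ⊢
  by_cases h : y ∈ Icc a b
  · rw [norm_mul, norm_mul, norm_gaussFun _ _ hx]
    have h1 := hC (x * y) (mul_pos hx hy)
    have h2 : Real.exp ((x * y / 2) ^ 2) * Real.exp (-((b ^ 2 / 2 + 2) / 2 * x ^ 2)) ≤
        Real.exp (-1 * x ^ 2) := by
      rw [← Real.exp_add, Real.exp_le_exp]
      have : (x * y) ^ 2 ≤ (x * b) ^ 2 := by gcongr; exact h.2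
      nlinarith
    have e : x ^ (2 * m.re + 1) = x ^ (m.re + 1 / 2) * x ^ (m.re + 1 / 2) := by
      rw [← Real.rpow_add hx]; congr 1; ring
    rw [e]
    rw [Real.mul_rpow hx.le hy.le] at h1
    set X := x ^ (m.re + 1 / 2)
    set Y := y ^ (m.re + 1 / 2)
    have hX : 0 < X := by positivity
    have hY : 0 < Y := by positivity
    calc ‖hankelFun m (x * y)‖ * ‖f y‖ * (X * Real.exp (-((b ^ 2 / 2 + 2) / 2 * x ^ 2)))
        ≤ (C * (X * Y) * Real.exp ((x * y / 2) ^ 2)) * ‖f y‖ *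
          (X * Real.exp (-((b ^ 2 / 2 + 2) / 2 * x ^ 2))) := by gcongr
      _ = C * (X * X) * (Y * ‖f y‖) * (Real.exp ((x * y / 2) ^ 2) *
          Real.exp (-((b ^ 2 / 2 + 2) / 2 * x ^ 2))) := by ring
      _ ≤ C * (X * X) * (Y * ‖f y‖) * Real.exp (-1 * x ^ 2) := by gcongr
      _ = _ := by ring
  · rw [hp h]
    simp

theorem hankel_ae_of_support {m : ℂ} (hm : -1 < m.re) (f : L2Pos) {a b : ℝ} (ha : 0 < a)
    (hf : ∀ᵐ x ∂volPos, x ∉ Icc a b → f x = 0) :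
    (hankel m hm f : ℝ → ℂ) =ᵐ[volPos] fun x => ∫ y, hankelFun m (x * y) * f y ∂volPos := by
  obtain ⟨l, hl, hint⟩ := exists_integrable_hankelFun_mul hm f ha hf
  exact hankel_ae hm f hl hint

theorem integrable_hankelFun_mul_ae {m : ℂ} (hm : -1 < m.re) (f : L2Pos) {a b : ℝ} (ha : 0 < a)
    (hf : ∀ᵐ x ∂volPos, x ∉ Icc a b → f x = 0) :
    ∀ᵐ x ∂volPos, Integrable (fun y => hankelFun m (x * y) * f y) volPos := by
  obtain ⟨l, hl, hint⟩ := exists_integrable_hankelFun_mul hm f ha hf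
  filter_upwards [hint.prod_right_ae, ae_restrict_mem measurableSet_Ioi] with x hx hx0
  have hx0' : (0 : ℝ) < x := hx0
  have hg : gaussFun m l x ≠ 0 := by
    rw [← norm_pos_iff, norm_gaussFun m l hx0']
    positivity
  refine (hx.mul_const (gaussFun m l x)⁻¹).congr (ae_of_all _ fun y => ?_)
  exact mul_inv_cancel_right₀ hg _

/-! ### The sine transformation -/

theorem neg_one_lt_re_half : -1 < (1 / 2 : ℂ).re := by norm_num

/-- By Legendre's duplication formula the Bessel series of order `1/2` is the sine series. -/
theorem besselJHalf_half {z : ℝ} (hz : 0 < z) : besselJHalf (1 / 2) z = Real.sin z := by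
  have h1 := (hasSum_besselJ neg_one_lt_re_half hz).mul_left (Real.sqrt (Real.pi * z / 2) : ℂ)
  have h2 := Complex.hasSum_sin z
  rw [besselJHalf, Complex.ofReal_sin]
  refine h1.unique (h2.congr_fun fun k => ?_)
  have hπ : (Real.sqrt Real.pi : ℂ) ≠ 0 :=
    Complex.ofReal_ne_zero.2 (Real.sqrt_pos.2 Real.pi_pos).ne'
  have hz2 : ((z / 2 : ℝ) : ℂ) ≠ 0 := Complex.ofReal_ne_zero.2 (half_pos hz).ne'
  have hΓ := Complex.Gamma_mul_Gamma_add_half ((k : ℂ) + 1)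
  have e1 : (2 : ℂ) * (k + 1) = (2 * k + 1 : ℕ) + 1 := by push_cast; ring
  have e2 : (k : ℂ) + 1 + 1 / 2 = 1 / 2 + k + 1 := by ring
  have e3 : 1 - (((2 * k + 1 : ℕ) : ℂ) + 1) = -((2 * k + 1 : ℕ) : ℂ) := by ring
  rw [e1, e2, e3, Complex.Gamma_nat_eq_factorial, Complex.Gamma_nat_eq_factorial,
    Complex.cpow_neg, Complex.cpow_natCast] at hΓ
  have e4 : (Real.sqrt (Real.pi * z / 2) : ℂ) * ((z / 2 : ℝ) : ℂ) ^ (1 / 2 + 2 * k : ℂ) =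
      (Real.sqrt Real.pi : ℂ) * ((z / 2 : ℝ) : ℂ) ^ (2 * k + 1) := by
    have e5 : ((z / 2 : ℝ) : ℂ) ^ (1 / 2 + 2 * k : ℂ) =
        (Real.sqrt (z / 2) : ℂ) * ((z / 2 : ℝ) : ℂ) ^ (2 * k) := by
      rw [Complex.cpow_add _ _ hz2, Real.sqrt_eq_rpow, Complex.ofReal_cpow (half_pos hz).le]
      congr 1
      · push_cast; rfl
      · exact_mod_cast Complex.cpow_natCast ((z / 2 : ℝ) : ℂ) (2 * k)
    have e6 : (Real.sqrt (z / 2) : ℂ) * (Real.sqrt (z / 2) : ℂ) = ((z / 2 : ℝ) : ℂ) := by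
      rw [← Complex.ofReal_mul, Real.mul_self_sqrt (half_pos hz).le]
    rw [e5, mul_div_assoc, Real.sqrt_mul Real.pi_pos.le, Complex.ofReal_mul, pow_succ, ← e6]
    ring
  have hf : ((2 * k + 1).factorial : ℂ) ≠ 0 := Nat.cast_ne_zero.2 (Nat.factorial_ne_zero _)
  rw [besselTerm, hΓ, mul_left_comm, e4]
  push_cast
  rw [div_pow]
  field_simp

/-- The sine transformation, as the Hankel transformation of order `1/2`. -/
def sineTransform : L2Pos →L[ℂ] L2Pos := hankel (1 / 2) neg_one_lt_re_half

theorem hankelFun_half {z : ℝ} (hz : 0 < z) :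
    hankelFun (1 / 2) z = (Real.sqrt (2 / Real.pi) : ℂ) * (Real.sin z : ℝ) := by
  rw [hankelFun, besselJHalf_half hz]

theorem sineTransform_ae (f : L2Pos) (hf : Integrable (f : ℝ → ℂ) volPos) :
    (sineTransform f : ℝ → ℂ) =ᵐ[volPos] fun x =>
      ∫ y, (Real.sqrt (2 / Real.pi) : ℂ) * (Real.sin (x * y) : ℝ) * f y ∂volPos := by
  have h : (sineTransform f : ℝ → ℂ) =ᵐ[volPos] fun x =>
      ∫ y, hankelFun (1 / 2) (x * y) * f y ∂volPos := by
    refine hankel_ae neg_one_lt_re_half f one_pos ?_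
    have hg : Integrable (fun x : ℝ => Real.sqrt (2 / Real.pi) *
        (x ^ (1 : ℝ) * Real.exp (-(1 / 2) * x ^ 2))) volPos :=
      Integrable.const_mul (integrableOn_rpow_mul_exp_neg_mul_sq (by norm_num) (by norm_num)) _
    refine (hg.mul_prod hf.norm).mono'
      (aestronglyMeasurable_hankelFun_mul_mul neg_one_lt_re_half f _) ?_
    rw [Measure.prod_restrict]
    filter_upwards [ae_restrict_mem (measurableSet_Ioi.prod measurableSet_Ioi)] with p hp
    have hx : (0 : ℝ) < p.1 := hp.1
    have hy : (0 : ℝ) < p.2 := hp.2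
    rw [norm_mul, norm_mul, norm_gaussFun _ _ hx, hankelFun_half (mul_pos hx hy), norm_mul,
      Complex.norm_real, Complex.norm_real, Real.norm_of_nonneg (Real.sqrt_nonneg _),
      Real.norm_eq_abs]
    have e1 : (1 / 2 : ℂ).re + 1 / 2 = 1 := by norm_num
    have e2 : -(1 / 2 * p.1 ^ 2) = -(1 / 2) * p.1 ^ 2 := by ring
    rw [e1, e2]
    calc _ ≤ Real.sqrt (2 / Real.pi) * 1 * ‖f p.2‖ *
          (p.1 ^ (1 : ℝ) * Real.exp (-(1 / 2) * p.1 ^ 2)) := by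
            have := Real.abs_sin_le_one (p.1 * p.2)
            gcongr
      _ = _ := by ring
  filter_upwards [h, ae_restrict_mem measurableSet_Ioi] with x hx hx0
  rw [hx]
  refine setIntegral_congr_fun measurableSet_Ioi fun y hy => ?_
  rw [hankelFun_half (mul_pos hx0 hy)]

theorem sineTransform_sineTransform (f : L2Pos) : sineTransform (sineTransform f) = f :=
  hankel_hankel _ f

theorem inner_sineTransform_left (f g : L2Pos) :
    inner ℂ (sineTransform f) g = inner ℂ f (sineTransform g) := by
  have e : starRingEnd ℂ (1 / 2) = 1 / 2 := by simp [map_ofNat (starRingEnd ℂ) 2]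
  have h : ∀ (m' : ℂ) (hm' : -1 < m'.re), m' = 1 / 2 → hankel m' hm' = sineTransform := by
    rintro _ _ rfl; rfl
  have h0 : -1 < (starRingEnd ℂ (1 / 2)).re := by rw [e]; exact neg_one_lt_re_half
  have h1 := inner_hankel_left neg_one_lt_re_half h0 f g
  rw [h _ h0 e] at h1
  exact h1

/-- The sine transformation as a unitary operator. -/
def sineTransformₗᵢ : L2Pos ≃ₗᵢ[ℂ] L2Pos where
  toFun := sineTransform
  map_add' := map_add _
  map_smul' := map_smul _
  invFun := sineTransform
  left_inv := sineTransform_sineTransform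
  right_inv := sineTransform_sineTransform
  norm_map' f := by
    change ‖sineTransform f‖ = ‖f‖
    rw [@norm_eq_sqrt_re_inner ℂ, inner_sineTransform_left, sineTransform_sineTransform,
      ← @norm_eq_sqrt_re_inner ℂ]

/-! ### The sine transformation diagonalizes the Dirichlet Laplacian -/

theorem norm_one_add_sq_inv (x : ℝ) : ‖((1 + x ^ 2 : ℝ) : ℂ)⁻¹‖ = (1 + x ^ 2)⁻¹ := by
  rw [norm_inv, Complex.norm_real, Real.norm_of_nonneg (by positivity)]

theorem ofReal_one_add_sq_ne_zero (x : ℝ) : ((1 + x ^ 2 : ℝ) : ℂ) ≠ 0 :=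
  Complex.ofReal_ne_zero.2 (by positivity)

theorem memLp_one_add_sq_inv :
    MemLp (fun x : ℝ => ((1 + x ^ 2 : ℝ) : ℂ)⁻¹) 2 volPos := by
  have hm : Measurable fun x : ℝ => ((1 + x ^ 2 : ℝ) : ℂ)⁻¹ := by fun_prop
  rw [memLp_two_iff_integrable_sq_norm hm.aestronglyMeasurable]
  refine (integrable_inv_one_add_sq.restrict (s := Ioi 0)).mono' (by fun_prop)
    (ae_of_all _ fun x => ?_)
  rw [norm_one_add_sq_inv, Real.norm_of_nonneg (by positivity)]
  exact pow_le_of_le_one (by positivity) (inv_le_one_of_one_le₀ (by nlinarith)) two_ne_zero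

theorem memLp_mul_one_add_sq_inv :
    MemLp (fun x : ℝ => (x : ℂ) * ((1 + x ^ 2 : ℝ) : ℂ)⁻¹) 2 volPos := by
  have hm : Measurable fun x : ℝ => (x : ℂ) * ((1 + x ^ 2 : ℝ) : ℂ)⁻¹ := by fun_prop
  rw [memLp_two_iff_integrable_sq_norm hm.aestronglyMeasurable]
  refine (integrable_inv_one_add_sq.restrict (s := Ioi 0)).mono'
    (hm.norm.pow_const 2).aestronglyMeasurable (ae_of_all _ fun x => ?_)
  rw [norm_mul, norm_one_add_sq_inv, Real.norm_of_nonneg (by positivity), mul_pow,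
    Complex.norm_real, Real.norm_eq_abs, sq_abs, inv_pow, ← div_eq_mul_inv, ← one_div,
    div_le_div_iff₀ (by positivity) (by positivity)]
  nlinarith [sq_nonneg x]

/-- If `û` and `x² û` are square integrable, then `û` and `x û` are integrable. -/
theorem integrable_of_sq_mul {f g : L2Pos}
    (h : (g : ℝ → ℂ) =ᵐ[volPos] fun x => ((x ^ 2 : ℝ) : ℂ) * f x) :
    Integrable (f : ℝ → ℂ) volPos ∧ Integrable (fun x : ℝ => (x : ℂ) * f x) volPos := by
  have e : ∀ᵐ x ∂volPos, f x = ((1 + x ^ 2 : ℝ) : ℂ)⁻¹ * (f + g : L2Pos) x := by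
    filter_upwards [h, Lp.coeFn_add f g] with x h1 h2
    rw [h2, Pi.add_apply, h1, eq_inv_mul_iff_mul_eq₀ (ofReal_one_add_sq_ne_zero x)]
    push_cast
    ring
  constructor
  · refine (memLp_one_add_sq_inv.integrable_mul (Lp.memLp (f + g))).congr ?_
    filter_upwards [e] with x hx
    rw [hx]; rfl
  · refine (memLp_mul_one_add_sq_inv.integrable_mul (Lp.memLp (f + g))).congr ?_
    filter_upwards [e] with x hx
    rw [hx, ← mul_assoc]; rfl

theorem integral_sin_mul {t y : ℝ} (ht : 0 ≤ t) (hy : 0 < y) :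
    ∫ x in Ioc 0 t, Real.sin (y * x) = (1 - Real.cos (t * y)) / y := by
  rw [← intervalIntegral.integral_of_le ht,
    intervalIntegral.integral_comp_mul_left (fun x => Real.sin x) hy.ne', integral_sin]
  simp
  ring_nf

theorem integral_cos_mul {x y : ℝ} (hx : 0 ≤ x) (hy : 0 < y) :
    ∫ t in Ioc 0 x, Real.cos (t * y) * y = Real.sin (x * y) := by
  rw [← intervalIntegral.integral_of_le hx, intervalIntegral.integral_mul_const,
    intervalIntegral.integral_comp_mul_right (fun x => Real.cos x) hy.ne', integral_cos]
  simp
  field_simp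

theorem volPos_Ioc_ne_top (t : ℝ) : volPos (Ioc 0 t) ≠ ⊤ :=
  ((Measure.restrict_apply_le _ _).trans_lt measure_Ioc_lt_top).ne

theorem volPos_restrict_Ioc (t : ℝ) : volPos.restrict (Ioc 0 t) = volume.restrict (Ioc 0 t) := by
  rw [volPos, Measure.restrict_restrict measurableSet_Ioc,
    inter_eq_self_of_subset_left Ioc_subset_Ioi_self]

theorem ae_Ioc_of_ae_volPos {p : ℝ → Prop} (h : ∀ᵐ x ∂volPos, p x) (t : ℝ) :
    ∀ᵐ x ∂(volume.restrict (Ioc 0 t)), p x :=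
  ae_mono (Measure.restrict_mono Ioc_subset_Ioi_self le_rfl) h

theorem sineTransform_indicator {t : ℝ} (ht : 0 ≤ t) :
    (sineTransform (indicatorConstLp 2 measurableSet_Ioc (volPos_Ioc_ne_top t) 1) : ℝ → ℂ)
      =ᵐ[volPos] fun y => ((Real.sqrt (2 / Real.pi) * ((1 - Real.cos (t * y)) / y) : ℝ) : ℂ) := by
  set f : L2Pos := indicatorConstLp 2 measurableSet_Ioc (volPos_Ioc_ne_top t) 1 with hf
  have hfe : (f : ℝ → ℂ) =ᵐ[volPos] (Ioc 0 t).indicator fun _ => 1 := indicatorConstLp_coeFn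
  have hfi : Integrable (f : ℝ → ℂ) volPos :=
    ((integrableOn_const (volPos_Ioc_ne_top t)).integrable_indicator measurableSet_Ioc).congr
      hfe.symm
  filter_upwards [sineTransform_ae f hfi, ae_restrict_mem measurableSet_Ioi] with y hy hy0
  rw [hy, ← integral_sin_mul ht hy0, ← integral_const_mul, ← integral_complex_ofReal,
    ← volPos_restrict_Ioc, ← integral_indicator measurableSet_Ioc]
  refine integral_congr_ae ?_
  filter_upwards [hfe] with x hx
  rw [hx]
  by_cases h : x ∈ Ioc 0 t
  · simp [h]
  · simp [h]

/-- If `S v = x² S u` then `u` is in the domain of the Dirichlet Laplacian, and is mapped to `v`. -/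
theorem mem_graph_dirichletLaplacian_of_sineTransform {u v : L2Pos}
    (h : (sineTransform v : ℝ → ℂ) =ᵐ[volPos] fun x => ((x ^ 2 : ℝ) : ℂ) * sineTransform u x) :
    (u, v) ∈ dirichletLaplacian.graph := by
  obtain ⟨hi, hi1⟩ := integrable_of_sq_mul h
  set w := sineTransform u with hw
  set s := Real.sqrt (2 / Real.pi) with hs
  -- the primitive of `v`, by Parseval's identity for the indicator function of `(0, t]`
  have hprim : ∀ t : ℝ, 0 ≤ t → ∫ τ in (0 : ℝ)..t, v τ =
      ∫ y, (s : ℂ) * ((y : ℂ) * w y) ∂volPos -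
        ∫ y, (s : ℂ) * ((Real.cos (t * y) * y : ℝ) : ℂ) * w y ∂volPos := by
    intro t ht
    have h1 := L2.inner_indicatorConstLp_one (𝕜 := ℂ) measurableSet_Ioc (volPos_Ioc_ne_top t) v
    rw [intervalIntegral.integral_of_le ht, ← volPos_restrict_Ioc, ← h1,
      ← sineTransform_sineTransform v, ← inner_sineTransform_left, L2.inner_def, ← integral_sub]
    · refine integral_congr_ae ?_
      filter_upwards [h, sineTransform_indicator ht, ae_restrict_mem measurableSet_Ioi]
        with y h2 h3 hy
      rw [h2, h3, RCLike.inner_apply', Complex.conj_ofReal]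
      have hy0 : (y : ℂ) ≠ 0 := Complex.ofReal_ne_zero.2 (ne_of_gt hy)
      push_cast
      field_simp
      ring
    · exact hi1.const_mul _
    · have := (hi1.const_mul (s : ℂ)).bdd_mul (f := fun y : ℝ => (Real.cos (t * y) : ℂ)) (c := 1)
        (by fun_prop) (ae_of_all _ fun y => by
          rw [Complex.norm_real]; exact Real.abs_cos_le_one _)
      refine this.congr (ae_of_all _ fun y => ?_)
      push_cast
      ring
  rw [mem_graph_dirichletLaplacian]
  refine ⟨∫ y, (s : ℂ) * ((y : ℂ) * w y) ∂volPos, ?_⟩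
  have hu := sineTransform_ae w hi
  rw [hw, sineTransform_sineTransform] at hu
  filter_upwards [hu, ae_restrict_mem measurableSet_Ioi] with x hx hx0
  have hx0' : (0 : ℝ) ≤ x := le_of_lt hx0
  rw [hx, intervalIntegral.integral_of_le hx0']
  have e1 : ∀ t ∈ Ioc 0 x, ((∫ y, (s : ℂ) * ((y : ℂ) * w y) ∂volPos) - ∫ τ in (0 : ℝ)..t, v τ) =
      ∫ y, (s : ℂ) * ((Real.cos (t * y) * y : ℝ) : ℂ) * w y ∂volPos := by
    intro t ht
    rw [hprim t ht.1.le, sub_sub_cancel]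
  rw [setIntegral_congr_fun measurableSet_Ioc e1, integral_integral_swap]
  · refine setIntegral_congr_fun measurableSet_Ioi fun y hy => ?_
    rw [integral_mul_const, integral_const_mul, integral_complex_ofReal, integral_cos_mul hx0' hy]
  · have h1 : Integrable (fun p : ℝ × ℝ => (s : ℂ) * ((p.2 : ℂ) * w p.2))
        ((volume.restrict (Ioc 0 x)).prod volPos) := by
      have h2 : Integrable (fun _ : ℝ => (s : ℂ)) (volume.restrict (Ioc 0 x)) :=
        integrableOn_const measure_Ioc_lt_top.ne
      exact h2.mul_prod hi1
    have := h1.bdd_mul (f := fun p : ℝ × ℝ => (Real.cos (p.1 * p.2) : ℂ)) (c := 1)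
      (by fun_prop) (ae_of_all _ fun y => by
        rw [Complex.norm_real]; exact Real.abs_cos_le_one _)
    refine this.congr (ae_of_all _ fun p => ?_)
    simp only [Function.uncurry]
    push_cast
    ring

/-- `-1` is not an eigenvalue of the Dirichlet Laplacian: a solution of `p'' = p` with `p(0) = 0` is
a multiple of `sinh`. -/
theorem eq_zero_of_mem_graph_neg {p : L2Pos} (h : (p, -p) ∈ dirichletLaplacian.graph) : p = 0 := by
  rw [mem_graph_dirichletLaplacian] at h
  obtain ⟨c, hc⟩ := h
  set w : ℝ → ℂ := (Ioi (0 : ℝ)).indicator p with hw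
  have hwi : ∀ x y : ℝ, IntervalIntegrable w volume x y := by
    have h1 : MemLp w 2 volume := (memLp_indicator_iff_restrict measurableSet_Ioi).2 (Lp.memLp p)
    intro x y
    exact ((h1.locallyIntegrable (by norm_num)).integrableOn_isCompact
      isCompact_uIcc).intervalIntegrable
  set Q : ℝ → ℂ := fun x => c + ∫ t in (0 : ℝ)..x, w t with hQ
  have hQc : Continuous Q :=
    continuous_const.add (intervalIntegral.continuous_primitive hwi 0)
  set P : ℝ → ℂ := fun x => ∫ t in (0 : ℝ)..x, Q t with hP
  have hPd : ∀ x, HasDerivAt P (Q x) x := fun x =>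
    (hQc.integral_hasStrictDerivAt 0 x).hasDerivAt
  have hPc : Continuous P := continuous_iff_continuousAt.2 fun x => (hPd x).continuousAt
  have hpP : ∀ᵐ x ∂volPos, p x = P x := by
    filter_upwards [hc, ae_restrict_mem measurableSet_Ioi] with x hx hx0
    rw [hx]
    refine intervalIntegral.integral_congr fun t ht => ?_
    rw [uIcc_of_le (le_of_lt hx0)] at ht
    simp only [hQ]
    rw [sub_eq_add_neg, ← intervalIntegral.integral_neg]
    congr 1
    rw [intervalIntegral.integral_of_le ht.1, intervalIntegral.integral_of_le ht.1]
    refine integral_congr_ae ?_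
    filter_upwards [ae_Ioc_of_ae_volPos (Lp.coeFn_neg p) t, ae_restrict_mem measurableSet_Ioc]
      with τ hτ hτ0
    rw [hτ, Pi.neg_apply, neg_neg, hw, indicator_of_mem (show τ ∈ Ioi (0 : ℝ) from hτ0.1)]
  set R : ℝ → ℂ := fun x => c + ∫ t in (0 : ℝ)..x, P t with hR
  have hRd : ∀ x, HasDerivAt R (P x) x := fun x =>
    ((hPc.integral_hasStrictDerivAt 0 x).hasDerivAt).const_add c
  have hQR : ∀ x, 0 ≤ x → Q x = R x := by
    intro x hx
    simp only [hQ, hR]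
    congr 1
    rw [intervalIntegral.integral_of_le hx, intervalIntegral.integral_of_le hx]
    refine integral_congr_ae ?_
    filter_upwards [ae_Ioc_of_ae_volPos hpP x, ae_restrict_mem measurableSet_Ioc] with τ hτ hτ0
    rw [hw, indicator_of_mem (show τ ∈ Ioi (0 : ℝ) from hτ0.1), hτ]
  have hP0 : P 0 = 0 := by simp [hP]
  have hR0 : R 0 = c := by simp [hR]
  -- `P' = R` and `R' = P`, so that `P ± R` are multiples of `e^{± x}`
  have h1 : ∀ x, 0 ≤ x → (P x + R x) * Complex.exp (-x) = c := by
    intro x hx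
    have hd : ∀ t, 0 ≤ t → HasDerivAt (fun t : ℝ => (P t + R t) * Complex.exp (-t)) 0 t := by
      intro t ht
      have he : HasDerivAt (fun t : ℝ => Complex.exp (-t)) (Complex.exp (-t) * -1) t :=
        (HasDerivAt.ofReal_comp (hasDerivAt_id t)).neg.cexp
      have := ((hPd t).add (hRd t)).mul he
      rw [hQR t ht] at this
      refine this.congr_deriv ?_
      simp only [Pi.add_apply]
      ring
    have := constant_of_has_deriv_right_zero (a := 0) (b := x)
      (fun t ht => (hd t ht.1).continuousAt.continuousWithinAt)
      (fun t ht => (hd t ht.1).hasDerivWithinAt) x ⟨hx, le_rfl⟩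
    simpa [hP0, hR0] using this
  have h2 : ∀ x, 0 ≤ x → (P x - R x) * Complex.exp x = -c := by
    intro x hx
    have hd : ∀ t, 0 ≤ t → HasDerivAt (fun t : ℝ => (P t - R t) * Complex.exp t) 0 t := by
      intro t ht
      have he : HasDerivAt (fun t : ℝ => Complex.exp t) (Complex.exp t * 1) t :=
        (HasDerivAt.ofReal_comp (hasDerivAt_id t)).cexp
      have := ((hPd t).sub (hRd t)).mul he
      rw [hQR t ht] at this
      refine this.congr_deriv ?_
      simp only [Pi.sub_apply]
      ring
    have := constant_of_has_deriv_right_zero (a := 0) (b := x)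
      (fun t ht => (hd t ht.1).continuousAt.continuousWithinAt)
      (fun t ht => (hd t ht.1).hasDerivWithinAt) x ⟨hx, le_rfl⟩
    simpa [hP0, hR0] using this
  have hsinh : ∀ x, 0 ≤ x → P x = c * (Real.sinh x : ℝ) := by
    intro x hx
    have e : Complex.exp (-x) * Complex.exp x = 1 := by
      rw [← Complex.exp_add, neg_add_cancel, Complex.exp_zero]
    rw [Complex.ofReal_sinh, Complex.sinh]
    linear_combination (Complex.exp x / 2) * h1 x hx + (Complex.exp (-x) / 2) * h2 x hx - P x * e
  -- `c sinh x` is square integrable only for `c = 0`, as `x ≤ sinh x`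
  have hc0 : c = 0 := by
    by_contra hne
    have hI := (memLp_two_iff_integrable_sq_norm (Lp.aestronglyMeasurable p)).1 (Lp.memLp p)
    refine not_integrableOn_Ioi_rpow (2 : ℝ) ?_
    refine (hI.const_mul ((‖c‖ ^ 2)⁻¹)).mono' (by fun_prop) ?_
    filter_upwards [hpP, ae_restrict_mem measurableSet_Ioi] with x hx hx0
    have hx0' : (0 : ℝ) ≤ x := le_of_lt hx0
    have hcn : 0 < ‖c‖ := norm_pos_iff.2 hne
    rw [hx, hsinh x hx0', norm_mul, mul_pow, ← mul_assoc, inv_mul_cancel₀ (by positivity), one_mul,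
      Real.rpow_two, Complex.norm_real, Real.norm_of_nonneg (by positivity), Real.norm_eq_abs,
      sq_abs]
    have := Real.self_le_sinh_iff.2 hx0'
    gcongr
  refine Lp.ext ?_
  have hz : ((0 : L2Pos) : ℝ → ℂ) =ᵐ[volPos] 0 := Lp.coeFn_zero ℂ 2 volPos
  filter_upwards [hpP, hz, ae_restrict_mem measurableSet_Ioi] with x h1 h2 h3
  rw [h1, h2, hsinh x (le_of_lt h3), hc0, zero_mul]
  rfl

theorem isSymbol_one_add_sq_inv : IsSymbol fun x : ℝ => ((1 + x ^ 2 : ℝ) : ℂ)⁻¹ := by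
  refine ⟨by fun_prop, 1, fun x => ?_⟩
  rw [norm_one_add_sq_inv]
  exact inv_le_one_of_one_le₀ (by nlinarith)

/-- The operator `S x² S` is contained in the Dirichlet Laplacian `H_D`; since `S x² S + 1` is
surjective and `H_D + 1` is injective, the two operators are equal. -/
theorem mem_graph_dirichletLaplacian_iff_sineTransform (u v : L2Pos) :
    (u, v) ∈ dirichletLaplacian.graph ↔
      (sineTransformₗᵢ v : ℝ → ℂ) =ᵐ[volPos]
        fun x => ((x ^ 2 : ℝ) : ℂ) * sineTransformₗᵢ u x := by
  refine ⟨fun h => ?_, mem_graph_dirichletLaplacian_of_sineTransform⟩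
  set w := sineTransform (u + v) with hw
  set r := mulL2 volPos _ isSymbol_one_add_sq_inv w with hr
  have hmem : (sineTransform (w - r) |> sineTransform : ℝ → ℂ) =ᵐ[volPos]
      fun x => ((x ^ 2 : ℝ) : ℂ) * sineTransform (sineTransform r) x := by
    rw [sineTransform_sineTransform, sineTransform_sineTransform]
    filter_upwards [Lp.coeFn_sub w r, mulL2_ae isSymbol_one_add_sq_inv w] with x h1 h2
    have := ofReal_one_add_sq_ne_zero x
    rw [h1, Pi.sub_apply, hr, h2]
    push_cast at this ⊢
    field_simp
    ring
  have h' := mem_graph_dirichletLaplacian_of_sineTransform hmem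
  have hsum : sineTransform r + sineTransform (w - r) = u + v := by
    rw [← map_add, add_sub_cancel, hw, sineTransform_sineTransform]
  have hd := Submodule.sub_mem _ h h'
  have hv : v - sineTransform (w - r) = -(u - sineTransform r) := by
    rw [neg_sub, sub_eq_sub_iff_add_eq_add, hsum, add_comm]
  have h0 : u - sineTransform r = 0 := by
    refine eq_zero_of_mem_graph_neg ?_
    rw [← hv]
    exact hd
  have hu : u = sineTransform r := sub_eq_zero.1 h0
  have hv' : v = sineTransform (w - r) := by
    rw [h0, neg_zero] at hv
    exact sub_eq_zero.1 hv
  rw [hu, hv']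
  exact hmem

/-- The sine transformation as a spectral representation of the Dirichlet Laplacian. -/
def dirichletRep : SpectralRep dirichletLaplacian where
  X := ℝ
  μ := volPos
  V := sineTransformₗᵢ
  a x := x ^ 2
  measurable_a := by fun_prop
  mem_graph_iff := mem_graph_dirichletLaplacian_iff_sineTransform

/-! ### The denominator of the kernel for non-exceptional pairs -/

theorem ne_zero_of_abs_re_pos {m : ℂ} (hm0 : 0 < |m.re|) : m ≠ 0 := by
  rintro rfl
  simp at hm0

theorem cpow_eq_exp_log {l : ℝ} (hl : 0 < l) (m : ℂ) :
    (l : ℂ) ^ m = Complex.exp ((Real.log l : ℝ) * m) := by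
  rw [Complex.cpow_def_of_ne_zero (Complex.ofReal_ne_zero.2 hl.ne'), Complex.ofReal_log hl.le]

/-- A zero `s` of the denominator, with `y² / 4 = e^s`, gives the logarithm `w = (iπ - s) m` of `ς`,
for which `Im (w / m) = π`. -/
theorem one_sub_exp_ne_zero {m κ : ℂ} (hm0 : m ≠ 0) (hκ : ¬ IsExceptionalPair m κ) (s : ℝ) :
    1 - varsigma m κ * Complex.exp (-Complex.I * Real.pi * m) * Complex.exp (s * m) ≠ 0 := by
  intro h
  rw [mul_assoc, ← Complex.exp_add, sub_eq_zero] at h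
  refine hκ ⟨?_, (Complex.I * Real.pi - s) * m, ?_, Or.inl ?_⟩
  · rintro rfl
    simp [varsigma] at h
  · have e : (Complex.I * Real.pi - s) * m = -(-Complex.I * Real.pi * m + s * m) := by ring
    rw [e, Complex.exp_neg]
    exact (eq_inv_of_mul_eq_one_left h.symm).symm
  · rw [mul_div_cancel_right₀ _ hm0]
    simp

/-- A function `s ↦ 1 - a e^{m s}` without zeros on the real line is bounded away from zero:
for `a ≠ 0` it tends to `1` at one end of the line and to infinity at the other. -/
theorem exists_le_norm_one_sub_exp {a m : ℂ} (hm0 : 0 < |m.re|)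
    (h : ∀ s : ℝ, 1 - a * Complex.exp (s * m) ≠ 0) :
    ∃ δ : ℝ, 0 < δ ∧ ∀ s : ℝ, δ ≤ ‖1 - a * Complex.exp (s * m)‖ := by
  rcases eq_or_ne a 0 with rfl | ha
  · exact ⟨1, one_pos, fun s => by simp⟩
  have ha' : 0 < ‖a‖ := norm_pos_iff.2 ha
  set B := (|Real.log ‖a‖| + 1) / |m.re| with hB
  have hB0 : 0 ≤ B := by positivity
  have hcont : Continuous fun s : ℝ => ‖1 - a * Complex.exp (s * m)‖ := by fun_prop
  obtain ⟨s₀, -, hs₀⟩ := isCompact_Icc.exists_isMinOn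
    (nonempty_Icc.2 (by linarith : -B ≤ B)) hcont.continuousOn
  refine ⟨min ‖1 - a * Complex.exp (s₀ * m)‖ (1 / 2),
    lt_min (norm_pos_iff.2 (h s₀)) (by norm_num), fun s => ?_⟩
  by_cases hs : s ∈ Icc (-B) B
  · exact (min_le_left _ _).trans (hs₀ hs)
  refine (min_le_right _ _).trans ?_
  have hz : ‖a * Complex.exp (s * m)‖ = Real.exp (Real.log ‖a‖ + m.re * s) := by
    rw [norm_mul, Complex.norm_exp, Real.exp_add, Real.exp_log ha']
    congr 2
    simp [mul_comm]
  have hlt : |Real.log ‖a‖| + 1 < |m.re * s| := by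
    have h1 : B < |s| := by
      rw [← not_le, abs_le]
      exact hs
    rw [abs_mul, mul_comm, ← div_lt_iff₀ hm0]
    exact h1
  have hab := abs_le.1 (le_refl |Real.log ‖a‖|)
  rcases le_total 0 (m.re * s) with h0 | h0
  · rw [abs_of_nonneg h0] at hlt
    have h1 : 2 ≤ ‖a * Complex.exp (s * m)‖ := by
      rw [hz]
      linarith [Real.add_one_le_exp (Real.log ‖a‖ + m.re * s)]
    have := norm_sub_norm_le (a * Complex.exp (s * m)) 1
    rw [norm_sub_rev, norm_one] at this
    linarith
  · rw [abs_of_nonpos h0] at hlt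
    have h1 : ‖a * Complex.exp (s * m)‖ ≤ 1 / 2 := by
      rw [hz]
      have h2 : Real.log ‖a‖ + m.re * s ≤ -1 := by linarith
      have h3 := Real.add_one_le_exp (-(Real.log ‖a‖ + m.re * s))
      rw [Real.exp_neg] at h3
      have h4 : (2 : ℝ) ≤ (Real.exp (Real.log ‖a‖ + m.re * s))⁻¹ := by linarith
      rw [le_inv_comm₀ two_pos (Real.exp_pos _)] at h4
      linarith
    have := norm_sub_norm_le 1 (a * Complex.exp (s * m))
    rw [norm_one] at this
    linarith

theorem exists_le_norm_denominator {m κ : ℂ} (hm0 : 0 < |m.re|) (hκ : ¬ IsExceptionalPair m κ) :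
    ∃ δ : ℝ, 0 < δ ∧ ∀ y : ℝ, δ ≤ ‖1 - varsigma m κ * Complex.exp (-Complex.I * Real.pi * m) *
      ((y ^ 2 / 4 : ℝ) : ℂ) ^ m‖ := by
  have hm := ne_zero_of_abs_re_pos hm0
  obtain ⟨δ, hδ, h⟩ := exists_le_norm_one_sub_exp hm0 (one_sub_exp_ne_zero hm hκ)
  refine ⟨min δ 1, lt_min hδ one_pos, fun y => ?_⟩
  -- at `y = 0` the power is `0` by convention, and the denominator is `1`
  rcases eq_or_ne y 0 with rfl | hy
  · rw [zero_pow two_ne_zero, zero_div, Complex.ofReal_zero, Complex.zero_cpow hm, mul_zero,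
      sub_zero, norm_one]
    exact min_le_right _ _
  · rw [cpow_eq_exp_log (by positivity)]
    exact (min_le_left _ _).trans (h _)

theorem isSymbol_lastFactor {m κ : ℂ} (hm0 : 0 < |m.re|) (hκ : ¬ IsExceptionalPair m κ) :
    IsSymbol fun y : ℝ => lastFactor m κ (y ^ 2) := by
  obtain ⟨δ, hδ, h⟩ := exists_le_norm_denominator hm0 hκ
  refine ⟨by unfold lastFactor; fun_prop,
    ‖Complex.exp (-Complex.I * (Real.pi / 2) * m)‖ / δ, fun y => ?_⟩
  rw [lastFactor, norm_div]
  exact div_le_div_of_nonneg_left (norm_nonneg _) hδ (h y)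

theorem isSymbol_sigmaPow_mul_lastFactor {m κ : ℂ} (hm0 : 0 < |m.re|)
    (hκ : ¬ IsExceptionalPair m κ) :
    IsSymbol fun y : ℝ => sigmaPow m κ (y ^ 2) * lastFactor m κ (y ^ 2) := by
  -- `σ g = e^{iπm} (1 - d) e^{-iπm/2} / d = e^{iπm} (g - e^{-iπm/2})`, where `d` is the denominator
  have hs : IsSymbol fun y : ℝ => Complex.exp (Complex.I * Real.pi * m) *
      (lastFactor m κ (y ^ 2) + -Complex.exp (-Complex.I * (Real.pi / 2) * m)) :=
    (IsSymbol.const _).mul ((isSymbol_lastFactor hm0 hκ).add (IsSymbol.const _))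
  obtain ⟨δ, hδ, h⟩ := exists_le_norm_denominator hm0 hκ
  convert hs using 2 with y
  have hd := norm_pos_iff.1 (hδ.trans_le (h y))
  have he : Complex.exp (Complex.I * Real.pi * m) * Complex.exp (-Complex.I * Real.pi * m) = 1 := by
    rw [← Complex.exp_add]
    ring_nf
    exact Complex.exp_zero
  rw [sigmaPow, lastFactor]
  generalize Complex.exp (Complex.I * Real.pi * m) = E' at he ⊢
  generalize Complex.exp (-Complex.I * Real.pi * m) = E at he hd ⊢
  generalize Complex.exp (-Complex.I * (Real.pi / 2) * m) = G
  generalize ((y ^ 2 / 4 : ℝ) : ℂ) ^ m = Y at hd ⊢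
  rw [mul_div_assoc', div_add' _ _ _ hd, mul_div_assoc']
  congr 1
  linear_combination (-(varsigma m κ * Y * G)) * he

/-! ### The Hankel transformations with general boundary conditions -/

theorem hankelKernel_neg_one (m κ : ℂ) (x y : ℝ) :
    hankelKernel (-1) m κ x y = hankelFun m (x * y) * lastFactor m κ (y ^ 2) -
      hankelFun (-m) (x * y) * (sigmaPow m κ (y ^ 2) * lastFactor m κ (y ^ 2)) := by
  rw [hankelKernel, lastFactor, sigmaPow, hankelFun, hankelFun]
  push_cast
  have e : (-1 : ℂ) * Complex.I = -Complex.I := by ring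
  rw [e]
  ring

/-- The bounded operator with kernel `ℱ^-_{m,κ}(x, y)`, the factors depending on `y` being bounded
multiplication operators. -/
def hankelMinus {m κ : ℂ} (hm0 : 0 < |m.re|) (hκ : ¬ IsExceptionalPair m κ) (hm : -1 < m.re)
    (hm' : -1 < (-m).re) : L2Pos →L[ℂ] L2Pos :=
  hankel m hm ∘L mulL2 volPos _ (isSymbol_lastFactor hm0 hκ) -
    hankel (-m) hm' ∘L mulL2 volPos _ (isSymbol_sigmaPow_mul_lastFactor hm0 hκ)

theorem isHankelExtension_hankelMinus {m κ : ℂ} (hm0 : 0 < |m.re|)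
    (hκ : ¬ IsExceptionalPair m κ) (hm : -1 < m.re) (hm' : -1 < (-m).re) :
    IsHankelExtension (-1) m κ (hankelMinus hm0 hκ hm hm') := by
  intro h f h1 h2 h3 hf
  obtain ⟨a, b, ha, -, hab⟩ := IsTest.exists_bounds ⟨h1, h2, h3⟩
  have hsupp : ∀ {φ : ℝ → ℂ} (hφ : IsSymbol φ),
      ∀ᵐ y ∂volPos, y ∉ Icc a b → mulL2 volPos φ hφ f y = 0 := by
    intro φ hφ
    filter_upwards [hf, mulL2_ae hφ f] with y h4 h5 h6
    rw [h5, h4, hab y h6, mul_zero]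
  set s1 := isSymbol_lastFactor hm0 hκ
  set s2 := isSymbol_sigmaPow_mul_lastFactor hm0 hκ
  change ((hankel m hm (mulL2 volPos _ s1 f) - hankel (-m) hm' (mulL2 volPos _ s2 f) : L2Pos) :
    ℝ → ℂ) =ᵐ[volPos] _
  filter_upwards [Lp.coeFn_sub (hankel m hm (mulL2 volPos _ s1 f))
      (hankel (-m) hm' (mulL2 volPos _ s2 f)),
    hankel_ae_of_support hm _ ha (hsupp s1), hankel_ae_of_support hm' _ ha (hsupp s2),
    integrable_hankelFun_mul_ae hm _ ha (hsupp s1),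
    integrable_hankelFun_mul_ae hm' _ ha (hsupp s2)] with x e1 e2 e3 i1 i2
  rw [e1, Pi.sub_apply, e2, e3, ← integral_sub i1 i2]
  refine integral_congr_ae ?_
  filter_upwards [hf, mulL2_ae s1 f, mulL2_ae s2 f] with y e4 e5 e6
  rw [e5, e6, e4, hankelKernel_neg_one]
  ring

theorem hankelKernel_half (x y : ℝ) : hankelKernel 1 (1 / 2) 0 x y =
    Complex.exp (Complex.I * (Real.pi / 4)) * hankelFun (1 / 2) (x * y) := by
  have e : ((1 : ℤ) : ℂ) * Complex.I * (Real.pi / 2) * (1 / 2) = Complex.I * (Real.pi / 4) := by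
    push_cast; ring
  rw [hankelKernel, hankelFun, varsigma, e]
  simp
  ring

theorem isHankelExtension_smul_sineTransform :
    IsHankelExtension 1 (1 / 2) 0 (Complex.exp (Complex.I * (Real.pi / 4)) • sineTransform) := by
  intro h f h1 h2 h3 hf
  obtain ⟨a, b, ha, -, hab⟩ := IsTest.exists_bounds ⟨h1, h2, h3⟩
  have hsupp : ∀ᵐ y ∂volPos, y ∉ Icc a b → f y = 0 := by
    filter_upwards [hf] with y h4 h6
    rw [h4, hab y h6]
  rw [smul_apply]
  filter_upwards [Lp.coeFn_smul (Complex.exp (Complex.I * (Real.pi / 4))) (sineTransform f),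
    hankel_ae_of_support neg_one_lt_re_half f ha hsupp] with x e1 e2
  rw [e1, Pi.smul_apply, sineTransform, e2, smul_eq_mul, ← integral_const_mul]
  refine integral_congr_ae ?_
  filter_upwards [hf] with y e4
  rw [e4, hankelKernel_half, mul_assoc]

theorem IsHankelExtension.unique {ε : ℤ} {m κ : ℂ} {F F' : L2Pos →L[ℂ] L2Pos}
    (h : IsHankelExtension ε m κ F) (h' : IsHankelExtension ε m κ F') : F = F' := by
  refine clm_ext_of_isTest _ _ fun g hg => Lp.ext ?_
  exact (h g _ hg.1 hg.2 hg.3 hg.memLp.coeFn_toLp).trans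
    (h' g _ hg.1 hg.2 hg.3 hg.memLp.coeFn_toLp).symm

theorem IsHankelExtension.hankelTransform {ε : ℤ} {m κ : ℂ} {F : L2Pos →L[ℂ] L2Pos}
    (h : IsHankelExtension ε m κ F) : IsHankelExtension ε m κ (hankelTransform ε m κ) := by
  have hex : ∃ F, IsHankelExtension ε m κ F := ⟨F, h⟩
  rw [_root_.hankelTransform, dif_pos hex]
  exact hex.choose_spec

theorem IsHankelExtension.hankelTransform_eq {ε : ℤ} {m κ : ℂ} {F : L2Pos →L[ℂ] L2Pos}
    (h : IsHankelExtension ε m κ F) : _root_.hankelTransform ε m κ = F :=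
  h.hankelTransform.unique h

/-! ### The transpose of the sine transformation -/

/-- The sine transformation has a real kernel. -/
theorem star_sineTransform_star (f : L2Pos) (hf : Integrable (f : ℝ → ℂ) volPos) :
    star (sineTransform (star f)) = sineTransform f := by
  have hs : Integrable ((star f : L2Pos) : ℝ → ℂ) volPos := by
    refine hf.congr' (Lp.aestronglyMeasurable _) ?_
    filter_upwards [Lp.coeFn_star f] with x hx
    rw [hx, Pi.star_apply, norm_star]
  refine Lp.ext ?_
  filter_upwards [Lp.coeFn_star (sineTransform (star f)), sineTransform_ae _ hs,
    sineTransform_ae f hf] with x h1 h2 h3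
  rw [h1, Pi.star_apply, h2, h3, ← starRingEnd_apply, ← integral_conj]
  refine integral_congr_ae ?_
  filter_upwards [Lp.coeFn_star f] with y hy
  rw [hy, Pi.star_apply, ← starRingEnd_apply, map_mul, map_mul, Complex.conj_conj,
    Complex.conj_ofReal, Complex.conj_ofReal]

theorem adjoint_sineTransform : ContinuousLinearMap.adjoint sineTransform = sineTransform :=
  ((ContinuousLinearMap.eq_adjoint_iff _ _).2 inner_sineTransform_left).symm

theorem transposeOp_smul_sineTransform (c : ℂ) :
    transposeOp (c • sineTransform) = c • sineTransform := by
  refine clm_ext_of_isTest _ _ fun g hg => ?_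
  set f := hg.memLp.toLp g with hf
  have hi : Integrable (f : ℝ → ℂ) volPos :=
    ((hg.contDiff.continuous.integrable_of_hasCompactSupport hg.hasCompactSupport).restrict).congr
      hg.memLp.coeFn_toLp.symm
  change star (ContinuousLinearMap.adjoint (c • sineTransform) (star f)) = c • sineTransform f
  rw [map_smulₛₗ, adjoint_sineTransform, smul_apply, L2Pos.star_smul, star_sineTransform_star f hi,
    ← starRingEnd_apply, Complex.conj_conj]

/-! ### The wave operator -/

theorem SpectralRep.fc_eq_bfc {H : Type*} [NormedAddCommGroup H] [InnerProductSpace ℂ H]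
    {T : H →ₗ.[ℂ] H} (R R' : SpectralRep T) {φ : ℝ → ℂ} (h : IsSymbol φ) :
    R.fc φ = (R'.bfc φ h : H →ₗ[ℂ] H).toPMap ⊤ := by
  rw [R.fc_congr R' h.1]
  exact R'.fc_eq_toPMap _ fun f => (R'.bfc_eq_iff h f _).1 rfl

theorem smul_toPMap_top {H : Type*} [AddCommGroup H] [Module ℂ H] (c : ℂ) (B : H →ₗ[ℂ] H) :
    c • B.toPMap ⊤ = (c • B).toPMap ⊤ :=
  LinearPMap.ext rfl fun _ _ _ => rfl

/-- The factorization of the Hankel transformation of order `m` through the sine transformation: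
`Ξ_{1/2}(A) Ξ_m(-A) S` has order `m`. -/
theorem bfc_Xi_bfc_Xi_sineTransform {m : ℂ} (hm : -1 < m.re) (f : L2Pos) :
    dilationRep.bfc _ (isSymbol_Xi neg_one_lt_re_half)
      (dilationRep.bfc _ ((isSymbol_Xi hm).comp measurable_neg) (sineTransform f)) =
        hankel m hm f := by
  rw [SpectralRep.bfc_eq_iff, SpectralRep.V_bfc]
  change (mellinL2 (hankel m hm f) : ℝ → ℂ) =ᵐ[volume] fun ξ => Xi (1 / 2) (-(2 * Real.pi * ξ)) *
    mulL2 volume (fun ξ : ℝ => Xi m (-(-(2 * Real.pi * ξ)))) _ (mellinL2 (sineTransform f)) ξ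
  filter_upwards [mellinL2_hankel_ae hm f, mellinL2_hankel_ae neg_one_lt_re_half f,
    mulL2_ae (((isSymbol_Xi hm).comp measurable_neg).comp dilationRep.measurable_a)
      (mellinL2 (sineTransform f))] with ξ h1 h2 h3
  have h2' : mellinL2 (sineTransform f) ξ = Xi (1 / 2) (2 * Real.pi * ξ) * mellinL2 f (-ξ) := h2
  refine h1.trans (Eq.trans ?_ (congrArg (Xi (1 / 2) (-(2 * Real.pi * ξ)) * ·) h3.symm))
  change _ = Xi (1 / 2) (-(2 * Real.pi * ξ)) *
    (Xi m (-(-(2 * Real.pi * ξ))) * mellinL2 (sineTransform f) ξ)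
  rw [neg_neg, h2']
  linear_combination (-(Xi m (2 * Real.pi * ξ) * mellinL2 f (-ξ))) *
    Xi_neg_mul_Xi neg_one_lt_re_half (2 * Real.pi * ξ)

theorem hankelMinus_smul_sineTransform {m κ : ℂ} (hm0 : 0 < |m.re|)
    (hκ : ¬ IsExceptionalPair m κ) (hm : -1 < m.re) (hm' : -1 < (-m).re) (c : ℂ) (f : L2Pos) :
    hankelMinus hm0 hκ hm hm' (c • sineTransform f) =
      c • dilationRep.bfc _ (isSymbol_Xi neg_one_lt_re_half)
        (dilationRep.bfc _ ((isSymbol_Xi hm).comp measurable_neg)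
            (sineTransform (mulL2 volPos _ (isSymbol_lastFactor hm0 hκ) (sineTransform f))) -
          dilationRep.bfc _ ((isSymbol_Xi hm').comp measurable_neg)
            (sineTransform (mulL2 volPos _ (isSymbol_sigmaPow_mul_lastFactor hm0 hκ)
              (sineTransform f)))) := by
  have e : ∀ g : L2Pos, hankelMinus hm0 hκ hm hm' g =
      hankel m hm (mulL2 volPos _ (isSymbol_lastFactor hm0 hκ) g) -
        hankel (-m) hm' (mulL2 volPos _ (isSymbol_sigmaPow_mul_lastFactor hm0 hκ) g) :=
    fun _ => rfl
  rw [ContinuousLinearMap.map_smul, e, ContinuousLinearMap.map_sub,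
    bfc_Xi_bfc_Xi_sineTransform hm, bfc_Xi_bfc_Xi_sineTransform hm']

theorem measurable_lastFactor (m κ : ℂ) : Measurable (lastFactor m κ) := by
  unfold lastFactor
  fun_prop

theorem measurable_sigmaPow (m κ : ℂ) : Measurable (sigmaPow m κ) := by
  unfold sigmaPow
  fun_prop

end

theorem lemma1 (m κ : ℂ) (hm0 : 0 < |m.re|) (hm1 : |m.re| < 1) (hκ : ¬ IsExceptionalPair m κ) :
    IsHankelExtension (-1) m κ (hankelTransform (-1) m κ) ∧
    IsHankelExtension 1 (1 / 2) 0 (hankelTransform 1 (1 / 2) 0) ∧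
    Nonempty (SpectralRep dilationGenerator) ∧
    Nonempty (SpectralRep dirichletLaplacian) ∧
    ∀ (A : SpectralRep dilationGenerator) (HD : SpectralRep dirichletLaplacian),
      (waveMinus m κ (1 / 2) 0 : L2Pos →ₗ[ℂ] L2Pos).toPMap ⊤ =
        Complex.exp (Complex.I * (Real.pi / 4)) •
          compUnbounded (A.fc (Xi (1 / 2)))
            (compUnbounded
              (A.fc (fun t => Xi m (-t)) -
                compUnbounded (A.fc (fun t => Xi (-m) (-t))) (HD.fc (sigmaPow m κ)))
              (HD.fc (lastFactor m κ))) := by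
  have hm : -1 < m.re := (abs_lt.1 hm1).1
  have hm' : -1 < (-m).re := by
    rw [Complex.neg_re]
    linarith [(abs_lt.1 hm1).2]
  have hF := isHankelExtension_hankelMinus hm0 hκ hm hm'
  have hS := isHankelExtension_smul_sineTransform
  refine ⟨hF.hankelTransform, hS.hankelTransform, ⟨dilationRep⟩, ⟨dirichletRep⟩, fun A HD => ?_⟩
  set c := Complex.exp (Complex.I * (Real.pi / 4)) with hc
  -- `q` is the last factor as a function of `H_D`, and `p = ς (H_D / 4)^m q` is bounded, so that
  -- the range of `q` is contained in the domain of `(H_D / 4)^m`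
  set s1 := isSymbol_lastFactor hm0 hκ
  set s2 := isSymbol_sigmaPow_mul_lastFactor hm0 hκ
  let q : L2Pos →L[ℂ] L2Pos := sineTransform ∘L mulL2 volPos _ s1 ∘L sineTransform
  let p : L2Pos →L[ℂ] L2Pos := sineTransform ∘L mulL2 volPos _ s2 ∘L sineTransform
  have hVq : ∀ f, dirichletRep.V (q f) = mulL2 volPos _ s1 (sineTransform f) := fun f =>
    sineTransform_sineTransform _
  have hVp : ∀ f, dirichletRep.V (p f) = mulL2 volPos _ s2 (sineTransform f) := fun f =>
    sineTransform_sineTransform _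
  have hq : HD.fc (lastFactor m κ) = (q : L2Pos →ₗ[ℂ] L2Pos).toPMap ⊤ := by
    rw [HD.fc_congr dirichletRep (measurable_lastFactor m κ)]
    refine dirichletRep.fc_eq_toPMap _ fun f => ?_
    change (dirichletRep.V (q f) : ℝ → ℂ) =ᵐ[volPos] _
    rw [hVq]
    exact mulL2_ae s1 (sineTransform f)
  have hp : ∀ f, (q f, p f) ∈ (HD.fc (sigmaPow m κ)).graph := by
    intro f
    rw [HD.fc_congr dirichletRep (measurable_sigmaPow m κ), SpectralRep.mem_graph_fc, hVq, hVp]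
    change (mulL2 volPos _ s2 (sineTransform f) : ℝ → ℂ) =ᵐ[volPos] fun x =>
      sigmaPow m κ (x ^ 2) * mulL2 volPos _ s1 (sineTransform f) x
    filter_upwards [mulL2_ae s1 (sineTransform f), mulL2_ae s2 (sineTransform f)] with x h1 h2
    rw [h1, h2, mul_assoc]
  rw [A.fc_eq_bfc dilationRep (isSymbol_Xi neg_one_lt_re_half),
    A.fc_eq_bfc dilationRep ((isSymbol_Xi hm).comp measurable_neg),
    A.fc_eq_bfc dilationRep ((isSymbol_Xi hm').comp measurable_neg), hq,
    compUnbounded_eq_toPMap _ _ _ _ (p : L2Pos →ₗ[ℂ] L2Pos) _ hp]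
  rw [smul_toPMap_top]
  refine congrArg (fun B : L2Pos →ₗ[ℂ] L2Pos => B.toPMap ⊤) (LinearMap.ext fun f => ?_)
  have hW : waveMinus m κ (1 / 2) 0 f = hankelMinus hm0 hκ hm hm' (c • sineTransform f) := by
    rw [waveMinus, hF.hankelTransform_eq, hS.hankelTransform_eq, transposeOp_smul_sineTransform]
    rfl
  exact hW.trans (hankelMinus_smul_sineTransform hm0 hκ hm hm' c f)
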